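/- For $n\ge m$ let $G(n,m)$ be the Grassmannian of $m$-dimensional linear subspaces of $\mathbb R^n$. An $m$-varifold $V$ on $\mathbb R^n$ is a Radon measure on $\mathbb R^n\times G(n,m)$; its weight is $\mu_V(A)=V(A\times G(n,m))$. It is rectifiable if $\mu_V$ is an $m$-rectifiable measure and $V(B)=\mu_V\{x:(x,T_x)\in B\}$, where $T_x$ is the approximate tangent plane of $\mu_V$ at $x$; it is stationary if $\int \operatorname{div}_S X(x)\,dV(x,S)=0$ for every smooth compactly supported vector field $X$ on $\mathbb R^n$. For $t>0$ let $V_{x,t}(A)=t^{-m}\,V\{(y,S):((y-x)/t,S)\in A\}$. A varifold $C$ is a tangent varifold to $V$ at $x$ if $V_{x,t_i}\to C$ (tested against continuous functions with compact support) for some $t_i>0$, $t_i\to0$; $C$ is conical if $C_{0,t}=C$ for all $t>0$. The density is $\theta^m(V,x)=\lim_{r\to0+}r^{-m}\mu_V(\{y:|y-x|\le r\})$. Let $J_{13}^{24}(x_1,x_2,x_3,x_4)=(-x_3,-x_4,x_1,x_2)$, $J_{12}^{34}(x_1,x_2,x_3,x_4)=(-x_2,x_1,-x_4,x_3)$, let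 $K=\{x\in\mathbb R^4: x_1x_4=x_2x_3\}=\{(ac,bc,ad,bd):a,b,c,d\in\mathbb R\}$, and for $J\in\{J_{13}^{24},J_{12}^{34}\}$ let $$G^0_J=\{(x,S): x\in K\setminus\{0\},\ S=\operatorname{span}\{x,Jx\}\}\subset\mathbb R^4\times G(4,2).$$ **Theorem.** There is a stationary rectifiable $2$-varifold $V$ on $\mathbb R^4$ such that the density $\theta^2(V,0)$ exists, $0<\theta^2(V,0)<\infty$, and $V$ has at least two different conical tangent varifolds at $0$. More precisely, the sets $G^0_{J_{13}^{24}}$ and $G^0_{J_{12}^{34}}$ are disjoint, and $V$ has conical tangent varifolds $C_1\ne C_2$ at $0$, both of positive mass, such that $C_1$ vanishes on the complement of $G^0_{J_{13}^{24}}$ and $C_2$ vanishes on the complement of $G^0_{J_{12}^{34}}$. -/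

import Mathlib

open MeasureTheory Filter Topology
open scoped ENNReal NNReal ContDiff

/-- The Grassmannian `G(n,m)` of `m`-dimensional linear subspaces of `ℝⁿ`. -/
def Gr (n m : ℕ) : Type :=
  {S : Submodule ℝ (EuclideanSpace ℝ (Fin n)) // Module.finrank ℝ S = m}

/-- The usual topology of the Grassmannian: a subspace is identified with the orthogonal projection
onto it. -/
noncomputable instance Gr.instTopologicalSpace (n m : ℕ) : TopologicalSpace (Gr n m) :=
  TopologicalSpace.induced (fun S : Gr n m => S.1.starProjection) inferInstance

noncomputable instance Gr.instMeasurableSpace (n m : ℕ) : MeasurableSpace (Gr n m) := borel (Gr n m)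

instance Gr.instBorelSpace (n m : ℕ) : BorelSpace (Gr n m) := ⟨rfl⟩

/-- An `m`-varifold on `ℝⁿ`: a Radon measure on `ℝⁿ × G(n,m)`.  As `ℝⁿ × G(n,m)` is locally compact,
metrizable and separable, a Borel measure on it is Radon as soon as compact sets have finite
measure. -/
structure Varifold (n m : ℕ) where
  /-- the underlying measure -/
  toMeasure : Measure (EuclideanSpace ℝ (Fin n) × Gr n m)
  /-- compact sets have finite measure -/
  finite_on_compacts : IsFiniteMeasureOnCompacts toMeasure

/-- `T` is the approximate tangent plane of the measure `μ` at `x`: the blow-ups of `μ` at `x`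
converge weakly to a positive multiple of the `m`-dimensional Hausdorff measure on `T`. -/
def IsApproxTangentPlane {n m : ℕ} (μ : Measure (EuclideanSpace ℝ (Fin n)))
    (x : EuclideanSpace ℝ (Fin n)) (T : Gr n m) : Prop :=
  ∃ θ : ℝ, 0 < θ ∧ ∀ f : EuclideanSpace ℝ (Fin n) → ℝ, Continuous f → HasCompactSupport f →
    Tendsto (fun t : ℝ => (t ^ m)⁻¹ * ∫ y, f (t⁻¹ • (y - x)) ∂μ) (𝓝[>] 0)
      (𝓝 (θ * ∫ y in (T.1 : Set (EuclideanSpace ℝ (Fin n))), f y ∂(μH[(m : ℝ)])))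

/-- `μ` is an `m`-rectifiable measure on `ℝⁿ`: it is absolutely continuous with respect to the
`m`-dimensional Hausdorff measure and carried by countably many Lipschitz images of subsets
of `ℝᵐ`. -/
def IsRectifiableMeasure {n : ℕ} (m : ℕ) (μ : Measure (EuclideanSpace ℝ (Fin n))) : Prop :=
  μ ≪ μH[(m : ℝ)] ∧
    ∃ (φ : ℕ → EuclideanSpace ℝ (Fin m) → EuclideanSpace ℝ (Fin n))
      (A : ℕ → Set (EuclideanSpace ℝ (Fin m))),
      (∀ i, ∃ K : ℝ≥0, LipschitzOnWith K (φ i) (A i)) ∧ μ (⋃ i, φ i '' A i)ᶜ = 0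

/-- `μ` has `k`-dimensional density `θ` at `x`:
`θ = lim_{r → 0+} μ (closed ball of radius r about x) / r ^ k` (the limit exists). -/
def HasDensityAt {n : ℕ} (μ : Measure (EuclideanSpace ℝ (Fin n))) (k : ℕ)
    (x : EuclideanSpace ℝ (Fin n)) (θ : ℝ≥0∞) : Prop :=
  Tendsto (fun r : ℝ => μ (Metric.closedBall x r) / ENNReal.ofReal (r ^ k)) (𝓝[>] 0) (𝓝 θ)

/-- The divergence at `x` of the vector field `X` along the subspace `S`, that is
`∑ i, ⟪τ i, DX(x) (τ i)⟫` for any orthonormal basis `τ` of `S`. -/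
noncomputable def divAlong {n m : ℕ} (S : Gr n m)
    (X : EuclideanSpace ℝ (Fin n) → EuclideanSpace ℝ (Fin n)) (x : EuclideanSpace ℝ (Fin n)) : ℝ :=
  LinearMap.trace ℝ (EuclideanSpace ℝ (Fin n))
    ((S.1.starProjection ∘L fderiv ℝ X x : EuclideanSpace ℝ (Fin n) →L[ℝ] EuclideanSpace ℝ (Fin n)) :
      EuclideanSpace ℝ (Fin n) →ₗ[ℝ] EuclideanSpace ℝ (Fin n))

namespace Varifold

/-- The weight `μ_V` of a varifold `V`: `μ_V A = V (A × G(n,m))`. -/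
noncomputable def weight {n m : ℕ} (V : Varifold n m) : Measure (EuclideanSpace ℝ (Fin n)) :=
  V.toMeasure.map Prod.fst

/-- `V` is rectifiable: its weight is an `m`-rectifiable measure, and
`V B = μ_V {x | (x, T x) ∈ B}` where `T x` is the approximate tangent plane of `μ_V` at `x`. -/
def IsRectifiable {n m : ℕ} (V : Varifold n m) : Prop :=
  IsRectifiableMeasure m V.weight ∧
    ∃ T : EuclideanSpace ℝ (Fin n) → Gr n m, AEMeasurable T V.weight ∧
      (∀ᵐ x ∂V.weight, IsApproxTangentPlane V.weight x (T x)) ∧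
      V.toMeasure = V.weight.map (fun x => (x, T x))

/-- The first variation `δV(X)`. -/
noncomputable def firstVariation {n m : ℕ} (V : Varifold n m)
    (X : EuclideanSpace ℝ (Fin n) → EuclideanSpace ℝ (Fin n)) : ℝ :=
  ∫ p, divAlong p.2 X p.1 ∂V.toMeasure

/-- `V` is stationary: the first variation vanishes on all smooth compactly supported vector
fields. -/
def IsStationary {n m : ℕ} (V : Varifold n m) : Prop :=
  ∀ X : EuclideanSpace ℝ (Fin n) → EuclideanSpace ℝ (Fin n),
    ContDiff ℝ ∞ X → HasCompactSupport X → V.firstVariation X = 0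

/-- `C` is a tangent varifold to `V` at `x`: for some sequence `t i → 0+`, the blow-ups of `V` at
`x` with the factors `t i` converge weakly to `C`. -/
def IsTangentAt {n m : ℕ} (C V : Varifold n m) (x : EuclideanSpace ℝ (Fin n)) : Prop :=
  ∃ t : ℕ → ℝ, (∀ i, 0 < t i) ∧ Tendsto t atTop (𝓝 0) ∧
    ∀ f : EuclideanSpace ℝ (Fin n) × Gr n m → ℝ, Continuous f → HasCompactSupport f →
      Tendsto (fun i => (t i ^ m)⁻¹ * ∫ p, f ((t i)⁻¹ • (p.1 - x), p.2) ∂V.toMeasure) atTop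
        (𝓝 (∫ p, f p ∂C.toMeasure))

/-- `C` is conical: it is invariant under the push-forward of varifolds by each homothety
`y ↦ y / t`, `t > 0`. -/
def IsConical {n m : ℕ} (C : Varifold n m) : Prop :=
  ∀ t : ℝ, 0 < t →
    ENNReal.ofReal ((t ^ m)⁻¹) • C.toMeasure.map (fun p => (t⁻¹ • p.1, p.2)) = C.toMeasure

end Varifold

/-- The rotation of `ℝ⁴` with `e₁ ↦ e₃`, `e₂ ↦ e₄`, `e₃ ↦ -e₁`, `e₄ ↦ -e₂`. -/
def J1324 (x : EuclideanSpace ℝ (Fin 4)) : EuclideanSpace ℝ (Fin 4) :=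
  !₂[-x 2, -x 3, x 0, x 1]

/-- The rotation of `ℝ⁴` with `e₁ ↦ e₂`, `e₃ ↦ e₄`, `e₂ ↦ -e₁`, `e₄ ↦ -e₃`. -/
def J1234 (x : EuclideanSpace ℝ (Fin 4)) : EuclideanSpace ℝ (Fin 4) :=
  !₂[-x 1, x 0, -x 3, x 2]

/-- The pairs `(x, S)` where `x ≠ 0` lies on the three-dimensional cone
`{(ac, bc, ad, bd)} = {x₁ x₄ = x₂ x₃}` and `S` is spanned by `x` and `J x`. -/
def radialSet (J : EuclideanSpace ℝ (Fin 4) → EuclideanSpace ℝ (Fin 4)) :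
    Set (EuclideanSpace ℝ (Fin 4) × Gr 4 2) :=
  {p | p.1 ≠ 0 ∧ p.1 0 * p.1 3 = p.1 1 * p.1 2 ∧ p.2.1 = Submodule.span ℝ {p.1, J p.1}}

open scoped ComplexConjugate

/-! Write ℝ⁴ = ℝ² ⊗ ℝ², so that K consists of the rank-one tensors u ⊗ w, with |u| = 1 and w ∈ ℂ.
The surface swept out by all u over a curve w(t) has area π times the length of the planar curve
z(t) = w(t)²: its circles have radius |w|, and |dz| = 2|w||dw|. So straight segments in the z-plane
that avoid 0 lift to minimal surfaces, and balanced weighted networks of segments lift to stationary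
varifolds (`firstVariation_edge`). Radial segments lift to pieces of 2-planes, which at x are
spanned by x and `J1234 x`. After interchanging the two tensor factors by an isometry, the planes
are spanned by x and `J1324 x`.

The two kinds of network are joined along a torus |z| = σ, that is |u| = 1, |w|² = σ, which the
interchange preserves. If infinitely many segments end on the torus so that their radial force is
equidistributed, the interchanged family can take up this force on the other side
(`torusForce_swapFactors`). To reach equidistribution, 2^M rays are refined to 2^(M+1) rays inside a
layer of relative thickness of order 2^(-M), turning by the angle π/2^M (`isFlow_inLayer`,
`isFlow_outLayer`). The relative change of flux in such a layer is O(2^(-M)), hence summable, so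
infinitely many layers fit into a thin shell with fluxes converging to a positive limit
(`exists_inTree`, `exists_outTree`). The ring forces are Riemann sums and converge to the force on
the torus (`tendsto_ringAvg`).

Tori are placed at the radii σ = 1/(n+1)!, the factors being interchanged at each of them
(`exists_isTwisted`). Between consecutive tori lie long shells of equally spaced rays, whose number
and logarithmic length tend to infinity. The force on a ring at |z| = s is O(√s), so nothing is
concentrated at the origin. The mass in |x|² ≤ s is π · flux · s in the radial shells and nearly so
in the thin transition shells. As the flux tends to 1, the density exists and equals π
(`IsTwisted.tendsto_ratio`). Blow-ups at the logarithmic midpoints of the radial shells see only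
equidistributed rays and converge to a rotationally invariant cone; the parity of the shell decides
which factor it uses (`IsTwisted.tendsto_blowup`). -/

abbrev E4 := EuclideanSpace ℝ (Fin 4)

/-! ### Planes spanned by orthogonal pairs in the Grassmannian G(4,2) -/

theorem Gr.isInducing_starProjection (n m : ℕ) :
    IsInducing (fun S : Gr n m => S.1.starProjection) := ⟨rfl⟩

instance Gr.instSecondCountable (n m : ℕ) : SecondCountableTopology (Gr n m) :=
  (Gr.isInducing_starProjection n m).secondCountableTopology

theorem finrank_span_pair_of_orthogonal {E : Type*} [NormedAddCommGroup E]
    [InnerProductSpace ℝ E] {v w : E} (hv : v ≠ 0) (hw : w ≠ 0) (h : inner ℝ v w = 0) :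
    Module.finrank ℝ (Submodule.span ℝ {v, w}) = 2 := by
  have hli : LinearIndependent ℝ ![v, w] := by
    refine linearIndependent_of_ne_zero_of_inner_eq_zero (𝕜 := ℝ) ?_ ?_
    · intro i; fin_cases i <;> simpa
    · intro i j hij
      fin_cases i <;> fin_cases j <;> simp_all [real_inner_comm]
  have := finrank_span_eq_card hli
  rw [Matrix.range_cons, Matrix.range_cons, Matrix.range_empty, Set.union_empty] at this
  exact this

/-- The coordinate plane spanned by the first two basis vectors. -/
noncomputable def Gr.coordPlane : Gr 4 2 :=
  ⟨Submodule.span ℝ {EuclideanSpace.single 0 1, EuclideanSpace.single 1 1}, by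
    refine finrank_span_pair_of_orthogonal ?_ ?_ ?_
    · rw [← norm_ne_zero_iff]; simp
    · rw [← norm_ne_zero_iff]; simp
    · simp [EuclideanSpace.inner_single_left]⟩

/-- The pairs of nonzero orthogonal vectors. -/
def orthoPairs : Set (E4 × E4) := {v | v.1 ≠ 0 ∧ v.2 ≠ 0 ∧ inner ℝ v.1 v.2 = 0}

open Classical in
/-- The plane spanned by two orthogonal nonzero vectors, with a default value for other pairs. -/
noncomputable def Gr.mk2 (v w : E4) : Gr 4 2 :=
  if h : (v, w) ∈ orthoPairs then
    ⟨Submodule.span ℝ {v, w}, finrank_span_pair_of_orthogonal h.1 h.2.1 h.2.2⟩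
  else Gr.coordPlane

theorem Gr.mk2_val {v w : E4} (hv : v ≠ 0) (hw : w ≠ 0) (h : inner ℝ v w = 0) :
    (Gr.mk2 v w).1 = Submodule.span ℝ {v, w} := by
  have : Gr.mk2 v w = ⟨_, finrank_span_pair_of_orthogonal hv hw h⟩ :=
    dif_pos ⟨hv, hw, h⟩
  rw [this]

theorem starProjection_span_pair {E : Type*} [NormedAddCommGroup E]
    [InnerProductSpace ℝ E] [FiniteDimensional ℝ E] {v w : E} (hv : v ≠ 0) (hw : w ≠ 0)
    (h : inner ℝ v w = 0) :
    (Submodule.span ℝ {v, w}).starProjection =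
      (‖v‖ ^ 2)⁻¹ • InnerProductSpace.rankOne ℝ v v +
        (‖w‖ ^ 2)⁻¹ • InnerProductSpace.rankOne ℝ w w := by
  have h' : inner ℝ w v = 0 := by rw [real_inner_comm]; exact h
  ext1 x
  apply Submodule.eq_starProjection_of_mem_of_inner_eq_zero
  · simp only [add_apply, smul_apply,
      InnerProductSpace.rankOne_apply]
    refine add_mem ?_ ?_ <;>
    · refine Submodule.smul_mem _ _ (Submodule.smul_mem _ _ (Submodule.subset_span ?_))
      simp
  · intro y hy
    have hv2 : ‖v‖ ^ 2 ≠ 0 := by simpa using hv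
    have hw2 : ‖w‖ ^ 2 ≠ 0 := by simpa using hw
    obtain ⟨a, b, rfl⟩ := Submodule.mem_span_pair.1 hy
    simp only [add_apply, smul_apply,
      InnerProductSpace.rankOne_apply, inner_sub_left, inner_add_left, inner_add_right,
      real_inner_smul_left, real_inner_smul_right, h, h', real_inner_self_eq_norm_sq]
    rw [real_inner_comm v x, real_inner_comm w x]
    field_simp
    ring

theorem Gr.mk2_starProjection {v w : E4} (hv : v ≠ 0) (hw : w ≠ 0) (h : inner ℝ v w = 0) :
    (Gr.mk2 v w).1.starProjection =
      (‖v‖ ^ 2)⁻¹ • InnerProductSpace.rankOne ℝ v v +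
        (‖w‖ ^ 2)⁻¹ • InnerProductSpace.rankOne ℝ w w := by
  rw [← starProjection_span_pair hv hw h]
  have := Gr.mk2_val hv hw h
  congr!

theorem measurableSet_orthoPairs : MeasurableSet orthoPairs := by
  refine ((isClosed_singleton (x := (0 : E4))).preimage
    continuous_fst).isOpen_compl.measurableSet.inter
    (((isClosed_singleton (x := (0 : E4))).preimage
    continuous_snd).isOpen_compl.measurableSet.inter ?_)
  have hc : Continuous fun v : E4 × E4 => (inner ℝ v.1 v.2 : ℝ) := by fun_prop
  exact ((isClosed_singleton (x := (0 : ℝ))).preimage hc).measurableSet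

theorem Gr.continuousOn_mk2 : ContinuousOn (fun v : E4 × E4 => Gr.mk2 v.1 v.2) orthoPairs := by
  rw [(Gr.isInducing_starProjection 4 2).continuousOn_iff]
  have : ContinuousOn (fun v : E4 × E4 => (‖v.1‖ ^ 2)⁻¹ • InnerProductSpace.rankOne ℝ v.1 v.1 +
        (‖v.2‖ ^ 2)⁻¹ • InnerProductSpace.rankOne ℝ v.2 v.2) orthoPairs := by
    have hr : Continuous fun v : E4 => InnerProductSpace.rankOne ℝ v v :=
      (InnerProductSpace.rankOne ℝ (E := E4) (F := E4)).continuous.clm_apply continuous_id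
    have h1 : Continuous fun v : E4 × E4 => ‖v.1‖ ^ 2 := by fun_prop
    have h2 : Continuous fun v : E4 × E4 => ‖v.2‖ ^ 2 := by fun_prop
    refine ContinuousOn.add (ContinuousOn.smul (h1.continuousOn.inv₀ ?_)
      (hr.comp continuous_fst).continuousOn)
      (ContinuousOn.smul (h2.continuousOn.inv₀ ?_)
      (hr.comp continuous_snd).continuousOn)
    · rintro v ⟨h, -, -⟩; simpa using h
    · rintro v ⟨-, h, -⟩; simpa using h
  refine this.congr ?_
  rintro v ⟨h1, h2, h3⟩
  exact Gr.mk2_starProjection h1 h2 h3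

theorem Gr.measurable_mk2 : Measurable fun v : E4 × E4 => Gr.mk2 v.1 v.2 := by
  classical
  have h := ContinuousOn.measurable_piecewise (s := orthoPairs) Gr.continuousOn_mk2
    (continuous_const (y := Gr.coordPlane)).continuousOn measurableSet_orthoPairs
  convert h using 1
  ext1 v
  by_cases hv : v ∈ orthoPairs
  · rw [Set.piecewise_eq_of_mem _ _ _ hv]
  · rw [Set.piecewise_eq_of_notMem _ _ _ hv]
    exact dif_neg hv

/-! ### The divergence along a plane -/

theorem divAlong_eq_of_orthogonal {S : Gr 4 2} {v w : E4} (hv : v ≠ 0) (hw : w ≠ 0)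
    (h : inner ℝ v w = 0) (hS : S.1 = Submodule.span ℝ {v, w}) (X : E4 → E4) (x : E4) :
    divAlong S X x = (‖v‖ ^ 2)⁻¹ * inner ℝ v (fderiv ℝ X x v) +
      (‖w‖ ^ 2)⁻¹ * inner ℝ w (fderiv ℝ X x w) := by
  have hp : S.1.starProjection = (‖v‖ ^ 2)⁻¹ • InnerProductSpace.rankOne ℝ v v +
        (‖w‖ ^ 2)⁻¹ • InnerProductSpace.rankOne ℝ w w := by
    rw [← starProjection_span_pair hv hw h]
    congr!
  rw [divAlong, hp]
  have key : ∀ u : E4, LinearMap.trace ℝ E4 ((InnerProductSpace.rankOne ℝ u u ∘L fderiv ℝ X x :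
      E4 →L[ℝ] E4) : E4 →ₗ[ℝ] E4) = inner ℝ u (fderiv ℝ X x u) := by
    intro u
    rw [InnerProductSpace.rankOne_comp, InnerProductSpace.trace_rankOne,
      ContinuousLinearMap.adjoint_inner_left]
  rw [ContinuousLinearMap.add_comp, ContinuousLinearMap.smul_comp, ContinuousLinearMap.smul_comp]
  simp only [ContinuousLinearMap.toLinearMap_add, ContinuousLinearMap.toLinearMap_smul, map_add, map_smul, key,
    smul_eq_mul]

theorem continuous_divAlong {X : E4 → E4} (hX : ContDiff ℝ ∞ X) :
    Continuous fun p : E4 × Gr 4 2 => divAlong p.2 X p.1 := by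
  have h1 : Continuous fun p : E4 × Gr 4 2 => p.2.1.starProjection ∘L fderiv ℝ X p.1 := by
    have h2 : Continuous fun p : E4 × Gr 4 2 => p.2.1.starProjection :=
      (Gr.isInducing_starProjection 4 2).continuous.comp continuous_snd
    exact h2.clm_comp ((hX.continuous_fderiv (by simp)).comp continuous_fst)
  let φ : (E4 →L[ℝ] E4) →ₗ[ℝ] ℝ := LinearMap.trace ℝ E4 ∘ₗ ContinuousLinearMap.coeLM ℝ
  exact φ.continuous_of_finiteDimensional.comp h1

/-- Projections have norm at most 1, so one bound serves all planes; it makes the first variation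
integrable against every finite measure. -/
theorem exists_bound_divAlong {X : E4 → E4} (hX : ContDiff ℝ ∞ X) (hc : HasCompactSupport X) :
    ∃ C : ℝ, ∀ (S : Gr 4 2) (x : E4), |divAlong S X x| ≤ C := by
  let φ : (E4 →L[ℝ] E4) →ₗ[ℝ] ℝ := LinearMap.trace ℝ E4 ∘ₗ ContinuousLinearMap.coeLM ℝ
  let ψ : (E4 →L[ℝ] E4) →L[ℝ] ℝ := LinearMap.toContinuousLinearMap φ
  obtain ⟨D, hD⟩ := (hc.fderiv (𝕜 := ℝ)).exists_bound_of_continuous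
    (hX.continuous_fderiv (by simp))
  refine ⟨‖ψ‖ * D, fun S x => ?_⟩
  have h1 : |divAlong S X x| ≤ ‖ψ‖ * ‖S.1.starProjection ∘L fderiv ℝ X x‖ :=
    ψ.le_opNorm (S.1.starProjection ∘L fderiv ℝ X x)
  refine h1.trans (mul_le_mul_of_nonneg_left ?_ (norm_nonneg ψ))
  refine (ContinuousLinearMap.opNorm_comp_le _ _).trans ?_
  have h2 : ‖S.1.starProjection‖ ≤ 1 := S.1.starProjection_norm_le
  nlinarith [hD x, norm_nonneg (fderiv ℝ X x), norm_nonneg S.1.starProjection]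

theorem divAlong_eq_zero {X : E4 → E4} {x : E4} (hx : x ∉ tsupport X) (S : Gr 4 2) :
    divAlong S X x = 0 := by
  have : fderiv ℝ X x = 0 := by
    by_contra h
    exact hx (support_fderiv_subset ℝ h)
  simp [divAlong, this]

/-! ### Rank-one tensors and the squaring map w ↦ w² -/

/-- The tensor `(cos α, sin α) ⊗ (Re w, Im w)` in `ℝ⁴ = ℝ² ⊗ ℝ²`. -/
noncomputable def tens (α : ℝ) (w : ℂ) : E4 :=
  !₂[Real.cos α * w.re, Real.sin α * w.re, Real.cos α * w.im, Real.sin α * w.im]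

theorem tens_add (α : ℝ) (w v : ℂ) : tens α (w + v) = tens α w + tens α v := by
  ext i; fin_cases i <;> simp [tens, mul_add]

theorem tens_smul (α r : ℝ) (w : ℂ) : tens α (r * w) = r • tens α w := by
  ext i; fin_cases i <;> simp [tens] <;> ring

theorem tens_neg (α : ℝ) (w : ℂ) : tens α (-w) = -tens α w := by
  ext i; fin_cases i <;> simp [tens]

theorem tens_add_pi (α : ℝ) (w : ℂ) : tens (α + Real.pi) w = -tens α w := by
  ext i; fin_cases i <;> simp [tens]

theorem tens_add_two_pi (α : ℝ) (w : ℂ) : tens (α + 2 * Real.pi) w = tens α w := by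
  ext i; fin_cases i <;> simp [tens]

theorem inner_tens (α : ℝ) (w v : ℂ) :
    inner ℝ (tens α w) (tens α v) = w.re * v.re + w.im * v.im := by
  simp [tens, PiLp.inner_apply, Fin.sum_univ_four]
  linear_combination (w.re * v.re + w.im * v.im) * Real.sin_sq_add_cos_sq α

/-- Turning u by a right angle gives orthogonality whatever w and v are. Therefore the derivatives
in u and in w of a lifted curve are always orthogonal. -/
theorem inner_tens_add_pi_div_two (α : ℝ) (w v : ℂ) :
    inner ℝ (tens (α + Real.pi / 2) w) (tens α v) = 0 := by
  simp [tens, PiLp.inner_apply, Fin.sum_univ_four, Real.cos_add_pi_div_two,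
    Real.sin_add_pi_div_two]
  ring

theorem norm_sq_tens (α : ℝ) (w : ℂ) : ‖tens α w‖ ^ 2 = ‖w‖ ^ 2 := by
  rw [← real_inner_self_eq_norm_sq, inner_tens, Complex.sq_norm, Complex.normSq_apply]

theorem norm_tens (α : ℝ) (w : ℂ) : ‖tens α w‖ = ‖w‖ := by
  have := norm_sq_tens α w
  rwa [sq_eq_sq₀ (norm_nonneg _) (norm_nonneg _)] at this

theorem tens_ne_zero {α : ℝ} {w : ℂ} (hw : w ≠ 0) : tens α w ≠ 0 := by
  rw [← norm_ne_zero_iff, norm_tens]; simpa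

theorem contDiff_tens {n : ℕ∞ω} : ContDiff ℝ n fun p : ℝ × ℂ => tens p.1 p.2 := by
  rw [contDiff_euclidean]
  have hre : ContDiff ℝ n fun p : ℝ × ℂ => p.2.re := Complex.reCLM.contDiff.comp contDiff_snd
  have him : ContDiff ℝ n fun p : ℝ × ℂ => p.2.im := Complex.imCLM.contDiff.comp contDiff_snd
  have hc : ContDiff ℝ n fun p : ℝ × ℂ => Real.cos p.1 := Real.contDiff_cos.comp contDiff_fst
  have hs : ContDiff ℝ n fun p : ℝ × ℂ => Real.sin p.1 := Real.contDiff_sin.comp contDiff_fst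
  intro i
  fin_cases i
  exacts [hc.mul hre, hs.mul hre, hc.mul him, hs.mul him]

theorem continuous_tens : Continuous fun p : ℝ × ℂ => tens p.1 p.2 :=
  (contDiff_tens (n := 0)).continuous

theorem hasDerivAt_euclidean {f : ℝ → E4} {f' : E4} {t : ℝ}
    (h : ∀ i, HasDerivAt (fun s => f s i) (f' i) t) : HasDerivAt f f' t :=
  ((PiLp.continuousLinearEquiv 2 ℝ (fun _ : Fin 4 => ℝ)).symm.hasFDerivAt).comp_hasDerivAt t
    (hasDerivAt_pi.2 h)

theorem hasDerivAt_tens_left (α : ℝ) (w : ℂ) :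
    HasDerivAt (fun a => tens a w) (tens (α + Real.pi / 2) w) α := by
  refine hasDerivAt_euclidean fun i => ?_
  have hc := (Real.hasDerivAt_cos α)
  have hs := (Real.hasDerivAt_sin α)
  fin_cases i <;> simp only [tens, Real.cos_add_pi_div_two, Real.sin_add_pi_div_two]
  exacts [hc.mul_const _, hs.mul_const _, hc.mul_const _, hs.mul_const _]

theorem hasDerivAt_tens_right (α : ℝ) {w : ℝ → ℂ} {w' : ℂ} {t : ℝ} (h : HasDerivAt w w' t) :
    HasDerivAt (fun s => tens α (w s)) (tens α w') t := by
  refine hasDerivAt_euclidean fun i => ?_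
  have hr : HasDerivAt (fun s => (w s).re) w'.re t :=
    Complex.reCLM.hasFDerivAt.comp_hasDerivAt t h
  have hi : HasDerivAt (fun s => (w s).im) w'.im t :=
    Complex.imCLM.hasFDerivAt.comp_hasDerivAt t h
  fin_cases i
  exacts [hr.const_mul _, hr.const_mul _, hi.const_mul _, hi.const_mul _]

/-- The quadratic map sending `u ⊗ w`, `‖u‖ = 1`, to `w ^ 2`. -/
noncomputable def hopf (y : E4) : ℂ :=
  ⟨y 0 ^ 2 + y 1 ^ 2 - y 2 ^ 2 - y 3 ^ 2, 2 * (y 0 * y 2 + y 1 * y 3)⟩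

theorem hopf_tens (α : ℝ) (w : ℂ) : hopf (tens α w) = w ^ 2 := by
  apply Complex.ext <;> simp [hopf, tens, pow_two]
  · linear_combination (w.re ^ 2 - w.im ^ 2) * Real.sin_sq_add_cos_sq α
  · linear_combination (2 * w.re * w.im) * Real.sin_sq_add_cos_sq α

theorem continuous_hopf : Continuous hopf := by
  have : Continuous fun y : E4 => ((y 0 ^ 2 + y 1 ^ 2 - y 2 ^ 2 - y 3 ^ 2 : ℝ) : ℂ) +
      ((2 * (y 0 * y 2 + y 1 * y 3) : ℝ) : ℂ) * Complex.I := by fun_prop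
  convert this using 2 with y
  apply Complex.ext
  · rw [Complex.add_re, Complex.mul_I_re, Complex.ofReal_re, Complex.ofReal_im]; simp [hopf]
  · rw [Complex.add_im, Complex.mul_I_im, Complex.ofReal_re, Complex.ofReal_im]; simp [hopf]

theorem J1234_tens (α : ℝ) (w : ℂ) : J1234 (tens α w) = tens (α + Real.pi / 2) w := by
  ext i; fin_cases i <;> simp [J1234, tens, Real.cos_add_pi_div_two, Real.sin_add_pi_div_two]

theorem J1324_tens (α : ℝ) (w : ℂ) : J1324 (tens α w) = tens α (Complex.I * w) := by
  ext i; fin_cases i <;> simp [J1324, tens]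

theorem continuous_J1234 : Continuous J1234 := by
  unfold J1234; fun_prop

theorem continuous_J1324 : Continuous J1324 := by
  unfold J1324; fun_prop

/-- The vector with `twist ζ (u ⊗ w) = u ⊗ (ζ w̄ |w|²)`. -/
noncomputable def twist (ζ : ℂ) (y : E4) : E4 :=
  (ζ * conj (hopf y)).re • y + (ζ * conj (hopf y)).im • J1324 y

theorem continuous_twist (ζ : ℂ) : Continuous (twist ζ) := by
  have h := continuous_hopf
  have h' := continuous_J1324
  unfold twist
  have h2 : Continuous fun y => ζ * conj (hopf y) := by fun_prop
  exact ((Complex.continuous_re.comp h2).smul continuous_id).add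
    ((Complex.continuous_im.comp h2).smul h')

/-- Since `hopf` yields w² and `J1324` multiplies w by i, the definition acts on w as multiplication
by ζ w̄². The result depends on the point only, not on the choice between (u, w) and (-u, -w). -/
theorem twist_tens (ζ : ℂ) (α : ℝ) (w : ℂ) :
    twist ζ (tens α w) = ‖w‖ ^ 2 • tens α (conj w * ζ) := by
  rw [twist, hopf_tens, J1324_tens, ← tens_smul, ← tens_smul, ← tens_smul, ← tens_add]
  congr 1
  set c := ζ * conj (w ^ 2) with hc
  have h1 : (c.re : ℂ) * w + c.im * (Complex.I * w) = c * w := by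
    conv_rhs => rw [← Complex.re_add_im c]
    ring
  rw [h1, hc]
  push_cast
  rw [← Complex.conj_mul']
  simp only [map_pow]
  ring

attribute [irreducible] tens hopf twist

/-- The plane spanned by the derivatives of `u ⊗ w` when `u` moves in the unit circle and `w ^ 2`
moves in the direction `ζ`, transported by the isometry `Q`. -/
noncomputable def planeField (Q : E4 ≃ₗᵢ[ℝ] E4) (ζ : ℂ) (x : E4) : Gr 4 2 :=
  Gr.mk2 (Q (J1234 (Q.symm x))) (Q (twist ζ (Q.symm x)))

theorem measurable_planeField (Q : E4 ≃ₗᵢ[ℝ] E4) (ζ : ℂ) : Measurable (planeField Q ζ) := by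
  have h1 := continuous_J1234
  have h2 := continuous_twist ζ
  have : Continuous fun x => ((Q (J1234 (Q.symm x)), Q (twist ζ (Q.symm x))) : E4 × E4) := by
    fun_prop
  exact Gr.measurable_mk2.comp this.measurable

/-- The plane field is a function on all of ℝ⁴ depending on ζ alone; this identifies it with the
tangent plane of any lifted segment of direction ζ through the point. -/
theorem planeField_tens (Q : E4 ≃ₗᵢ[ℝ] E4) {ζ : ℂ} (hζ : ζ ≠ 0) (α : ℝ) {w : ℂ} (hw : w ≠ 0) :
    (planeField Q ζ (Q (tens α w))).1 =
      Submodule.span ℝ {Q (tens (α + Real.pi / 2) w), Q (tens α (conj w * ζ))} := by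
  have hw' : conj w * ζ ≠ 0 := by simp [hw, hζ]
  rw [planeField, Q.symm_apply_apply, J1234_tens, twist_tens, Gr.mk2_val]
  · apply le_antisymm
    · rw [Submodule.span_le, Set.pair_subset_iff]
      refine ⟨Submodule.subset_span (by simp), ?_⟩
      rw [map_smul]
      exact Submodule.smul_mem _ _ (Submodule.subset_span (by simp))
    · rw [Submodule.span_le, Set.pair_subset_iff]
      refine ⟨Submodule.subset_span (by simp), ?_⟩
      have h : Q (tens α (conj w * ζ)) = (‖w‖ ^ 2)⁻¹ • Q (‖w‖ ^ 2 • tens α (conj w * ζ)) := by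
        rw [map_smul, smul_smul, inv_mul_cancel₀ (by simpa using hw), one_smul]
      rw [h]
      exact Submodule.smul_mem _ _ (Submodule.subset_span (by simp))
  · simpa using tens_ne_zero hw
  · simpa [hw] using tens_ne_zero hw'
  · rw [Q.inner_map_map, inner_smul_right, inner_tens_add_pi_div_two, mul_zero]

/-! ### Lifting a segment of the z-plane -/

/-- A branch of `t ↦ η √(p + t (q - p))`. -/
noncomputable def curve (η p q : ℂ) (t : ℝ) : ℂ :=
  η * Complex.exp (Complex.log (p + t * (q - p)) / 2)

theorem segment_re_pos {p q : ℂ} (hp : 0 < p.re) (hq : 0 < q.re) {t : ℝ}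
    (ht : t ∈ Set.Icc (0 : ℝ) 1) : 0 < (p + t * (q - p)).re := by
  simp only [Complex.add_re, Complex.mul_re, Complex.ofReal_re, Complex.ofReal_im,
    Complex.sub_re, zero_mul, sub_zero]
  nlinarith [ht.1, ht.2, mul_nonneg ht.1 hq.le, mul_nonneg (sub_nonneg.2 ht.2) hp.le,
    mul_pos hp hq]

theorem ne_zero_of_re_pos {z : ℂ} (h : 0 < z.re) : z ≠ 0 := by
  rintro rfl; simp at h

theorem curve_sq {η p q : ℂ} {t : ℝ} (h : 0 < (p + t * (q - p)).re) :
    curve η p q t ^ 2 = η ^ 2 * (p + t * (q - p)) := by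
  rw [curve, mul_pow, ← Complex.exp_nat_mul]
  congr 1
  push_cast
  rw [mul_div_cancel₀ _ two_ne_zero, Complex.exp_log (ne_zero_of_re_pos h)]

theorem curve_ne_zero {η p q : ℂ} (hη : η ≠ 0) (t : ℝ) : curve η p q t ≠ 0 :=
  mul_ne_zero hη (Complex.exp_ne_zero _)

theorem norm_curve_sq {η p q : ℂ} (hη : ‖η‖ = 1) {t : ℝ} (h : 0 < (p + t * (q - p)).re) :
    ‖curve η p q t‖ ^ 2 = ‖p + t * (q - p)‖ := by
  rw [← norm_pow, curve_sq h]; simp [hη]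

/-- Differentiating w² = η²(p + t(q - p)) gives w' = ζ/(2w) = w̄ζ/(2|w|²) with ζ = η²(q - p). -/
theorem hasDerivAt_curve {η p q : ℂ} (hη : ‖η‖ = 1) {t : ℝ} (h : 0 < (p + t * (q - p)).re) :
    HasDerivAt (curve η p q) (((2 * ‖curve η p q t‖ ^ 2)⁻¹ : ℝ) *
      (conj (curve η p q t) * (η ^ 2 * (q - p)))) t := by
  have h1 : HasDerivAt (fun s : ℝ => p + s * (q - p)) (q - p) t := by
    have : HasDerivAt (fun s : ℝ => (s : ℂ)) 1 t := Complex.ofRealCLM.hasDerivAt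
    simpa using (this.mul_const (q - p)).const_add p
  have h2 := ((h1.clog_real (Or.inl h)).div_const 2).cexp.const_mul η
  have h0 := ne_zero_of_re_pos h
  have hη0 : η ≠ 0 := by rintro rfl; simp at hη
  refine h2.congr_deriv (Eq.symm ?_)
  have hw := curve_ne_zero (p := p) (q := q) hη0 t
  have hw2 := curve_sq (η := η) h
  have hc : η * Complex.exp (Complex.log (p + t * (q - p)) / 2) = curve η p q t := rfl
  rw [← mul_assoc η, hc]
  set w := curve η p q t
  have h3 : (((2 * ‖w‖ ^ 2)⁻¹ : ℝ) : ℂ) = (2 * (conj w * w))⁻¹ := by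
    rw [Complex.conj_mul']; push_cast; rfl
  rw [h3]
  have hcw : conj w ≠ 0 := by simpa using hw
  generalize p + t * (q - p) = z at h0 hw2 ⊢
  field_simp
  linear_combination (p - q) * hw2

theorem measurable_curve (η p q : ℂ) : Measurable (curve η p q) := by
  unfold curve
  have : Measurable fun t : ℝ => Complex.log (p + t * (q - p)) :=
    Complex.measurable_log.comp (by fun_prop)
  fun_prop

theorem contDiffAt_curve {n : ℕ∞ω} {η p q : ℂ} {t : ℝ} (h : 0 < (p + t * (q - p)).re) :
    ContDiffAt ℝ n (curve η p q) t := by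
  unfold curve
  have h1 : ContDiffAt ℝ n (fun s : ℝ => p + s * (q - p)) t := by
    have : ContDiffAt ℝ n (fun s : ℝ => (s : ℂ)) t := Complex.ofRealCLM.contDiff.contDiffAt
    exact contDiffAt_const.add (this.mul contDiffAt_const)
  have h2 : ContDiffAt ℝ n Complex.log (p + t * (q - p)) :=
    (Complex.contDiffAt_log (Or.inl h)).restrict_scalars ℝ
  have h3 : ContDiffAt ℝ n (fun s : ℝ => Complex.log (p + s * (q - p))) t :=
    h2.comp (f := fun s : ℝ => p + s * (q - p)) t h1
  exact contDiffAt_const.mul ((h3.div_const 2).cexp)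

attribute [irreducible] curve planeField

/-- Parametrization of the surface lying over a segment. -/
noncomputable def surf (Q : E4 ≃ₗᵢ[ℝ] E4) (η p q : ℂ) (v : ℝ × ℝ) : E4 :=
  Q (tens v.1 (curve η p q v.2))

/-- The domain of the parametrization. -/
def box : Set (ℝ × ℝ) := Set.Icc 0 (2 * Real.pi) ×ˢ Set.Icc 0 1

theorem measurableSet_box : MeasurableSet box := measurableSet_Icc.prod measurableSet_Icc

theorem isCompact_box : IsCompact box := isCompact_Icc.prod isCompact_Icc

theorem measurable_surf (Q : E4 ≃ₗᵢ[ℝ] E4) (η p q : ℂ) : Measurable (surf Q η p q) := by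
  have h0 : Measurable fun v : ℝ × ℝ => curve η p q v.2 := (measurable_curve η p q).comp measurable_snd
  have h : Measurable fun v : ℝ × ℝ => (v.1, curve η p q v.2) := measurable_fst.prodMk h0
  have hc : Measurable fun v : ℝ × ℂ => tens v.1 v.2 := continuous_tens.measurable
  have h2 : Measurable ((fun v : ℝ × ℂ => tens v.1 v.2) ∘ fun v : ℝ × ℝ => (v.1, curve η p q v.2)) :=
    hc.comp h
  have hQ : Measurable fun x => Q x := Q.continuous.measurable
  exact hQ.comp h2

/-- The weight measure of the surface over a segment, with constant density in parameters. -/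
noncomputable def edgeWeight (Q : E4 ≃ₗᵢ[ℝ] E4) (η p q : ℂ) : Measure E4 :=
  ENNReal.ofReal (‖q - p‖ ^ 2 / 2) • (volume.restrict box).map (surf Q η p q)

/-- The varifold carried by the surface over a segment, with density the length of the segment. -/
noncomputable def edge (Q : E4 ≃ₗᵢ[ℝ] E4) (η p q : ℂ) : Measure (E4 × Gr 4 2) :=
  (edgeWeight Q η p q).map fun x => (x, planeField Q (η ^ 2 * (q - p)) x)

theorem measurable_graph (T : E4 → Gr 4 2) (hT : Measurable T) :
    Measurable fun x => (x, T x) := measurable_id.prodMk hT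

theorem integral_edge (Q : E4 ≃ₗᵢ[ℝ] E4) (η p q : ℂ) {f : E4 × Gr 4 2 → ℝ} (hf : Measurable f) :
    ∫ x, f x ∂edge Q η p q = (‖q - p‖ ^ 2 / 2) *
      ∫ v in box, f (surf Q η p q v, planeField Q (η ^ 2 * (q - p)) (surf Q η p q v)) := by
  have h1 := measurable_graph _ (measurable_planeField Q (η ^ 2 * (q - p)))
  have h2 : Measurable fun x => f (x, planeField Q (η ^ 2 * (q - p)) x) := hf.comp h1
  rw [edge, integral_map h1.aemeasurable hf.aestronglyMeasurable, edgeWeight,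
    integral_smul_measure, integral_map (measurable_surf Q η p q).aemeasurable
    h2.aestronglyMeasurable, ENNReal.toReal_ofReal (by positivity), smul_eq_mul]

/-! ### First variation of a lifted segment -/

/-- The force exerted by a vector field on the circle of all `u ⊗ w`, in the direction `w̄ ζ`. -/
noncomputable def traction (Q : E4 ≃ₗᵢ[ℝ] E4) (X : E4 → E4) (w ζ : ℂ) : ℝ :=
  ∫ α in (0 : ℝ)..2 * Real.pi, inner ℝ (X (Q (tens α w))) (Q (tens α (conj w * ζ)))

theorem continuousOn_curve {η p q : ℂ} (hp : 0 < p.re) (hq : 0 < q.re) :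
    ContinuousOn (curve η p q) (Set.Icc 0 1) := fun _ ht =>
  (contDiffAt_curve (n := 0) (segment_re_pos hp hq ht)).continuousAt.continuousWithinAt

theorem hasDerivAt_comp_of_contDiff {X : E4 → E4} (hX : ContDiff ℝ ∞ X) {c : ℝ → E4} {c' : E4}
    {t : ℝ} (h : HasDerivAt c c' t) :
    HasDerivAt (fun s => X (c s)) (fderiv ℝ X (c t) c') t :=
  ((hX.differentiable (by simp)).differentiableAt.hasFDerivAt).comp_hasDerivAt t h

theorem integral_box_of_continuousOn {f : ℝ × ℝ → ℝ} (hf : ContinuousOn f box) :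
    IntegrableOn f box ∧
    ∫ v in box, f v = ∫ α in (0 : ℝ)..2 * Real.pi, ∫ t in (0 : ℝ)..1, f (α, t) ∧
    ∫ v in box, f v = ∫ t in (0 : ℝ)..1, ∫ α in (0 : ℝ)..2 * Real.pi, f (α, t) := by
  have hi : IntegrableOn f box := hf.integrableOn_compact isCompact_box
  refine ⟨hi, ?_, ?_⟩
  · have := setIntegral_prod (μ := (volume : Measure ℝ)) (ν := (volume : Measure ℝ)) f
      (s := Set.Icc 0 (2 * Real.pi)) (t := Set.Icc 0 1) hi
    rw [intervalIntegral.integral_of_le Real.two_pi_pos.le, ← integral_Icc_eq_integral_Ioc]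
    simp_rw [intervalIntegral.integral_of_le zero_le_one, ← integral_Icc_eq_integral_Ioc]
    exact this
  · have h1 := setIntegral_prod_swap (μ := (volume : Measure ℝ)) (ν := (volume : Measure ℝ))
      (Set.Icc 0 (2 * Real.pi)) (Set.Icc 0 1) f
    have hi2 : IntegrableOn (fun z : ℝ × ℝ => f z.swap)
        (Set.Icc 0 1 ×ˢ Set.Icc 0 (2 * Real.pi)) := by
      apply ContinuousOn.integrableOn_compact (isCompact_Icc.prod isCompact_Icc)
      exact hf.comp continuous_swap.continuousOn fun z hz => ⟨hz.2, hz.1⟩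
    have := setIntegral_prod (μ := (volume : Measure ℝ)) (ν := (volume : Measure ℝ))
      (fun z : ℝ × ℝ => f z.swap) hi2
    rw [intervalIntegral.integral_of_le zero_le_one, ← integral_Icc_eq_integral_Ioc]
    simp_rw [intervalIntegral.integral_of_le Real.two_pi_pos.le, ← integral_Icc_eq_integral_Ioc]
    rw [← Measure.volume_eq_prod] at this h1
    rw [box, ← h1]
    exact this

/-- The factor ‖ζ‖²/2 is the density of an edge in its parameters: the area element is |w| ·
|ζ|/(2|w|) = ‖ζ‖/2, and the multiplicity is ‖ζ‖. The spanning vectors have lengths |w| and |w||ζ|.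
-/
theorem divAlong_surf (Q : E4 ≃ₗᵢ[ℝ] E4) {ζ : ℂ} (hζ : ζ ≠ 0) (α : ℝ) {w : ℂ} (hw : w ≠ 0)
    (X : E4 → E4) :
    ‖ζ‖ ^ 2 / 2 * divAlong (planeField Q ζ (Q (tens α w))) X (Q (tens α w)) =
      (2 * ‖w‖ ^ 2)⁻¹ * (‖ζ‖ ^ 2 * inner ℝ (fderiv ℝ X (Q (tens α w))
        (Q (tens (α + Real.pi / 2) w))) (Q (tens (α + Real.pi / 2) w)) +
        inner ℝ (fderiv ℝ X (Q (tens α w)) (Q (tens α (conj w * ζ))))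
          (Q (tens α (conj w * ζ)))) := by
  have hw' : conj w * ζ ≠ 0 := by simp [hw, hζ]
  rw [divAlong_eq_of_orthogonal _ _ _ (planeField_tens Q hζ α hw)]
  · rw [Q.norm_map, Q.norm_map, norm_tens, norm_tens, norm_mul, RCLike.norm_conj, real_inner_comm,
      real_inner_comm (fderiv ℝ X (Q (tens α w)) (Q (tens α (conj w * ζ))))]
    have h1 : ‖w‖ ≠ 0 := by simpa
    have h2 : ‖ζ‖ ≠ 0 := by simpa
    field_simp
  · simpa using tens_ne_zero hw
  · simpa using tens_ne_zero hw'
  · rw [Q.inner_map_map, inner_tens_add_pi_div_two]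

theorem continuous_isom_tens (Q : E4 ≃ₗᵢ[ℝ] E4) : Continuous fun v : ℝ × ℂ => Q (tens v.1 v.2) := by
  have hQ : Continuous fun x => Q x := Q.continuous
  exact hQ.comp continuous_tens

theorem continuousOn_isom_tens (Q : E4 ≃ₗᵢ[ℝ] E4) {Y : Type*} [TopologicalSpace Y] {s : Set Y}
    {a : Y → ℝ} {b : Y → ℂ} (ha : ContinuousOn a s) (hb : ContinuousOn b s) :
    ContinuousOn (fun v => Q (tens (a v) (b v))) s := by
  have h := ha.prodMk hb
  exact (continuous_isom_tens Q).comp_continuousOn (f := fun v => (a v, b v)) h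

/-- Adding ‖ζ‖²⟨X, e₀⟩ to one half of the divergence makes it a t-derivative, and subtracting it
from the other half makes that an α-derivative. That one term serves both is the vanishing of the
mean curvature. The α-part vanishes on the closed circle; the t-part leaves the tractions at the two
ends. -/
theorem firstVariation_edge (Q : E4 ≃ₗᵢ[ℝ] E4) {η p q : ℂ} (hη : ‖η‖ = 1) (hp : 0 < p.re)
    (hq : 0 < q.re) (hpq : p ≠ q) {X : E4 → E4} (hX : ContDiff ℝ ∞ X) :
    ∫ x, divAlong x.2 X x.1 ∂edge Q η p q =
      traction Q X (curve η p q 1) (η ^ 2 * (q - p)) -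
        traction Q X (curve η p q 0) (η ^ 2 * (q - p)) := by
  have hη0 : η ≠ 0 := by rintro rfl; simp at hη
  set ζ := η ^ 2 * (q - p) with hζ
  have hζn : ‖q - p‖ = ‖ζ‖ := by simp [hζ, hη]
  have hζ0 : ζ ≠ 0 := mul_ne_zero (pow_ne_zero _ hη0) (sub_ne_zero.2 hpq.symm)
  set w := curve η p q with hw
  have hw0 : ∀ t, w t ≠ 0 := curve_ne_zero hη0
  let D : ℝ × ℝ → E4 →L[ℝ] E4 := fun v => fderiv ℝ X (Q (tens v.1 (w v.2)))
  let e₀ : ℝ × ℝ → E4 := fun v => Q (tens v.1 (w v.2))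
  let e₁ : ℝ × ℝ → E4 := fun v => Q (tens (v.1 + Real.pi / 2) (w v.2))
  let e₂ : ℝ × ℝ → E4 := fun v => Q (tens v.1 (conj (w v.2) * ζ))
  let c : ℝ → ℝ := fun t => (2 * ‖w t‖ ^ 2)⁻¹
  let A : ℝ × ℝ → ℝ := fun v => c v.2 * (inner ℝ (D v (e₂ v)) (e₂ v) +
    ‖ζ‖ ^ 2 * inner ℝ (X (e₀ v)) (e₀ v))
  let B : ℝ × ℝ → ℝ := fun v => (c v.2 * ‖ζ‖ ^ 2) * (inner ℝ (D v (e₁ v)) (e₁ v) -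
    inner ℝ (X (e₀ v)) (e₀ v))
  have hwc : ContinuousOn (fun v : ℝ × ℝ => w v.2) box :=
    (continuousOn_curve hp hq).comp continuous_snd.continuousOn fun v hv => hv.2
  have h₀ : ContinuousOn e₀ box := continuousOn_isom_tens Q continuous_fst.continuousOn hwc
  have h₁ : ContinuousOn e₁ box := continuousOn_isom_tens Q (continuous_fst.add continuous_const).continuousOn hwc
  have h₂ : ContinuousOn e₂ box := continuousOn_isom_tens Q continuous_fst.continuousOn
    ((Complex.continuous_conj.comp_continuousOn hwc).mul continuousOn_const)
  have hD : ContinuousOn D box := (hX.continuous_fderiv (by simp)).comp_continuousOn h₀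
  have hXc : ContinuousOn (fun v => X (e₀ v)) box := hX.continuous.comp_continuousOn h₀
  have hc : ContinuousOn (fun v : ℝ × ℝ => c v.2) box := by
    refine ContinuousOn.inv₀ (continuousOn_const.mul (hwc.norm.pow 2)) fun v _ => ?_
    have := hw0 v.2
    positivity
  have hA : ContinuousOn A box :=
    hc.mul (((hD.clm_apply h₂).inner h₂).add (continuousOn_const.mul (hXc.inner h₀)))
  have hB : ContinuousOn B box :=
    (hc.mul continuousOn_const).mul (((hD.clm_apply h₁).inner h₁).sub (hXc.inner h₀))
  have hsum : ∀ v, ‖q - p‖ ^ 2 / 2 * divAlong (planeField Q ζ (surf Q η p q v)) X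
      (surf Q η p q v) = A v + B v := by
    intro v
    rw [hζn]
    have := divAlong_surf Q hζ0 v.1 (hw0 v.2) X
    refine this.trans ?_
    simp only [A, B, c, D, e₀, e₁, e₂]
    ring
  obtain ⟨hAi, hA1, -⟩ := integral_box_of_continuousOn hA
  obtain ⟨hBi, -, hB1⟩ := integral_box_of_continuousOn hB
  rw [integral_edge _ _ _ _ (continuous_divAlong hX).measurable, ← integral_const_mul,
    integral_congr_ae (Eventually.of_forall hsum), integral_add hAi hBi, hA1, hB1]
  have hA2 : ∀ α ∈ Set.uIcc 0 (2 * Real.pi), ∫ t in (0 : ℝ)..1, A (α, t) =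
      inner ℝ (X (e₀ (α, 1))) (e₂ (α, 1)) - inner ℝ (X (e₀ (α, 0))) (e₂ (α, 0)) := by
    intro α hα
    rw [Set.uIcc_of_le Real.two_pi_pos.le] at hα
    refine intervalIntegral.integral_eq_sub_of_hasDerivAt
      (f := fun t => inner ℝ (X (e₀ (α, t))) (e₂ (α, t))) ?_ ?_
    · intro t ht
      rw [Set.uIcc_of_le zero_le_one] at ht
      have hd := hasDerivAt_curve hη (segment_re_pos hp hq ht)
      have hdc := Complex.conjCLE.hasFDerivAt.comp_hasDerivAt t hd
      have d0 := Q.toContinuousLinearEquiv.hasFDerivAt.comp_hasDerivAt t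
        (hasDerivAt_tens_right α hd)
      have d2 := Q.toContinuousLinearEquiv.hasFDerivAt.comp_hasDerivAt t
        (hasDerivAt_tens_right α (hdc.mul_const ζ))
      have dX := hasDerivAt_comp_of_contDiff hX d0
      have := dX.inner ℝ d2
      refine this.congr_deriv ?_
      -- The derivative of w̄ζ is a real multiple of w itself, which produces the normal term
      -- included in `A`.
      have e1 : conj (((2 * ‖w t‖ ^ 2)⁻¹ : ℝ) * (conj (w t) * ζ)) * ζ =
          (((2 * ‖w t‖ ^ 2)⁻¹ * ‖ζ‖ ^ 2 : ℝ) : ℂ) * w t := by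
        rw [map_mul, map_mul, Complex.conj_conj, Complex.conj_ofReal, Complex.ofReal_mul,
          Complex.ofReal_pow ‖ζ‖, ← Complex.conj_mul' ζ]
        ring
      simp only [A, c, D, e₀, e₂]
      erw [tens_smul, e1, tens_smul]
      simp only [ContinuousLinearEquiv.coe_coe, LinearIsometryEquiv.coe_toContinuousLinearEquiv,
        map_smul, inner_smul_left, inner_smul_right, Function.comp_apply]
      simp
      ring
    · apply ContinuousOn.intervalIntegrable
      rw [Set.uIcc_of_le zero_le_one]
      exact hA.comp (by fun_prop) fun t ht => ⟨hα, ht⟩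
  have hB2 : ∀ t ∈ Set.uIcc (0 : ℝ) 1, ∫ α in (0 : ℝ)..2 * Real.pi, B (α, t) = 0 := by
    intro t ht
    rw [Set.uIcc_of_le zero_le_one] at ht
    have : ∫ α in (0 : ℝ)..2 * Real.pi, B (α, t) =
        (c t * ‖ζ‖ ^ 2) * inner ℝ (X (e₀ (2 * Real.pi, t))) (e₁ (2 * Real.pi, t)) -
        (c t * ‖ζ‖ ^ 2) * inner ℝ (X (e₀ (0, t))) (e₁ (0, t)) := by
      refine intervalIntegral.integral_eq_sub_of_hasDerivAt
        (f := fun α => (c t * ‖ζ‖ ^ 2) * inner ℝ (X (e₀ (α, t))) (e₁ (α, t))) ?_ ?_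
      · intro α _
        have d0 := Q.toContinuousLinearEquiv.hasFDerivAt.comp_hasDerivAt α
          (hasDerivAt_tens_left α (w t))
        have d1 := Q.toContinuousLinearEquiv.hasFDerivAt.comp_hasDerivAt α
          ((hasDerivAt_tens_left (α + Real.pi / 2) (w t)).comp_add_const α (Real.pi / 2))
        have dX := hasDerivAt_comp_of_contDiff hX d0
        have := (dX.inner ℝ d1).const_mul (c t * ‖ζ‖ ^ 2)
        refine this.congr_deriv ?_
        simp only [B, c, D, e₀, e₁]
        -- Two α-derivatives return the negative of the vector, which produces the term subtracted
        -- in `B`.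
        have e1 : tens (α + Real.pi / 2 + Real.pi / 2) (w t) = - tens α (w t) := by
          rw [← tens_add_pi]; ring_nf
        erw [e1]
        simp only [ContinuousLinearEquiv.coe_coe, LinearIsometryEquiv.coe_toContinuousLinearEquiv,
          map_neg, inner_neg_right, Function.comp_apply]
        ring
      · apply ContinuousOn.intervalIntegrable
        rw [Set.uIcc_of_le Real.two_pi_pos.le]
        exact hB.comp (by fun_prop) fun α hα => ⟨hα, ht⟩
    rw [this]
    have e1 : e₀ (2 * Real.pi, t) = e₀ (0, t) := by
      have := tens_add_two_pi 0 (w t)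
      rw [zero_add] at this
      simp only [e₀, this]
    have e2 : e₁ (2 * Real.pi, t) = e₁ (0, t) := by
      have := tens_add_two_pi (0 + Real.pi / 2) (w t)
      rw [show 0 + Real.pi / 2 + 2 * Real.pi = 2 * Real.pi + Real.pi / 2 by ring] at this
      simp only [e₁, this]
    rw [e1, e2, sub_self]
  rw [intervalIntegral.integral_congr hA2, intervalIntegral.integral_congr hB2]
  have hi : ∀ t ∈ Set.Icc (0 : ℝ) 1, IntervalIntegrable
      (fun α => inner ℝ (X (e₀ (α, t))) (e₂ (α, t))) volume 0 (2 * Real.pi) := by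
    intro t ht
    apply ContinuousOn.intervalIntegrable
    rw [Set.uIcc_of_le Real.two_pi_pos.le]
    exact (hXc.inner h₂).comp (g := fun v : ℝ × ℝ => inner ℝ (X (e₀ v)) (e₂ v))
      (f := fun α => (α, t)) (by fun_prop) fun α hα => ⟨hα, ht⟩
  rw [intervalIntegral.integral_sub (hi 1 (by simp)) (hi 0 (by simp))]
  simp only [intervalIntegral.integral_zero, add_zero]
  rfl

/-! ### Blow-ups and rectifiability of a parametrized surface -/

theorem exists_antilipschitz_const {L : ℝ × ℝ →L[ℝ] E4} (hL : Function.Injective L) :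
    ∃ κ : ℝ, 0 < κ ∧ ∀ q, κ * ‖q‖ ≤ ‖L q‖ := by
  obtain ⟨K, hK, hA⟩ := (L : ℝ × ℝ →ₗ[ℝ] E4).exists_antilipschitzWith (LinearMap.ker_eq_bot.2 hL)
  refine ⟨(K : ℝ)⁻¹, by positivity, fun q => ?_⟩
  have := hA.le_mul_dist q 0
  simp only [dist_zero_right, map_zero] at this
  rw [inv_mul_le_iff₀ (by positivity)]
  exact this

/-- Near p₀ this is injectivity of the derivative; away from p₀ it is compactness, because no other
parameter reaches F p₀. It rules out further sheets of the surface through the point. -/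
theorem exists_lower_bound_of_injective {F : ℝ × ℝ → E4} {L : ℝ × ℝ →L[ℝ] E4} {D : Set (ℝ × ℝ)}
    {p₀ : ℝ × ℝ} (hD : IsCompact D) (hF : ContinuousOn F D) (hL : Function.Injective L)
    (hd : HasFDerivAt F L p₀) (hne : ∀ p ∈ D, p ≠ p₀ → F p ≠ F p₀) :
    ∃ κ : ℝ, 0 < κ ∧ ∀ p ∈ D, κ * ‖p - p₀‖ ≤ ‖F p - F p₀‖ := by
  obtain ⟨c, hc, hcL⟩ := exists_antilipschitz_const hL
  have h1 := hd.isLittleO.def (half_pos hc)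
  obtain ⟨ε, hε, hball⟩ := Metric.eventually_nhds_iff_ball.1 h1
  have hK : IsCompact (D \ Metric.ball p₀ ε) := hD.diff Metric.isOpen_ball
  obtain ⟨R, hR⟩ := (hD.isBounded).subset_closedBall p₀
  have hfar : ∃ m : ℝ, 0 < m ∧ ∀ p ∈ D \ Metric.ball p₀ ε, m ≤ ‖F p - F p₀‖ := by
    rcases (D \ Metric.ball p₀ ε).eq_empty_or_nonempty with h | h
    · exact ⟨1, one_pos, by simp [h]⟩
    · obtain ⟨a, ha, hmin⟩ := hK.exists_isMinOn h
        ((hF.mono Set.sdiff_subset).sub continuousOn_const).norm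
      refine ⟨_, norm_pos_iff.2 (sub_ne_zero.2 (hne a ha.1 ?_)), fun p hp => hmin hp⟩
      rintro rfl
      exact ha.2 (Metric.mem_ball_self hε)
  obtain ⟨m, hm, hfar⟩ := hfar
  refine ⟨min (c / 2) (m / (|R| + 1)), by positivity, fun p hp => ?_⟩
  by_cases hpb : p ∈ Metric.ball p₀ ε
  · have h2 := hball p hpb
    have h3 := hcL (p - p₀)
    have h4 := norm_sub_norm_le (L (p - p₀)) (F p - F p₀)
    rw [norm_sub_rev (L (p - p₀))] at h4
    have h5 : min (c / 2) (m / (|R| + 1)) * ‖p - p₀‖ ≤ c / 2 * ‖p - p₀‖ :=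
      mul_le_mul_of_nonneg_right (min_le_left _ _) (norm_nonneg _)
    linarith
  · have h2 := hfar p ⟨hp, hpb⟩
    have h3 : ‖p - p₀‖ ≤ |R| + 1 := by
      have := hR hp
      rw [mem_closedBall_iff_norm] at this
      linarith [le_abs_self R]
    calc _ ≤ m / (|R| + 1) * (|R| + 1) := by
            refine mul_le_mul (min_le_right _ _) h3 (norm_nonneg _) (by positivity)
      _ = m := by field_simp
      _ ≤ _ := h2

/-- Substitute p = p₀ + t q: the integrands converge to f (L q), and `hlow` confines all of them to
the ball of radius R/κ, so dominated convergence applies. -/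
theorem tendsto_blowup_param {F : ℝ × ℝ → E4} {L : ℝ × ℝ →L[ℝ] E4} {D : Set (ℝ × ℝ)}
    {p₀ : ℝ × ℝ} (hFm : Measurable F) (hDm : MeasurableSet D) (hD : D ∈ 𝓝 p₀)
    (hd : HasFDerivAt F L p₀) {κ : ℝ} (hκ : 0 < κ)
    (hlow : ∀ p ∈ D, κ * ‖p - p₀‖ ≤ ‖F p - F p₀‖)
    {f : E4 → ℝ} (hf : Continuous f) (hfc : HasCompactSupport f) :
    Tendsto (fun t : ℝ => (t ^ 2)⁻¹ * ∫ p in D, f (t⁻¹ • (F p - F p₀))) (𝓝[>] 0)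
      (𝓝 (∫ q, f (L q))) := by
  obtain ⟨M, hM⟩ := hfc.exists_bound_of_continuous hf
  obtain ⟨R, hR⟩ := hfc.isCompact.isBounded.subset_closedBall (0 : E4)
  let G : ℝ → ℝ × ℝ → ℝ := fun t => D.indicator fun p => f (t⁻¹ • (F p - F p₀))
  have hG : ∀ t : ℝ, 0 < t → (t ^ 2)⁻¹ * ∫ p in D, f (t⁻¹ • (F p - F p₀)) =
      ∫ q, G t (p₀ + t • q) := by
    intro t ht
    have h1 := Measure.integral_comp_smul (volume : Measure (ℝ × ℝ)) (fun p => G t (p₀ + p)) t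
    rw [h1, integral_add_left_eq_self, integral_indicator hDm]
    simp [abs_of_pos ht]
  have hev : (fun t : ℝ => ∫ q, G t (p₀ + t • q)) =ᶠ[𝓝[>] 0]
      fun t : ℝ => (t ^ 2)⁻¹ * ∫ p in D, f (t⁻¹ • (F p - F p₀)) := by
    filter_upwards [self_mem_nhdsWithin] with t ht using (hG t ht).symm
  refine Tendsto.congr' hev ?_
  refine tendsto_integral_filter_of_dominated_convergence
    ((Metric.closedBall (0 : ℝ × ℝ) (R / κ)).indicator fun _ => M) ?_ ?_ ?_ ?_
  · refine Eventually.of_forall fun t => Measurable.aestronglyMeasurable ?_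
    have h1 : Measurable (G t) := by
      refine Measurable.indicator ?_ hDm
      have hs : Continuous fun x : E4 => f (t⁻¹ • (x - F p₀)) := by fun_prop
      exact hs.measurable.comp hFm
    exact h1.comp (by fun_prop)
  · filter_upwards [self_mem_nhdsWithin] with t ht
    refine Eventually.of_forall fun q => ?_
    have ht : 0 < t := ht
    by_cases hz : G t (p₀ + t • q) = 0
    · rw [hz, norm_zero]
      exact Set.indicator_nonneg (fun _ _ => (norm_nonneg _).trans (hM 0)) _
    · have hmem : p₀ + t • q ∈ D := by
        by_contra h; exact hz (Set.indicator_of_notMem h _)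
      have hval : G t (p₀ + t • q) = f (t⁻¹ • (F (p₀ + t • q) - F p₀)) :=
        Set.indicator_of_mem hmem _
      rw [hval] at hz ⊢
      have h1 : t⁻¹ • (F (p₀ + t • q) - F p₀) ∈ Metric.closedBall (0 : E4) R :=
        hR (subset_tsupport f hz)
      rw [mem_closedBall_zero_iff, norm_smul, norm_inv, Real.norm_of_nonneg ht.le,
        inv_mul_le_iff₀ ht] at h1
      have h2 := hlow _ hmem
      rw [add_sub_cancel_left, norm_smul, Real.norm_of_nonneg ht.le] at h2
      have h3 : q ∈ Metric.closedBall (0 : ℝ × ℝ) (R / κ) := by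
        rw [mem_closedBall_zero_iff, le_div_iff₀ hκ]
        have h4 : t * (‖q‖ * κ) ≤ t * R := by linarith
        exact le_of_mul_le_mul_left h4 ht
      rw [Set.indicator_of_mem h3]
      exact hM _
  · refine (integrable_indicator_iff Metric.isClosed_closedBall.measurableSet).2 ?_
    exact integrableOn_const (by exact measure_closedBall_lt_top.ne)
  · refine Eventually.of_forall fun q => ?_
    have hline : Tendsto (fun t : ℝ => p₀ + t • q) (𝓝[>] 0) (𝓝 p₀) := by
      have : Continuous fun t : ℝ => p₀ + t • q := by fun_prop
      have h := this.tendsto 0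
      simp only [zero_smul, add_zero] at h
      exact h.mono_left nhdsWithin_le_nhds
    have hlim : Tendsto (fun t : ℝ => t⁻¹ • (F (p₀ + t • q) - F p₀)) (𝓝[>] 0) (𝓝 (L q)) := by
      have h := hd.hasLineDerivAt q
      exact h.tendsto_slope_zero_right
    refine ((hf.tendsto _).comp hlim).congr' ?_
    filter_upwards [hline.eventually hD] with t ht
    exact (Set.indicator_of_mem ht fun p => f (t⁻¹ • (F p - F p₀))).symm

/-- The image of Lebesgue measure and the Hausdorff measure are both Haar measures on the plane,
hence proportional. -/
theorem exists_integral_comp_linear_eq {L : ℝ × ℝ →L[ℝ] E4} (hL : Function.Injective L)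
    {T : Gr 4 2} (hT : T.1 = LinearMap.range (L : ℝ × ℝ →ₗ[ℝ] E4)) :
    ∃ θ : ℝ, 0 < θ ∧ ∀ f : E4 → ℝ, Continuous f →
      ∫ q, f (L q) = θ * ∫ y in (T.1 : Set E4), f y ∂μH[((2 : ℕ) : ℝ)] := by
  obtain ⟨T, hT2⟩ := T
  simp only at hT
  subst hT
  set S := LinearMap.range (L : ℝ × ℝ →ₗ[ℝ] E4)
  let e : (ℝ × ℝ) ≃L[ℝ] S :=
    (LinearEquiv.ofInjective (L : ℝ × ℝ →ₗ[ℝ] E4) hL).toContinuousLinearEquiv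
  have he : ∀ q, (e q : E4) = L q := fun q => rfl
  have i1 : (μH[((2 : ℕ) : ℝ)] : Measure S).IsAddHaarMeasure := by
    have := isAddHaarMeasure_hausdorffMeasure (E := S)
    rwa [hT2] at this
  let ν : Measure S := (volume : Measure (ℝ × ℝ)).map e
  have i2 : ν.IsAddHaarMeasure := e.isAddHaarMeasure_map volume
  have hν := Measure.isAddLeftInvariant_eq_smul ν μH[((2 : ℕ) : ℝ)]
  set c := ν.addHaarScalarFactor μH[((2 : ℕ) : ℝ)]
  have hc : 0 < c := Measure.addHaarScalarFactor_pos_of_isAddHaarMeasure _ _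
  refine ⟨c, hc, fun f hf => ?_⟩
  have h1 : ∫ q, f (L q) = ∫ y, f y ∂ν := by
    have hs : Continuous fun y : S => f y := hf.comp continuous_subtype_val
    rw [integral_map e.continuous.measurable.aemeasurable hs.aestronglyMeasurable]
    simp only [he]
  have h2 : ∫ y in (S : Set E4), f y ∂μH[((2 : ℕ) : ℝ)] =
      ∫ y : S, f y ∂μH[((2 : ℕ) : ℝ)] := by
    have := (isometry_subtype_coe (s := (S : Set E4))).map_hausdorffMeasure
      (d := ((2 : ℕ) : ℝ)) (Or.inl (by positivity))
    rw [Subtype.range_coe] at this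
    rw [← this, integral_map continuous_subtype_val.measurable.aemeasurable
      hf.aestronglyMeasurable]
    rfl
  rw [h1, hν, h2, integral_smul_nnreal_measure]
  rfl

/-- Where the strict derivative is injective, F has locally a Lipschitz inverse on its image, and
Lipschitz maps preserve Hausdorff null sets. On the parameter plane Lebesgue measure is a multiple
of two-dimensional Hausdorff measure. -/
theorem absolutelyContinuous_map_hausdorff {F : ℝ × ℝ → E4} {U : Set (ℝ × ℝ)}
    (hFm : Measurable F)
    (hF : ∀ p ∈ U, ∃ L : ℝ × ℝ →L[ℝ] E4, Function.Injective L ∧ HasStrictFDerivAt F L p) :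
    (volume.restrict U).map F ≪ μH[((2 : ℕ) : ℝ)] := by
  refine Measure.AbsolutelyContinuous.mk fun A hA h0 => ?_
  rw [Measure.map_apply hFm hA, Measure.restrict_apply (hFm hA)]
  have hac : (volume : Measure (ℝ × ℝ)) ≪ μH[((2 : ℕ) : ℝ)] := by
    have i1 : (μH[((2 : ℕ) : ℝ)] : Measure (ℝ × ℝ)).IsAddHaarMeasure := by
      have := isAddHaarMeasure_hausdorffMeasure (E := ℝ × ℝ)
      simpa using this
    rw [Measure.isAddLeftInvariant_eq_smul (volume : Measure (ℝ × ℝ)) μH[((2 : ℕ) : ℝ)]]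
    exact Measure.smul_absolutelyContinuous
  refine measure_null_of_locally_null _ fun p hp => ?_
  obtain ⟨L, hL, hd⟩ := hF p hp.2
  obtain ⟨c, hc, hcL⟩ := exists_antilipschitz_const hL
  have h1 := hd.isLittleO.def (half_pos hc)
  rw [nhds_prod_eq] at h1
  obtain ⟨N, hN, hNF⟩ := (eventually_prod_self_iff
    (r := fun x y => ‖F x - F y - L (x - y)‖ ≤ c / 2 * ‖x - y‖)).1 h1
  have hanti : ∀ x ∈ N, ∀ y ∈ N, ‖x - y‖ ≤ 2 / c * ‖F x - F y‖ := by
    intro x hx y hy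
    have h2 := hNF x hx y hy
    have h3 := hcL (x - y)
    have h4 := norm_sub_norm_le (L (x - y)) (F x - F y)
    rw [norm_sub_rev (L (x - y))] at h4
    rw [div_mul_eq_mul_div, le_div_iff₀ hc]
    linarith
  have hinj : Set.InjOn F N := by
    intro x hx y hy hxy
    have := hanti x hx y hy
    rw [hxy, sub_self, norm_zero, mul_zero] at this
    exact sub_eq_zero.1 (norm_le_zero_iff.1 this)
  have hlip : LipschitzOnWith (2 / c).toNNReal (Function.invFunOn F N) (F '' N) := by
    refine LipschitzOnWith.of_dist_le_mul ?_
    rintro _ ⟨x, hx, rfl⟩ _ ⟨y, hy, rfl⟩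
    rw [hinj.leftInvOn_invFunOn hx, hinj.leftInvOn_invFunOn hy, dist_eq_norm, dist_eq_norm,
      Real.coe_toNNReal _ (by positivity)]
    exact hanti x hx y hy
  refine ⟨_, inter_mem_nhdsWithin _ hN, hac (measure_mono_null (t := Function.invFunOn F N ''
    (A ∩ F '' N)) ?_ ?_)⟩
  · rintro x ⟨⟨hxA, -⟩, hxN⟩
    exact ⟨F x, ⟨hxA, x, hxN, rfl⟩, hinj.leftInvOn_invFunOn hxN⟩
  · refine le_antisymm ?_ zero_le
    refine ((hlip.mono Set.inter_subset_right).hausdorffMeasure_image_le (by positivity)).trans ?_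
    rw [measure_mono_null Set.inter_subset_left h0, mul_zero]

theorem contDiffAt_surf (Q : E4 ≃ₗᵢ[ℝ] E4) {n : ℕ∞ω} {η p q : ℂ} {v : ℝ × ℝ}
    (h : 0 < (p + v.2 * (q - p)).re) : ContDiffAt ℝ n (surf Q η p q) v := by
  have h1 : ContDiffAt ℝ n (fun v : ℝ × ℝ => curve η p q v.2) v :=
    (contDiffAt_curve h).comp (f := Prod.snd) v contDiffAt_snd
  have h2 : ContDiffAt ℝ n (fun v : ℝ × ℝ => (v.1, curve η p q v.2)) v := contDiffAt_fst.prodMk h1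
  have h3 : ContDiffAt ℝ n (fun v : ℝ × ℂ => tens v.1 v.2) (v.1, curve η p q v.2) :=
    contDiff_tens.contDiffAt
  have h4 : ContDiffAt ℝ n (fun v : ℝ × ℝ => tens v.1 (curve η p q v.2)) v :=
    h3.comp (f := fun v : ℝ × ℝ => (v.1, curve η p q v.2)) v h2
  exact (Q.toContinuousLinearEquiv.contDiff.contDiffAt (n := n)).comp
    (f := fun v : ℝ × ℝ => tens v.1 (curve η p q v.2)) v h4

theorem injective_and_range_of_orthogonal {L : ℝ × ℝ →L[ℝ] E4} {v w : E4} (h1 : L (1, 0) = v)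
    (h2 : L (0, 1) = w) (hv : v ≠ 0) (hw : w ≠ 0) (h : inner ℝ v w = 0) :
    Function.Injective L ∧
      LinearMap.range (L : ℝ × ℝ →ₗ[ℝ] E4) = Submodule.span ℝ {v, w} := by
  have hL : ∀ q : ℝ × ℝ, L q = q.1 • v + q.2 • w := by
    intro q
    rw [← h1, ← h2, ← map_smul, ← map_smul, ← map_add]
    simp
  constructor
  · rw [injective_iff_map_eq_zero]
    intro q hq
    rw [hL] at hq
    have e1 : inner ℝ v (q.1 • v + q.2 • w) = (0 : ℝ) := by rw [hq, inner_zero_right]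
    have e2 : inner ℝ w (q.1 • v + q.2 • w) = (0 : ℝ) := by rw [hq, inner_zero_right]
    rw [inner_add_right, real_inner_smul_right, real_inner_smul_right] at e1 e2
    rw [h, mul_zero, add_zero, mul_eq_zero, inner_self_eq_zero] at e1
    rw [real_inner_comm, h, mul_zero, zero_add, mul_eq_zero, inner_self_eq_zero] at e2
    exact Prod.ext (e1.resolve_right hv) (e2.resolve_right hw)
  · ext x
    rw [Submodule.mem_span_pair, LinearMap.mem_range]
    constructor
    · rintro ⟨q, rfl⟩
      exact ⟨q.1, q.2, (hL q).symm⟩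
    · rintro ⟨a, b, rfl⟩
      exact ⟨(a, b), hL _⟩

theorem exists_derivative_surf (Q : E4 ≃ₗᵢ[ℝ] E4) {η p q : ℂ} (hη : ‖η‖ = 1) (hpq : p ≠ q)
    {v : ℝ × ℝ} (h : 0 < (p + v.2 * (q - p)).re) :
    ∃ L : ℝ × ℝ →L[ℝ] E4, HasStrictFDerivAt (surf Q η p q) L v ∧ Function.Injective L ∧
      (planeField Q (η ^ 2 * (q - p)) (surf Q η p q v)).1 =
        LinearMap.range (L : ℝ × ℝ →ₗ[ℝ] E4) := by
  have hη0 : η ≠ 0 := by rintro rfl; simp at hη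
  have hζ0 : η ^ 2 * (q - p) ≠ 0 := mul_ne_zero (pow_ne_zero _ hη0) (sub_ne_zero.2 hpq.symm)
  have hw0 : curve η p q v.2 ≠ 0 := curve_ne_zero hη0 _
  have hd : HasStrictFDerivAt (surf Q η p q) (fderiv ℝ (surf Q η p q) v) v :=
    (contDiffAt_surf Q (n := 1) h).hasStrictFDerivAt (by simp)
  set L := fderiv ℝ (surf Q η p q) v
  set w := curve η p q v.2 with hw
  set ζ := η ^ 2 * (q - p)
  have e1 : L (1, 0) = Q (tens (v.1 + Real.pi / 2) w) := by
    have a1 : HasDerivAt (fun s : ℝ => ((s, v.2) : ℝ × ℝ)) (1, 0) v.1 :=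
      (hasDerivAt_id v.1).prodMk (hasDerivAt_const _ _)
    have a2 := hd.hasFDerivAt.comp_hasDerivAt
      (f := fun s : ℝ => ((s, v.2) : ℝ × ℝ)) v.1 a1
    have a3 := Q.toContinuousLinearEquiv.hasFDerivAt.comp_hasDerivAt v.1
          (hasDerivAt_tens_left v.1 w)
    exact a2.unique a3
  have e2 : L (0, 1) = (2 * ‖w‖ ^ 2)⁻¹ • Q (tens v.1 (conj w * ζ)) := by
    have a1 : HasDerivAt (fun s : ℝ => ((v.1, s) : ℝ × ℝ)) (0, 1) v.2 :=
      (hasDerivAt_const _ _).prodMk (hasDerivAt_id v.2)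
    have a2 := hd.hasFDerivAt.comp_hasDerivAt
      (f := fun s : ℝ => ((v.1, s) : ℝ × ℝ)) v.2 a1
    have a3 := Q.toContinuousLinearEquiv.hasFDerivAt.comp_hasDerivAt v.2
          (hasDerivAt_tens_right v.1 (hasDerivAt_curve hη h))
    have a4 := a2.unique a3
    rw [a4, ← map_smul, ← tens_smul]
    rfl
  have hr : (2 * ‖w‖ ^ 2)⁻¹ ≠ 0 := by positivity
  have hne2 : Q (tens v.1 (conj w * ζ)) ≠ 0 := by
    simpa using tens_ne_zero (α := v.1) (w := conj w * ζ) (by simp [hw0, hζ0])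
  obtain ⟨h1, h2⟩ := injective_and_range_of_orthogonal e1 e2
    (by simpa using tens_ne_zero (α := v.1 + Real.pi / 2) hw0)
    (smul_ne_zero hr hne2)
    (by rw [real_inner_smul_right, Q.inner_map_map, inner_tens_add_pi_div_two, mul_zero])
  refine ⟨L, hd, h1, ?_⟩
  rw [h2]
  refine (planeField_tens Q hζ0 v.1 hw0).trans ?_
  rw [Submodule.span_insert, Submodule.span_insert, Submodule.span_singleton_smul_eq
    (IsUnit.mk0 _ hr)]

theorem interior_box : interior box = Set.Ioo 0 (2 * Real.pi) ×ˢ Set.Ioo 0 1 := by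
  rw [box, interior_prod_eq, interior_Icc, interior_Icc]

theorem hopf_surf (Q : E4 ≃ₗᵢ[ℝ] E4) {η p q : ℂ} {v : ℝ × ℝ} (h : 0 < (p + v.2 * (q - p)).re) :
    hopf (Q.symm (surf Q η p q v)) = η ^ 2 * (p + v.2 * (q - p)) := by
  rw [surf, Q.symm_apply_apply, hopf_tens, curve_sq h]

/-- The point z = w² on the segment determines t, and then the tensor determines cos α and sin α.
The only remaining ambiguity, α = 0 against α = 2π, is excluded because v is interior. -/
theorem surf_injective (Q : E4 ≃ₗᵢ[ℝ] E4) {η p q : ℂ} (hη : ‖η‖ = 1) (hp : 0 < p.re)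
    (hq : 0 < q.re) (hpq : p ≠ q) {v v' : ℝ × ℝ} (hv : v ∈ interior box) (hv' : v' ∈ box)
    (h : surf Q η p q v' = surf Q η p q v) : v' = v := by
  have hη0 : η ≠ 0 := by rintro rfl; simp at hη
  have h1 := segment_re_pos hp hq (interior_subset hv).2
  have h2 := segment_re_pos hp hq hv'.2
  have h3 := hopf_surf Q (η := η) h2
  rw [h, hopf_surf Q h1] at h3
  have h4 : v'.2 = v.2 := by
    have h5 := add_left_cancel (mul_left_cancel₀ (pow_ne_zero 2 hη0) h3)
    exact_mod_cast (mul_right_cancel₀ (sub_ne_zero.2 hpq.symm) h5).symm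
  refine Prod.ext ?_ h4
  simp only [surf, h4] at h
  have h6 := Q.injective h
  have hw0 : curve η p q v.2 ≠ 0 := curve_ne_zero hη0 _
  set w := curve η p q v.2
  rw [interior_box] at hv
  have hcs : Real.cos v'.1 = Real.cos v.1 ∧ Real.sin v'.1 = Real.sin v.1 := by
    have k0 : Real.cos v'.1 * w.re = Real.cos v.1 * w.re := by
      simpa [tens] using congrArg (fun x : E4 => x 0) h6
    have k1 : Real.sin v'.1 * w.re = Real.sin v.1 * w.re := by
      simpa [tens] using congrArg (fun x : E4 => x 1) h6
    have k2 : Real.cos v'.1 * w.im = Real.cos v.1 * w.im := by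
      simpa [tens] using congrArg (fun x : E4 => x 2) h6
    have k3 : Real.sin v'.1 * w.im = Real.sin v.1 * w.im := by
      simpa [tens] using congrArg (fun x : E4 => x 3) h6
    rcases eq_or_ne w.re 0 with hre | hre
    · have him : w.im ≠ 0 := fun him => hw0 (Complex.ext hre him)
      exact ⟨mul_right_cancel₀ him k2, mul_right_cancel₀ him k3⟩
    · exact ⟨mul_right_cancel₀ hre k0, mul_right_cancel₀ hre k1⟩
  have hcos : Real.cos (v'.1 - v.1) = 1 := by
    rw [Real.cos_sub, hcs.1, hcs.2, ← pow_two, ← pow_two, Real.cos_sq_add_sin_sq]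
  have h7 := (Real.cos_eq_one_iff_of_lt_of_lt (x := v'.1 - v.1)
    (by linarith [hv'.1.1, hv.1.2]) (by linarith [hv'.1.2, hv.1.1])).1 hcos
  linarith

/-- The blow-ups of `μ` at `x` converge weakly to `θ` times the Hausdorff measure on `T`. -/
def HasBlowup (μ : Measure E4) (x : E4) (T : Gr 4 2) (θ : ℝ) : Prop :=
  ∀ f : E4 → ℝ, Continuous f → HasCompactSupport f →
    Tendsto (fun t : ℝ => (t ^ 2)⁻¹ * ∫ y, f (t⁻¹ • (y - x)) ∂μ) (𝓝[>] 0)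
      (𝓝 (θ * ∫ y in (T.1 : Set E4), f y ∂μH[((2 : ℕ) : ℝ)]))

theorem HasBlowup.smul {μ : Measure E4} {x : E4} {T : Gr 4 2} {θ c : ℝ} (h : HasBlowup μ x T θ)
    (hc : 0 ≤ c) : HasBlowup (ENNReal.ofReal c • μ) x T (c * θ) := by
  intro f hf hfc
  have := (h f hf hfc).const_mul c
  rw [← mul_assoc] at this
  refine this.congr fun t => ?_
  rw [integral_smul_measure, ENNReal.toReal_ofReal hc, smul_eq_mul]
  ring

/-- The rescaled function lives in a ball of radius O(t) about x, so blow-ups are a local matter. -/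
theorem eventually_comp_eq_zero {f : E4 → ℝ} (hfc : HasCompactSupport f) {x : E4} {U : Set E4}
    (hU : U ∈ 𝓝 x) : ∀ᶠ t : ℝ in 𝓝[>] 0, ∀ y ∉ U, f (t⁻¹ • (y - x)) = 0 := by
  obtain ⟨R, hR⟩ := hfc.isCompact.isBounded.subset_closedBall (0 : E4)
  obtain ⟨ε, hε, hball⟩ := Metric.mem_nhds_iff.1 hU
  have h1 : ∀ᶠ t : ℝ in 𝓝[>] 0, t * (|R| + 1) < ε := by
    have : Tendsto (fun t : ℝ => t * (|R| + 1)) (𝓝[>] 0) (𝓝 (0 * (|R| + 1))) :=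
      (tendsto_id.mul_const _).mono_left nhdsWithin_le_nhds
    rw [zero_mul] at this
    exact this.eventually (gt_mem_nhds hε)
  filter_upwards [h1, self_mem_nhdsWithin] with t ht ht0 y hy
  by_contra hne
  have h2 := hR (subset_tsupport f hne)
  have ht0 : 0 < t := ht0
  rw [mem_closedBall_zero_iff, norm_smul, norm_inv, Real.norm_of_nonneg ht0.le,
    inv_mul_le_iff₀ ht0] at h2
  refine hy (hball ?_)
  rw [mem_ball_iff_norm]
  nlinarith [le_abs_self R]

theorem hasBlowup_zero_of_notMem {μ : Measure E4} {M : Set E4} (hM : IsClosed M)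
    (hμ : μ Mᶜ = 0) {x : E4} (hx : x ∉ M) (T : Gr 4 2) : HasBlowup μ x T 0 := by
  intro f hf hfc
  rw [zero_mul]
  refine tendsto_const_nhds.congr' ?_
  filter_upwards [eventually_comp_eq_zero hfc (hM.isOpen_compl.mem_nhds hx)] with t ht
  rw [integral_eq_zero_of_ae, mul_zero]
  have : ∀ᵐ y ∂μ, y ∈ M := hμ
  filter_upwards [this] with y hy
  exact ht y (not_not.2 hy)

theorem HasBlowup.sum {ι : Type*} [Fintype ι] {μ : ι → Measure E4} [∀ i, IsFiniteMeasure (μ i)]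
    {x : E4} {T : Gr 4 2} {θ : ι → ℝ} (h : ∀ i, HasBlowup (μ i) x T (θ i)) :
    HasBlowup (Measure.sum μ) x T (∑ i, θ i) := by
  intro f hf hfc
  have := tendsto_finsetSum Finset.univ fun i _ => h i f hf hfc
  rw [← Finset.sum_mul] at this
  refine this.congr fun t => ?_
  rw [Measure.sum_fintype, ← Finset.mul_sum]
  congr 1
  refine (integral_finsetSum_measure fun i _ => ?_).symm
  obtain ⟨M, hM⟩ := hfc.exists_bound_of_continuous hf
  refine Integrable.of_bound (C := M) ?_ (Eventually.of_forall fun y => hM _)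
  exact Continuous.aestronglyMeasurable (by fun_prop)

theorem hasBlowup_edgeWeight (Q : E4 ≃ₗᵢ[ℝ] E4) {η p q : ℂ} (hη : ‖η‖ = 1) (hp : 0 < p.re)
    (hq : 0 < q.re) (hpq : p ≠ q) {v : ℝ × ℝ} (hv : v ∈ interior box) :
    ∃ θ : ℝ, 0 < θ ∧ HasBlowup (edgeWeight Q η p q) (surf Q η p q v)
      (planeField Q (η ^ 2 * (q - p)) (surf Q η p q v)) θ := by
  have hre := segment_re_pos hp hq (interior_subset hv).2
  obtain ⟨L, hd, hL, hT⟩ := exists_derivative_surf Q hη hpq hre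
  have hc : ContinuousOn (surf Q η p q) box := fun v' hv' =>
    (contDiffAt_surf Q (n := 0) (segment_re_pos hp hq hv'.2)).continuousAt.continuousWithinAt
  obtain ⟨κ, hκ, hlow⟩ := exists_lower_bound_of_injective isCompact_box hc hL hd.hasFDerivAt
    fun v' hv' hne heq => hne (surf_injective Q hη hp hq hpq hv hv' heq)
  obtain ⟨θ, hθ, hint⟩ := exists_integral_comp_linear_eq hL hT
  have hpos : 0 < ‖q - p‖ ^ 2 / 2 := by
    have := norm_pos_iff.2 (sub_ne_zero.2 hpq.symm)
    positivity
  refine ⟨_, mul_pos hpos hθ, ?_⟩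
  refine HasBlowup.smul (fun f hf hfc => ?_) hpos.le
  rw [← hint f hf]
  refine (tendsto_blowup_param (measurable_surf Q η p q) measurableSet_box
    (mem_interior_iff_mem_nhds.1 hv) hd.hasFDerivAt hκ hlow hf hfc).congr fun t => ?_
  have hs : Continuous fun y : E4 => f (t⁻¹ • (y - surf Q η p q v)) := by fun_prop
  rw [integral_map (measurable_surf Q η p q).aemeasurable hs.aestronglyMeasurable]

theorem isClosed_surf_image (Q : E4 ≃ₗᵢ[ℝ] E4) {η p q : ℂ} (hp : 0 < p.re) (hq : 0 < q.re) :
    IsClosed (surf Q η p q '' box) := by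
  refine (isCompact_box.image_of_continuousOn fun v hv => ?_).isClosed
  exact (contDiffAt_surf Q (n := 0) (segment_re_pos hp hq hv.2)).continuousAt.continuousWithinAt

theorem edgeWeight_compl_eq_zero (Q : E4 ≃ₗᵢ[ℝ] E4) {η p q : ℂ} {S : Set E4}
    (hS : MeasurableSet S) (h : ∀ᵐ v : ℝ × ℝ, v ∈ box → surf Q η p q v ∈ S) :
    edgeWeight Q η p q Sᶜ = 0 := by
  have : ∀ᵐ x ∂(volume.restrict box).map (surf Q η p q), x ∈ S := by
    refine (ae_map_iff (measurable_surf Q η p q).aemeasurable (p := fun x => x ∈ S) hS).2 ?_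
    exact (ae_restrict_iff' measurableSet_box).2 h
  exact Measure.ae_smul_measure this _

theorem edgeWeight_compl_image (Q : E4 ≃ₗᵢ[ℝ] E4) {η p q : ℂ} (hp : 0 < p.re) (hq : 0 < q.re) :
    edgeWeight Q η p q (surf Q η p q '' box)ᶜ = 0 :=
  edgeWeight_compl_eq_zero Q (isClosed_surf_image Q hp hq).measurableSet
    (Eventually.of_forall fun v hv => ⟨v, hv, rfl⟩)

theorem isRectifiableMeasure_edgeWeight (Q : E4 ≃ₗᵢ[ℝ] E4) {η p q : ℂ} (hη : ‖η‖ = 1)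
    (hp : 0 < p.re) (hq : 0 < q.re) (hpq : p ≠ q) :
    IsRectifiableMeasure 2 (edgeWeight Q η p q) := by
  constructor
  · refine Measure.AbsolutelyContinuous.smul_left ?_ _
    have hbox : (volume.restrict box : Measure (ℝ × ℝ)) = volume.restrict (interior box) := by
      refine Measure.restrict_congr_set (interior_ae_eq_of_null_frontier ?_).symm
      exact ((convex_Icc _ _).prod (convex_Icc _ _)).addHaar_frontier volume
    rw [hbox]
    refine absolutelyContinuous_map_hausdorff (measurable_surf Q η p q) fun v hv => ?_
    obtain ⟨L, hd, hL, -⟩ := exists_derivative_surf Q hη hpq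
      (segment_re_pos hp hq (interior_subset hv).2)
    exact ⟨L, hL, hd⟩
  · have hcd : ContDiffOn ℝ 1 (surf Q η p q) box := fun v hv =>
      (contDiffAt_surf Q (segment_re_pos hp hq hv.2)).contDiffWithinAt
    obtain ⟨K, hK⟩ := hcd.exists_lipschitzOnWith (by simp)
      ((convex_Icc _ _).prod (convex_Icc _ _)) isCompact_box
    let g : EuclideanSpace ℝ (Fin 2) →L[ℝ] ℝ × ℝ :=
      (EuclideanSpace.proj (0 : Fin 2)).prod (EuclideanSpace.proj (1 : Fin 2))
    refine ⟨fun _ => surf Q η p q ∘ g, fun _ => g ⁻¹' box, fun _ => ⟨K * ‖g‖₊, ?_⟩, ?_⟩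
    · exact hK.comp g.lipschitz.lipschitzOnWith fun x hx => hx
    · have himg : surf Q η p q '' box ⊆ ⋃ _ : ℕ, (surf Q η p q ∘ g) '' (g ⁻¹' box) := by
        rintro _ ⟨v, hv, rfl⟩
        refine Set.mem_iUnion.2 ⟨0, !₂[v.1, v.2], ?_, ?_⟩
        · exact hv
        · rfl
      refine measure_mono_null (Set.compl_subset_compl.2 himg) ?_
      exact edgeWeight_compl_image Q hp hq

/-! ### Superpositions of rectifiable varifolds -/

/-- Rectifiability of a measure on `ℝ⁴ × G(4,2)`, with a Borel tangent plane field. -/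
def IsRectVarifold (W : Measure (E4 × Gr 4 2)) : Prop :=
  IsRectifiableMeasure 2 (W.map Prod.fst) ∧ ∃ T : E4 → Gr 4 2, Measurable T ∧
    (∀ᵐ x ∂W.map Prod.fst, IsApproxTangentPlane (W.map Prod.fst) x (T x)) ∧
    W = (W.map Prod.fst).map fun x => (x, T x)

theorem map_fst_graph (μ : Measure E4) {T : E4 → Gr 4 2} (hT : Measurable T) :
    (μ.map fun x => (x, T x)).map Prod.fst = μ := by
  rw [Measure.map_map measurable_fst (measurable_graph T hT)]
  exact Measure.map_id

theorem map_fst_sum {ι : Type*} (W : ι → Measure (E4 × Gr 4 2)) :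
    (Measure.sum W).map Prod.fst = Measure.sum fun i => (W i).map Prod.fst :=
  Measure.map_sum measurable_fst.aemeasurable

theorem IsRectifiableMeasure.sum {n : ℕ} {ι : Type*} [Countable ι] {m : ℕ}
    {μ : ι → Measure (EuclideanSpace ℝ (Fin n))} (h : ∀ i, IsRectifiableMeasure m (μ i)) :
    IsRectifiableMeasure m (Measure.sum μ) := by
  refine ⟨Measure.absolutelyContinuous_sum_left fun i => (h i).1, ?_⟩
  rcases isEmpty_or_nonempty ι with hι | hι
  · refine ⟨fun _ _ => 0, fun _ => ∅, fun _ => ⟨0, by simp⟩, ?_⟩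
    rw [Measure.sum_of_isEmpty]; simp
  choose hac φ A hlip h0 using h
  obtain ⟨e, he⟩ := exists_surjective_nat (ι × ℕ)
  refine ⟨fun k => φ (e k).1 (e k).2, fun k => A (e k).1 (e k).2, fun k => hlip _ _, ?_⟩
  have : ∀ᵐ x ∂Measure.sum μ, x ∈ ⋃ k, φ (e k).1 (e k).2 '' A (e k).1 (e k).2 := by
    rw [Measure.ae_sum_iff]
    intro i
    have hi : ∀ᵐ x ∂μ i, x ∈ ⋃ j, φ i j '' A i j := h0 i
    filter_upwards [hi] with x hx
    obtain ⟨j, hj⟩ := Set.mem_iUnion.1 hx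
    obtain ⟨k, hk⟩ := he (i, j)
    refine Set.mem_iUnion.2 ⟨k, ?_⟩
    rw [hk]
    exact hj
  exact this

/-- As the plane fields agree wherever two of the sets `t i` overlap, they glue to one Borel field;
each summand is then the graph measure of this common field. -/
theorem IsRectVarifold.of_family {ι : Type*} [Countable ι] [Nonempty ι] {μ : ι → Measure E4}
    {P : ι → E4 → Gr 4 2} (hP : ∀ i, Measurable (P i)) {t : ι → Set E4}
    (ht : ∀ i, MeasurableSet (t i)) (h0 : ∀ i, μ i (t i)ᶜ = 0)
    (hPt : ∀ i j, Set.EqOn (P i) (P j) (t i ∩ t j)) (hr : ∀ i, IsRectifiableMeasure 2 (μ i))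
    (hT : ∀ i, ∀ᵐ x ∂μ i, x ∈ t i → IsApproxTangentPlane (Measure.sum μ) x (P i x)) :
    IsRectVarifold (Measure.sum fun i => (μ i).map fun x => (x, P i x)) := by
  have hw : (Measure.sum fun i => (μ i).map fun x => (x, P i x)).map Prod.fst =
      Measure.sum μ := by
    rw [map_fst_sum]
    simp_rw [map_fst_graph _ (hP _)]
  obtain ⟨T, hTm, hTe⟩ := exists_measurable_piecewise t ht P hP fun i j _ => hPt i j
  have hmem : ∀ i, ∀ᵐ x ∂μ i, x ∈ t i := h0
  refine ⟨by rw [hw]; exact IsRectifiableMeasure.sum hr, T, hTm, ?_, ?_⟩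
  · rw [hw, Measure.ae_sum_iff]
    intro i
    filter_upwards [hmem i, hT i] with x hx hx'
    rw [hTe i hx]
    exact hx' hx
  · rw [hw, Measure.map_sum (measurable_graph T hTm).aemeasurable]
    congr 1
    ext1 i
    refine Measure.map_congr ?_
    filter_upwards [hmem i] with x hx
    rw [hTe i hx]

theorem IsApproxTangentPlane.congr_of_restrict_eq {μ ν : Measure E4} {U : Set E4} (hU : IsOpen U)
    (h : μ.restrict U = ν.restrict U) {x : E4} (hx : x ∈ U) {T : Gr 4 2}
    (hT : IsApproxTangentPlane μ x T) : IsApproxTangentPlane ν x T := by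
  obtain ⟨θ, hθ, hlim⟩ := hT
  refine ⟨θ, hθ, fun f hf hfc => (hlim f hf hfc).congr' ?_⟩
  filter_upwards [eventually_comp_eq_zero hfc (hU.mem_nhds hx)] with t ht
  rw [← setIntegral_eq_integral_of_forall_compl_eq_zero ht (μ := μ),
    ← setIntegral_eq_integral_of_forall_compl_eq_zero ht (μ := ν), h]

theorem restrict_sum_eq_of_disjoint {ι Ω : Type*} [Countable ι] [MeasurableSpace Ω]
    {μ : ι → Measure Ω} {U : ι → Set Ω} (hU : ∀ i, MeasurableSet (U i))
    (hd : Pairwise fun i j => Disjoint (U i) (U j)) (h0 : ∀ i, μ i (U i)ᶜ = 0) (i : ι) :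
    (Measure.sum μ).restrict (U i) = μ i := by
  classical
  rw [Measure.restrict_sum _ (hU i)]
  have h1 : ∀ j, (μ j).restrict (U i) = if j = i then μ i else 0 := by
    intro j
    split_ifs with hj
    · subst hj
      exact Measure.restrict_eq_self_of_ae_mem (h0 j)
    · rw [Measure.restrict_eq_zero]
      exact measure_mono_null (hd (Ne.symm hj)).subset_compl_right (h0 j)
  simp_rw [h1]
  ext s hs
  rw [Measure.sum_apply _ hs, tsum_eq_single i]
  · simp
  · intro j hj; simp [hj]

/-- Approximate tangent planes are local, and inside the open set `U i` only the i-th summand is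
present. -/
theorem IsRectVarifold.sum {ι : Type*} [Countable ι] [Nonempty ι]
    {W : ι → Measure (E4 × Gr 4 2)} (hW : ∀ i, IsRectVarifold (W i)) {U : ι → Set E4}
    (hU : ∀ i, IsOpen (U i)) (hd : Pairwise fun i j => Disjoint (U i) (U j))
    (h0 : ∀ i, (W i).map Prod.fst (U i)ᶜ = 0) : IsRectVarifold (Measure.sum W) := by
  choose hr T hTm hT hWT using hW
  have := IsRectVarifold.of_family hTm (fun i => (hU i).measurableSet) h0 ?_ hr ?_
  · convert this using 2
    ext1 i
    exact hWT i
  · intro i j x hx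
    rcases eq_or_ne i j with rfl | hij
    · rfl
    · exact absurd hx.2 (Set.disjoint_left.1 (hd hij) hx.1)
  · intro i
    filter_upwards [hT i] with x hx hxU
    refine hx.congr_of_restrict_eq (hU i) ?_ hxU
    rw [restrict_sum_eq_of_disjoint (fun i => (hU i).measurableSet) hd h0]
    exact Measure.restrict_eq_self_of_ae_mem (h0 i)

/-! ### Networks of weighted segments -/

/-- A segment `η² [p, q]` in the plane together with a weight. -/
structure Seg where
  /-- the phase -/
  η : ℂ
  /-- the initial point -/
  p : ℂ
  /-- the end point -/
  q : ℂ
  /-- the weight -/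
  c : ℝ

/-- The phase is a unit, the segment is in the right half-plane and the weight is positive. -/
structure Seg.Valid (e : Seg) : Prop where
  norm_phase : ‖e.η‖ = 1
  re_left : 0 < e.p.re
  re_right : 0 < e.q.re
  ne : e.p ≠ e.q
  weight_pos : 0 < e.c

/-- The direction of a segment. -/
def Seg.dir (e : Seg) : ℂ := e.η ^ 2 * (e.q - e.p)

/-- The point of the rotated segment at parameter `t`. -/
def Seg.point (e : Seg) (t : ℝ) : ℂ := e.η ^ 2 * (e.p + t * (e.q - e.p))

/-- The surface lying over a segment. -/
def Seg.carrier (Q : E4 ≃ₗᵢ[ℝ] E4) (e : Seg) : Set E4 := surf Q e.η e.p e.q '' box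

/-- The weight measure of the surface over a weighted segment. -/
noncomputable def Seg.weight (Q : E4 ≃ₗᵢ[ℝ] E4) (e : Seg) : Measure E4 :=
  ENNReal.ofReal e.c • edgeWeight Q e.η e.p e.q

/-- The varifold given by a family of segments. -/
noncomputable def net {ι : Type} (Q : E4 ≃ₗᵢ[ℝ] E4) (e : ι → Seg) : Measure (E4 × Gr 4 2) :=
  Measure.sum fun i => (Seg.weight Q (e i)).map fun x => (x, planeField Q (e i).dir x)

instance (Q : E4 ≃ₗᵢ[ℝ] E4) (η p q : ℂ) : IsFiniteMeasure (edgeWeight Q η p q) := by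
  have : IsFiniteMeasure (volume.restrict box : Measure (ℝ × ℝ)) :=
    ⟨by rw [Measure.restrict_apply_univ]; exact isCompact_box.measure_lt_top⟩
  unfold edgeWeight
  exact Measure.smul_finite _ ENNReal.ofReal_ne_top

instance (Q : E4 ≃ₗᵢ[ℝ] E4) (e : Seg) : IsFiniteMeasure (Seg.weight Q e) := by
  unfold Seg.weight
  exact Measure.smul_finite _ ENNReal.ofReal_ne_top

theorem Seg.Valid.dir_ne_zero {e : Seg} (h : e.Valid) : e.dir ≠ 0 := by
  have hη0 : e.η ≠ 0 := by intro h0; have := h.norm_phase; simp [h0] at this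
  exact mul_ne_zero (pow_ne_zero _ hη0) (sub_ne_zero.2 h.ne.symm)

theorem planeField_real_mul (Q : E4 ≃ₗᵢ[ℝ] E4) {ζ : ℂ} (hζ : ζ ≠ 0) {r : ℝ} (hr : r ≠ 0) (α : ℝ)
    {w : ℂ} (hw : w ≠ 0) :
    planeField Q (r * ζ) (Q (tens α w)) = planeField Q ζ (Q (tens α w)) := by
  apply Subtype.ext
  rw [planeField_tens Q (mul_ne_zero (Complex.ofReal_ne_zero.2 hr) hζ) α hw,
    planeField_tens Q hζ α hw, mul_left_comm, tens_smul, map_smul, Submodule.span_insert,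
    Submodule.span_insert, Submodule.span_singleton_smul_eq (IsUnit.mk0 _ hr)]

/-- The exceptional points of a family of segments: end points, and the intersection points of
segments that are not parallel. -/
def Seg.crossings {ι : Type} (e : ι → Seg) : Set ℂ :=
  {z | ∃ i, z = (e i).point 0 ∨ z = (e i).point 1} ∪
  {z | ∃ i j, (∃ s : ℝ, z = (e i).point s) ∧ (∃ s : ℝ, z = (e j).point s) ∧
    ¬ ∃ r : ℝ, r ≠ 0 ∧ (e j).dir = r * (e i).dir}

/-- Two lines with two distinct common points have proportional directions, so each non-parallel
pair contributes at most one point. -/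
theorem Seg.finite_crossings {ι : Type} [Finite ι] (e : ι → Seg) :
    (Seg.crossings e).Finite := by
  refine Set.Finite.union ?_ ?_
  · have : {z | ∃ i, z = (e i).point 0 ∨ z = (e i).point 1} =
        Set.range (fun i => (e i).point 0) ∪ Set.range fun i => (e i).point 1 := by
      ext z; simp only [Set.mem_ofPred_eq, Set.mem_union, Set.mem_range, exists_or, eq_comm]
    rw [this]
    exact (Set.finite_range _).union (Set.finite_range _)
  · simp only [Set.ofPred_exists]
    refine Set.finite_iUnion fun i => Set.finite_iUnion fun j => Set.Subsingleton.finite ?_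
    rintro z ⟨⟨s, hs⟩, ⟨s', hs'⟩, hn⟩ z' ⟨⟨u, hu⟩, ⟨u', hu'⟩, -⟩
    by_contra hne
    refine hn ?_
    have h1 : z - z' = ((s - u : ℝ) : ℂ) * (e i).dir := by
      rw [hs, hu, Seg.point, Seg.point, Seg.dir]; push_cast; ring
    have h2 : z - z' = ((s' - u' : ℝ) : ℂ) * (e j).dir := by
      rw [hs', hu', Seg.point, Seg.point, Seg.dir]; push_cast; ring
    have h3 : s' - u' ≠ 0 := by
      intro h; rw [h] at h2; exact sub_ne_zero.2 hne (by simpa using h2)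
    have h4 : s - u ≠ 0 := by
      intro h; rw [h] at h1; exact sub_ne_zero.2 hne (by simpa using h1)
    refine ⟨(s - u) / (s' - u'), div_ne_zero h4 h3, ?_⟩
    have h5 : ((s' - u' : ℝ) : ℂ) ≠ 0 := Complex.ofReal_ne_zero.2 h3
    rw [Complex.ofReal_div, div_mul_eq_mul_div, eq_div_iff h5, mul_comm, ← h2, h1]

/-- The points of `ℝ⁴` over exceptional points, and those of the form `e₁ ⊗ w`. -/
def Seg.badSet {ι : Type} (Q : E4 ≃ₗᵢ[ℝ] E4) (e : ι → Seg) : Set E4 :=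
  {x | Q.symm x 1 = 0 ∧ Q.symm x 3 = 0} ∪ (fun x => hopf (Q.symm x)) ⁻¹' Seg.crossings e

theorem Seg.measurableSet_badSet {ι : Type} [Finite ι] (Q : E4 ≃ₗᵢ[ℝ] E4) (e : ι → Seg) :
    MeasurableSet (Seg.badSet Q e) := by
  have hQ : Continuous fun x => Q.symm x := Q.symm.continuous
  refine MeasurableSet.union ?_ ?_
  · have h1 : Continuous fun x => Q.symm x 1 := by fun_prop
    have h3 : Continuous fun x => Q.symm x 3 := by fun_prop
    exact ((isClosed_eq h1 continuous_const).inter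
      (isClosed_eq h3 continuous_const)).measurableSet
  · exact ((Seg.finite_crossings e).isClosed.preimage (continuous_hopf.comp hQ)).measurableSet

theorem Seg.sin_ne_zero_of_notMem_badSet {ι : Type} (Q : E4 ≃ₗᵢ[ℝ] E4) {e : ι → Seg} {α : ℝ}
    {w : ℂ} (h : Q (tens α w) ∉ Seg.badSet Q e) : Real.sin α ≠ 0 := by
  intro hs
  refine h (Or.inl ?_)
  simp [tens, hs]

theorem Seg.Valid.surf_mem_badSet {ι : Type} {Q : E4 ≃ₗᵢ[ℝ] E4} {e : ι → Seg} {i : ι}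
    (he : (e i).Valid) {v : ℝ × ℝ} (hv : v ∈ box)
    (h : surf Q (e i).η (e i).p (e i).q v ∈ Seg.badSet Q e) :
    Real.sin v.1 = 0 ∨ (e i).point v.2 ∈ Seg.crossings e := by
  have hη0 : (e i).η ≠ 0 := by intro h0; have := he.norm_phase; simp [h0] at this
  rcases h with h | h
  · left
    simp only [surf, Set.mem_ofPred_eq, Q.symm_apply_apply] at h
    have hw := curve_ne_zero (p := (e i).p) (q := (e i).q) hη0 v.2
    set w := curve (e i).η (e i).p (e i).q v.2
    by_contra hs
    refine hw (Complex.ext ?_ ?_)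
    · simpa [tens, hs] using h.1
    · simpa [tens, hs] using h.2
  · right
    rw [Set.mem_preimage, hopf_surf Q (segment_re_pos he.re_left he.re_right hv.2)] at h
    exact h

/-- The bad set is met only for countably many α (zeros of the sine) and countably many t (a segment
is injective and the crossings are finite), hence on a null set of parameters. -/
theorem Seg.Valid.weight_badSet {ι : Type} [Finite ι] {Q : E4 ≃ₗᵢ[ℝ] E4} {e : ι → Seg}
    (he : ∀ i, (e i).Valid) (i : ι) :
    Seg.weight Q (e i) (Seg.carrier Q (e i) \ Seg.badSet Q e)ᶜ = 0 := by
  have h1 : edgeWeight Q (e i).η (e i).p (e i).q (Seg.carrier Q (e i) \ Seg.badSet Q e)ᶜ = 0 := by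
    refine edgeWeight_compl_eq_zero Q ((isClosed_surf_image Q (he i).re_left
      (he i).re_right).measurableSet.diff (Seg.measurableSet_badSet Q e)) ?_
    have hsin : ∀ᵐ v : ℝ × ℝ, ¬ Real.sin v.1 = 0 := by
      have hc : {a : ℝ | Real.sin a = 0}.Countable := by
        have : {a : ℝ | Real.sin a = 0} = Set.range fun n : ℤ => (n : ℝ) * Real.pi := by
          ext a; simp [Real.sin_eq_zero_iff]
        rw [this]; exact Set.countable_range _
      have : ∀ᵐ a : ℝ, ¬ Real.sin a = 0 := hc.ae_notMem volume
      exact Measure.quasiMeasurePreserving_fst.ae this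
    have hcr : ∀ᵐ v : ℝ × ℝ, ¬ (e i).point v.2 ∈ Seg.crossings e := by
      have hinj : Function.Injective (e i).point := by
        intro s s' hs
        have hd := (he i).dir_ne_zero
        have h2 : ((s - s' : ℝ) : ℂ) * (e i).dir = 0 := by
          rw [Seg.dir]
          rw [Seg.point, Seg.point] at hs
          push_cast
          linear_combination hs
        rw [mul_eq_zero, or_iff_left hd, Complex.ofReal_eq_zero] at h2
        linarith
      have hc : ((e i).point ⁻¹' Seg.crossings e).Countable :=
        ((Seg.finite_crossings e).preimage hinj.injOn).countable
      have : ∀ᵐ t : ℝ, ¬ (e i).point t ∈ Seg.crossings e := hc.ae_notMem volume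
      exact Measure.quasiMeasurePreserving_snd.ae this
    filter_upwards [hsin, hcr] with v h2 h3 hv
    refine ⟨⟨v, hv, rfl⟩, fun hb => ?_⟩
    rcases (he i).surf_mem_badSet hv hb with h | h
    exacts [h2 h, h3 h]
  rw [Seg.weight, Measure.smul_apply, h1, smul_zero]

/-- The bad set was chosen to contain the seam α ∈ {0, 2π} of the parametrization and the end
circles. -/
theorem Seg.Valid.exists_interior {ι : Type} {Q : E4 ≃ₗᵢ[ℝ] E4} {e : ι → Seg} {i : ι}
    (he : (e i).Valid) {x : E4} (hx : x ∈ Seg.carrier Q (e i)) (hb : x ∉ Seg.badSet Q e) :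
    ∃ v ∈ interior box, surf Q (e i).η (e i).p (e i).q v = x := by
  obtain ⟨v, hv, rfl⟩ := hx
  refine ⟨v, ?_, rfl⟩
  have hre := segment_re_pos he.re_left he.re_right hv.2
  have hs := Seg.sin_ne_zero_of_notMem_badSet Q hb
  have hcr : (e i).point v.2 ∉ Seg.crossings e := fun h => hb (Or.inr (by
    rw [Set.mem_preimage, hopf_surf Q hre]; exact h))
  rw [interior_box]
  refine ⟨⟨lt_of_le_of_ne hv.1.1 ?_, lt_of_le_of_ne hv.1.2 ?_⟩,
    ⟨lt_of_le_of_ne hv.2.1 ?_, lt_of_le_of_ne hv.2.2 ?_⟩⟩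
  · intro h; exact hs (by rw [← h, Real.sin_zero])
  · intro h; exact hs (by rw [h, Real.sin_two_pi])
  · intro h; exact hcr (Or.inl ⟨i, Or.inl (by rw [← h])⟩)
  · intro h; exact hcr (Or.inl ⟨i, Or.inr (by rw [h])⟩)

/-- Segments meeting off the crossings are parallel, and the plane depends on the direction only up
to a nonzero real factor. -/
theorem Seg.Valid.planeField_eq {ι : Type} {Q : E4 ≃ₗᵢ[ℝ] E4} {e : ι → Seg} {i j : ι}
    (hi : (e i).Valid) (hj : (e j).Valid) {x : E4} (hxi : x ∈ Seg.carrier Q (e i))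
    (hxj : x ∈ Seg.carrier Q (e j)) (hb : x ∉ Seg.badSet Q e) :
    planeField Q (e j).dir x = planeField Q (e i).dir x := by
  obtain ⟨v, hv, rfl⟩ := hxi
  obtain ⟨v', hv', hvv⟩ := hxj
  have h1 := hopf_surf Q (η := (e i).η) (segment_re_pos hi.re_left hi.re_right hv.2)
  have h2 := hopf_surf Q (η := (e j).η) (segment_re_pos hj.re_left hj.re_right hv'.2)
  rw [hvv] at h2
  have h3 : ∃ r : ℝ, r ≠ 0 ∧ (e j).dir = r * (e i).dir := by
    by_contra hn
    exact hb (Or.inr (Or.inr ⟨i, j, ⟨v.2, h1⟩, ⟨v'.2, h2⟩, hn⟩))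
  obtain ⟨r, hr, hd⟩ := h3
  have hη0 : (e i).η ≠ 0 := by intro h0; have := hi.norm_phase; simp [h0] at this
  rw [hd]
  exact planeField_real_mul Q hi.dir_ne_zero hr _ (curve_ne_zero hη0 _)

/-- At a point off the bad set all surfaces through it share one tangent plane, so their blow-ups
are nonnegative multiples of the same Hausdorff measure and can be added; closed surfaces missing
the point contribute 0. Overlapping parallel segments are thus allowed. -/
theorem isRectVarifold_net {ι : Type} [Fintype ι] [Nonempty ι] (Q : E4 ≃ₗᵢ[ℝ] E4) {e : ι → Seg}
    (he : ∀ i, (e i).Valid) : IsRectVarifold (net Q e) := by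
  classical
  have hcl : ∀ i, IsClosed (Seg.carrier Q (e i)) := fun i =>
    isClosed_surf_image Q (he i).re_left (he i).re_right
  refine IsRectVarifold.of_family (fun i => measurable_planeField Q (e i).dir)
    (t := fun i => Seg.carrier Q (e i) \ Seg.badSet Q e)
    (fun i => (hcl i).measurableSet.diff (Seg.measurableSet_badSet Q e))
    (fun i => Seg.Valid.weight_badSet he i) ?_ ?_ ?_
  · rintro i j x ⟨hxi, hxj⟩
    exact (he j).planeField_eq (he i) hxj.1 hxi.1 hxi.2
  · intro i
    obtain ⟨h1, h2⟩ := isRectifiableMeasure_edgeWeight Q (he i).norm_phase (he i).re_left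
      (he i).re_right (he i).ne
    obtain ⟨φ, A, hφ, h0⟩ := h2
    exact ⟨h1.smul_left _, φ, A, hφ, by rw [Seg.weight, Measure.smul_apply, h0, smul_zero]⟩
  · intro i
    refine Eventually.of_forall fun x hx => ?_
    have hall : ∀ j, ∃ θ : ℝ, 0 ≤ θ ∧ (j = i → 0 < θ) ∧
        HasBlowup (Seg.weight Q (e j)) x (planeField Q (e i).dir x) θ := by
      intro j
      by_cases hxj : x ∈ Seg.carrier Q (e j)
      · obtain ⟨v, hv, hvx⟩ := (he j).exists_interior hxj hx.2
        obtain ⟨θ, hθ, hbl⟩ := hasBlowup_edgeWeight Q (he j).norm_phase (he j).re_left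
          (he j).re_right (he j).ne hv
        rw [hvx] at hbl
        have hpf := (he i).planeField_eq (he j) hx.1 hxj hx.2
        have := hbl.smul (he j).weight_pos.le
        have hθ' := mul_pos (he j).weight_pos hθ
        refine ⟨_, hθ'.le, fun _ => hθ', ?_⟩
        rw [← hpf]
        exact this
      · refine ⟨0, le_rfl, fun h => absurd hx.1 (h ▸ hxj), ?_⟩
        refine hasBlowup_zero_of_notMem (hcl j) ?_ hxj _
        rw [Seg.weight, Measure.smul_apply, Seg.carrier,
          edgeWeight_compl_image Q (he j).re_left (he j).re_right, smul_zero]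
    choose θ h0 hpos hbl using hall
    exact ⟨∑ j, θ j, Finset.sum_pos' (fun j _ => h0 j) ⟨i, Finset.mem_univ _, hpos i rfl⟩,
      HasBlowup.sum hbl⟩

/-! ### Forces on the circle over a node -/

/-- The force of a vector field on the circle over `s e^{iθ}`, in the direction `e^{iθ} κ`. -/
noncomputable def nodeForce (Q : E4 ≃ₗᵢ[ℝ] E4) (X : E4 → E4) (s θ : ℝ) (κ : ℂ) : ℝ :=
  traction Q X (Complex.exp (θ / 2 * Complex.I) * Real.sqrt s)
    (Complex.exp (θ * Complex.I) * κ)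

/-- The radial force of a vector field on the circle over `s e^{iθ}`. -/
noncomputable def radialForce (Q : E4 ≃ₗᵢ[ℝ] E4) (X : E4 → E4) (s θ : ℝ) : ℝ :=
  ∫ α in (0 : ℝ)..2 * Real.pi,
    inner ℝ (X (Q (tens α (Complex.exp (θ / 2 * Complex.I) * Real.sqrt s))))
      (Q (tens α (Complex.exp (θ / 2 * Complex.I) * Real.sqrt s)))

theorem continuous_traction_integrand (Q : E4 ≃ₗᵢ[ℝ] E4) {X : E4 → E4} (hX : Continuous X)
    (w v : ℂ) : Continuous fun α => (inner ℝ (X (Q (tens α w))) (Q (tens α v)) : ℝ) := by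
  have h : ∀ u : ℂ, Continuous fun α => Q (tens α u) := fun u =>
    (continuous_isom_tens Q).comp (f := fun α : ℝ => (α, u)) (by fun_prop)
  exact (hX.comp (h w)).inner (h v)

theorem nodeForce_add (Q : E4 ≃ₗᵢ[ℝ] E4) {X : E4 → E4} (hX : Continuous X) (s θ : ℝ) (κ κ' : ℂ) :
    nodeForce Q X s θ (κ + κ') = nodeForce Q X s θ κ + nodeForce Q X s θ κ' := by
  rw [nodeForce, nodeForce, nodeForce, traction, traction, traction,
    ← intervalIntegral.integral_add]
  · congr 1
    ext α
    rw [mul_add, mul_add, tens_add, map_add, inner_add_right]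
  · exact (continuous_traction_integrand Q hX _ _).intervalIntegrable _ _
  · exact (continuous_traction_integrand Q hX _ _).intervalIntegrable _ _

/-- For w = e^{iθ/2}√s one has w̄e^{iθ} = w, so real κ corresponds to the radial direction. -/
theorem nodeForce_ofReal (Q : E4 ≃ₗᵢ[ℝ] E4) (X : E4 → E4) (s θ κ : ℝ) :
    nodeForce Q X s θ κ = κ * radialForce Q X s θ := by
  rw [nodeForce, radialForce, traction, ← intervalIntegral.integral_const_mul]
  congr 1
  ext α
  have h : conj (Complex.exp (θ / 2 * Complex.I) * Real.sqrt s) *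
      (Complex.exp (θ * Complex.I) * κ) =
      κ * (Complex.exp (θ / 2 * Complex.I) * Real.sqrt s) := by
    rw [map_mul, Complex.conj_ofReal, ← Complex.exp_conj]
    have h1 : conj ((θ : ℂ) / 2 * Complex.I) = -(θ / 2 * Complex.I) := by
      rw [map_mul, Complex.conj_I, map_div₀, Complex.conj_ofReal, Complex.conj_ofNat]
      ring
    have h2 : Complex.exp (θ * Complex.I) =
        Complex.exp (θ / 2 * Complex.I) * Complex.exp (θ / 2 * Complex.I) := by
      rw [← Complex.exp_add]; ring_nf
    have h3 : Complex.exp (-(θ / 2 * Complex.I)) * Complex.exp (θ / 2 * Complex.I) = 1 := by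
      rw [← Complex.exp_add]; simp
    rw [h1, h2]
    linear_combination (Complex.exp (θ / 2 * Complex.I) * κ * Real.sqrt s) * h3
  rw [h, tens_smul, map_smul, real_inner_smul_right]

theorem tens_neg_eq_add_pi (α : ℝ) (w : ℂ) : tens α (-w) = tens (α + Real.pi) w := by
  rw [tens_neg, tens_add_pi]

/-- Since u ⊗ (-w) = (-u) ⊗ w, changing the square root shifts α by π, which a full period does not
notice. -/
theorem traction_neg (Q : E4 ≃ₗᵢ[ℝ] E4) (X : E4 → E4) (w ζ : ℂ) :
    traction Q X (-w) ζ = traction Q X w ζ := by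
  rw [traction, traction]
  simp_rw [map_neg, neg_mul, tens_neg_eq_add_pi]
  have hp : Function.Periodic (fun α => (inner ℝ (X (Q (tens α w)))
      (Q (tens α (conj w * ζ))) : ℝ)) (2 * Real.pi) := by
    intro α
    simp only [tens_add_two_pi]
  rw [intervalIntegral.integral_comp_add_right
    (fun α => (inner ℝ (X (Q (tens α w))) (Q (tens α (conj w * ζ))) : ℝ)), zero_add, add_comm]
  have := hp.intervalIntegral_add_eq Real.pi 0
  rwa [zero_add] at this

/-- The root e^{iθ/2} changes sign after a full turn of θ; by `traction_neg` the force is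
nevertheless a function of the point s e^{iθ}. -/
theorem nodeForce_periodic (Q : E4 ≃ₗᵢ[ℝ] E4) (X : E4 → E4) (s : ℝ) (κ : ℂ) :
    Function.Periodic (fun θ => nodeForce Q X s θ κ) (2 * Real.pi) := by
  intro θ
  simp only [nodeForce]
  have h1 : Complex.exp (((θ + 2 * Real.pi : ℝ) : ℂ) / 2 * Complex.I) =
      -Complex.exp (θ / 2 * Complex.I) := by
    rw [← Complex.exp_add_pi_mul_I]
    congr 1
    push_cast; ring
  have h2 : Complex.exp (((θ + 2 * Real.pi : ℝ) : ℂ) * Complex.I) =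
      Complex.exp (θ * Complex.I) := by
    have h3 : ((θ + 2 * Real.pi : ℝ) : ℂ) * Complex.I = θ * Complex.I + 2 * Real.pi * Complex.I := by
      push_cast; ring
    rw [h3, Complex.exp_periodic]
  rw [h1, h2, neg_mul, traction_neg]

theorem radialForce_eq (Q : E4 ≃ₗᵢ[ℝ] E4) (X : E4 → E4) (s θ : ℝ) :
    radialForce Q X s θ = nodeForce Q X s θ 1 := by
  have := nodeForce_ofReal Q X s θ 1
  rw [one_mul, Complex.ofReal_one] at this
  exact this.symm

theorem radialForce_periodic (Q : E4 ≃ₗᵢ[ℝ] E4) (X : E4 → E4) (s : ℝ) :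
    Function.Periodic (radialForce Q X s) (2 * Real.pi) := by
  intro θ
  rw [radialForce_eq, radialForce_eq]
  exact nodeForce_periodic Q X s 1 θ

/-! ### Segments in polar coordinates -/

/-- The segment from `a e^{iθ}` to `b e^{i(θ + δ)}`. -/
noncomputable def Seg.polar (θ δ a b c : ℝ) : Seg where
  η := Complex.exp (θ / 2 * Complex.I)
  p := a
  q := b * Complex.exp (δ * Complex.I)
  c := c

theorem Seg.re_polar (δ b : ℝ) : ((b : ℂ) * Complex.exp (δ * Complex.I)).re = b * Real.cos δ := by
  rw [Complex.re_ofReal_mul, Complex.exp_ofReal_mul_I_re]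

/-- The conditions under which the segments are admissible. -/
structure Admissible (δ a b : ℝ) : Prop where
  pos : 0 < a
  lt : a < b
  le_cos : a < b * Real.cos δ
  abs_lt : |δ| < Real.pi

theorem Admissible.neg {δ a b : ℝ} (h : Admissible δ a b) : Admissible (-δ) a b :=
  ⟨h.pos, h.lt, by rw [Real.cos_neg]; exact h.le_cos, by rw [abs_neg]; exact h.abs_lt⟩

theorem Admissible.lt_sub {δ a b : ℝ} (h : Admissible δ a b) : 0 < b - a * Real.cos δ := by
  have := h.pos
  nlinarith [h.lt, Real.cos_le_one δ]

theorem Seg.valid_polar (θ : ℝ) {δ a b c : ℝ} (h : Admissible δ a b) (hc : 0 < c) :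
    (Seg.polar θ δ a b c).Valid := by
  refine ⟨?_, ?_, ?_, ?_, hc⟩
  · have := Complex.norm_exp_ofReal_mul_I (θ / 2)
    push_cast at this
    exact this
  · exact h.pos
  · simp only [Seg.polar, Seg.re_polar]; exact h.pos.trans h.le_cos
  · intro he
    have := congrArg Complex.re he
    simp only [Seg.polar, Seg.re_polar, Complex.ofReal_re] at this
    exact h.le_cos.ne this

theorem norm_sq_polar_point {δ a b : ℝ} (t : ℝ) :
    ‖(a : ℂ) + t * (b * Complex.exp (δ * Complex.I) - a)‖ ^ 2 =
      a ^ 2 + 2 * t * a * (b * Real.cos δ - a) +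
        t ^ 2 * (a ^ 2 + b ^ 2 - 2 * a * b * Real.cos δ) := by
  rw [Complex.sq_norm, Complex.normSq_apply]
  simp only [Complex.add_re, Complex.add_im, Complex.re_ofReal_mul, Complex.im_ofReal_mul,
    Complex.sub_re, Complex.sub_im, Complex.ofReal_re, Complex.ofReal_im,
    Complex.exp_ofReal_mul_I_re, Complex.exp_ofReal_mul_I_im]
  linear_combination t ^ 2 * b ^ 2 * Real.sin_sq_add_cos_sq δ

/-- Because a < b cos δ, the squared modulus is a quadratic in t with positive linear and
nonnegative leading coefficient, increasing from a² to b². Layers over disjoint ranges of radii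
therefore live in disjoint shells. -/
theorem norm_polar_point_mem {δ a b t : ℝ} (h : Admissible δ a b) (ht : t ∈ Set.Ioo (0 : ℝ) 1) :
    ‖(a : ℂ) + t * (b * Complex.exp (δ * Complex.I) - a)‖ ∈ Set.Ioo a b := by
  have h1 := norm_sq_polar_point (δ := δ) (a := a) (b := b) t
  have h2 : 0 < 2 * a * (b * Real.cos δ - a) := by
    have := sub_pos.2 h.le_cos
    have := h.pos
    positivity
  have h3 : 0 ≤ a ^ 2 + b ^ 2 - 2 * a * b * Real.cos δ := by
    nlinarith [Real.cos_le_one δ, mul_pos h.pos (h.pos.trans h.lt), sq_nonneg (a - b)]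
  constructor
  · refine lt_of_pow_lt_pow_left₀ 2 (norm_nonneg _) ?_
    rw [h1]
    nlinarith [mul_pos ht.1 h2, mul_nonneg (sq_nonneg t) h3]
  · refine lt_of_pow_lt_pow_left₀ 2 (h.pos.trans h.lt).le ?_
    rw [h1]
    have e : b ^ 2 - (a ^ 2 + 2 * t * a * (b * Real.cos δ - a) +
        t ^ 2 * (a ^ 2 + b ^ 2 - 2 * a * b * Real.cos δ)) =
        (1 - t) * (2 * a * (b * Real.cos δ - a) +
          (1 + t) * (a ^ 2 + b ^ 2 - 2 * a * b * Real.cos δ)) := by ring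
    have h4 : 0 < (1 - t) * (2 * a * (b * Real.cos δ - a) +
          (1 + t) * (a ^ 2 + b ^ 2 - 2 * a * b * Real.cos δ)) := by
      refine mul_pos (sub_pos.2 ht.2) (add_pos_of_pos_of_nonneg h2 (mul_nonneg ?_ h3))
      linarith [ht.1]
    linarith

/-- The direction e^{iθ}(be^{iδ} - a) is rewritten as e^{i(θ+δ)}(b - ae^{-iδ}), relative to the
phase of the far node. The condition |δ| < π makes the principal logarithm return δ. -/
theorem traction_curve_polar (Q : E4 ≃ₗᵢ[ℝ] E4) (X : E4 → E4) (θ : ℝ) {δ a b : ℝ}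
    (h : Admissible δ a b) (c : ℝ) :
    let e := Seg.polar θ δ a b c
    traction Q X (curve e.η e.p e.q 1) (e.η ^ 2 * (e.q - e.p)) =
      nodeForce Q X b (θ + δ) (b - a * Complex.exp (-(δ * Complex.I))) ∧
    traction Q X (curve e.η e.p e.q 0) (e.η ^ 2 * (e.q - e.p)) =
      nodeForce Q X a θ (b * Complex.exp (δ * Complex.I) - a) := by
  have hη : Complex.exp (θ / 2 * Complex.I) ^ 2 = Complex.exp (θ * Complex.I) := by
    rw [← Complex.exp_nat_mul]; congr 1; push_cast; ring
  have hb : 0 < b := h.pos.trans h.lt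
  have hsqrt : ∀ s : ℝ, 0 < s → Complex.exp ((Real.log s : ℂ) / 2) = Real.sqrt s := by
    intro s hs
    rw [Real.sqrt_eq_rpow, Real.rpow_def_of_pos hs]
    push_cast
    congr 1; ring
  simp only [Seg.polar, hη, nodeForce]
  constructor
  · congr 1
    · rw [curve]
      have hlog : Complex.log ((a : ℂ) + ((1 : ℝ) : ℂ) * (b * Complex.exp (δ * Complex.I) - a)) =
          (Real.log b : ℂ) + δ * Complex.I := by
        have h1 : (a : ℂ) + ((1 : ℝ) : ℂ) * (b * Complex.exp (δ * Complex.I) - a) =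
            Complex.exp ((Real.log b : ℂ) + δ * Complex.I) := by
          rw [Complex.exp_add, ← Complex.ofReal_exp, Real.exp_log hb]
          push_cast; ring
        have hlt := abs_lt.1 h.abs_lt
        rw [h1, Complex.log_exp]
        · simpa using hlt.1
        · simpa using hlt.2.le
      rw [hlog, add_div, Complex.exp_add, hsqrt b hb, mul_comm (Real.sqrt b : ℂ), ← mul_assoc,
        ← Complex.exp_add]
      congr 2
      push_cast; ring
    · push_cast
      rw [add_mul, Complex.exp_add, mul_assoc, mul_sub (Complex.exp (δ * Complex.I))]
      have h1 : Complex.exp (δ * Complex.I) * (a * Complex.exp (-(δ * Complex.I))) = a := by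
        rw [mul_left_comm, ← Complex.exp_add]; simp
      rw [h1, mul_comm (b : ℂ)]
  · congr 1
    rw [curve]
    have : (a : ℂ) + ((0 : ℝ) : ℂ) * (b * Complex.exp (δ * Complex.I) - a) = a := by simp
    rw [this, ← Complex.ofReal_log h.pos.le, hsqrt a h.pos]

theorem Seg.map_weight_eq_smul_edge (Q : E4 ≃ₗᵢ[ℝ] E4) (e : Seg) :
    (Seg.weight Q e).map (fun x => (x, planeField Q e.dir x)) =
      ENNReal.ofReal e.c • edge Q e.η e.p e.q := by
  rw [Seg.weight, Measure.map_smul]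
  rfl

theorem integral_net {ι : Type} [Fintype ι] (Q : E4 ≃ₗᵢ[ℝ] E4) (e : ι → Seg)
    (hc : ∀ i, 0 ≤ (e i).c) {f : E4 × Gr 4 2 → ℝ} (hf : Measurable f) {C : ℝ}
    (hb : ∀ x, |f x| ≤ C) :
    ∫ x, f x ∂net Q e = ∑ i, (e i).c * ∫ x, f x ∂edge Q (e i).η (e i).p (e i).q := by
  rw [net, Measure.sum_fintype, integral_finsetSum_measure]
  · refine Finset.sum_congr rfl fun i _ => ?_
    rw [Seg.map_weight_eq_smul_edge, integral_smul_measure, ENNReal.toReal_ofReal (hc i),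
      smul_eq_mul]
  · intro i _
    have : IsFiniteMeasure ((Seg.weight Q (e i)).map
        fun x => (x, planeField Q (e i).dir x)) := by infer_instance
    exact Integrable.of_bound hf.aestronglyMeasurable C (Eventually.of_forall hb)

/-- Area π‖q - p‖ times multiplicity ‖q - p‖. -/
theorem edgeWeight_univ (Q : E4 ≃ₗᵢ[ℝ] E4) (η p q : ℂ) :
    edgeWeight Q η p q Set.univ = ENNReal.ofReal (Real.pi * ‖q - p‖ ^ 2) := by
  rw [edgeWeight, Measure.smul_apply, Measure.map_apply (measurable_surf Q η p q)
    MeasurableSet.univ, Set.preimage_univ, Measure.restrict_apply_univ, box,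
    Measure.volume_eq_prod, Measure.prod_prod, Real.volume_Icc, Real.volume_Icc, smul_eq_mul,
    ← ENNReal.ofReal_mul (by linarith [Real.pi_pos]), ← ENNReal.ofReal_mul (by positivity)]
  congr 1
  ring

theorem net_univ {ι : Type} [Fintype ι] (Q : E4 ≃ₗᵢ[ℝ] E4) (e : ι → Seg)
    (hc : ∀ i, 0 ≤ (e i).c) :
    net Q e Set.univ = ENNReal.ofReal (∑ i, (e i).c * (Real.pi * ‖(e i).q - (e i).p‖ ^ 2)) := by
  rw [net, Measure.sum_apply _ MeasurableSet.univ, tsum_fintype, ENNReal.ofReal_sum_of_nonneg]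
  · refine Finset.sum_congr rfl fun i _ => ?_
    rw [Measure.map_apply (measurable_graph _ (measurable_planeField _ _)) MeasurableSet.univ,
      Set.preimage_univ, Seg.weight, Measure.smul_apply, edgeWeight_univ, smul_eq_mul,
      ← ENNReal.ofReal_mul (hc i)]
  · intro i _
    have := hc i
    have := Real.pi_pos
    positivity

theorem map_fst_net {ι : Type} (Q : E4 ≃ₗᵢ[ℝ] E4) (e : ι → Seg) :
    (net Q e).map Prod.fst = Measure.sum fun i => Seg.weight Q (e i) := by
  rw [net, map_fst_sum]
  simp_rw [map_fst_graph _ (measurable_planeField Q _)]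

/-- The spherical shell of points with `a < ‖x‖² < b`. -/
def shell (a b : ℝ) : Set E4 := {x | ‖x‖ ^ 2 ∈ Set.Ioo a b}

theorem isOpen_shell (a b : ℝ) : IsOpen (shell a b) :=
  isOpen_Ioo.preimage (by fun_prop : Continuous fun x : E4 => ‖x‖ ^ 2)

theorem norm_sq_surf_polar (Q : E4 ≃ₗᵢ[ℝ] E4) {θ δ a b c : ℝ} (h : Admissible δ a b)
    {v : ℝ × ℝ} (hv : v.2 ∈ Set.Icc (0 : ℝ) 1) :
    let e := Seg.polar θ δ a b c
    ‖surf Q e.η e.p e.q v‖ ^ 2 = ‖(a : ℂ) + v.2 * (b * Complex.exp (δ * Complex.I) - a)‖ := by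
  have hval := Seg.valid_polar θ h one_pos
  intro e
  rw [surf, Q.norm_map, norm_tens]
  exact norm_curve_sq (η := e.η) (p := e.p) (q := e.q) hval.norm_phase
    (segment_re_pos hval.re_left hval.re_right hv)

theorem Seg.weight_polar_shell (Q : E4 ≃ₗᵢ[ℝ] E4) {θ δ a b c : ℝ} (h : Admissible δ a b) :
    Seg.weight Q (Seg.polar θ δ a b c) (shell a b)ᶜ = 0 := by
  rw [Seg.weight, Measure.smul_apply, edgeWeight_compl_eq_zero Q (isOpen_shell a b).measurableSet,
    smul_zero]
  have h0 : ∀ᵐ t : ℝ, t ∉ ({0, 1} : Set ℝ) := (Set.toFinite _).countable.ae_notMem volume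
  filter_upwards [Measure.quasiMeasurePreserving_snd.ae h0] with v hv hvb
  have ht : v.2 ∈ Set.Ioo (0 : ℝ) 1 := by
    simp only [Set.mem_insert_iff, Set.mem_singleton_iff, not_or] at hv
    exact ⟨lt_of_le_of_ne hvb.2.1 (Ne.symm hv.1), lt_of_le_of_ne hvb.2.2 hv.2⟩
  have h1 := norm_sq_surf_polar Q (θ := θ) (c := c) h hvb.2
  simp only at h1
  simp only [shell, Set.mem_ofPred_eq, h1]
  exact norm_polar_point_mem h ht

/-! ### Rings of nodes and symmetric layers -/

/-- The mean of `g` over the `N` angles `φ + 2πj/N`. -/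
noncomputable def ringAvg (g : ℝ → ℝ) (N : ℕ) (φ : ℝ) : ℝ :=
  (N : ℝ)⁻¹ * ∑ j ∈ Finset.range N, g (φ + 2 * Real.pi * j / N)

theorem ringAvg_shift {g : ℝ → ℝ} (hg : Function.Periodic g (2 * Real.pi)) {N : ℕ} (hN : N ≠ 0)
    (φ : ℝ) : ringAvg g N (φ + 2 * Real.pi / N) = ringAvg g N φ := by
  have hN' : (N : ℝ) ≠ 0 := Nat.cast_ne_zero.2 hN
  rw [ringAvg, ringAvg]
  congr 1
  have h1 : ∀ j : ℕ, g (φ + 2 * Real.pi / N + 2 * Real.pi * j / N) =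
      (fun j : ℕ => g (φ + 2 * Real.pi * j / N)) (j + 1) := by
    intro j
    simp only
    congr 1
    push_cast; ring
  simp_rw [h1]
  have h2 := Finset.sum_range_succ (fun j : ℕ => g (φ + 2 * Real.pi * j / N)) N
  rw [Finset.sum_range_succ' (fun j : ℕ => g (φ + 2 * Real.pi * j / N)) N] at h2
  have h3 : g (φ + 2 * Real.pi * (N : ℝ) / N) = g (φ + 2 * Real.pi * ((0 : ℕ) : ℝ) / N) := by
    rw [mul_div_cancel_right₀ _ hN', hg]; simp
  rw [h3] at h2
  exact add_right_cancel h2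

theorem ringAvg_double (g : ℝ → ℝ) {N : ℕ} (hN : N ≠ 0) (φ : ℝ) :
    ringAvg g (2 * N) φ = (ringAvg g N φ + ringAvg g N (φ + Real.pi / N)) / 2 := by
  have hN' : (N : ℝ) ≠ 0 := Nat.cast_ne_zero.2 hN
  have h : ∀ M : ℕ, ∑ j ∈ Finset.range (2 * M), g (φ + 2 * Real.pi * j / ((2 * N : ℕ) : ℝ)) =
      ∑ j ∈ Finset.range M, g (φ + 2 * Real.pi * j / N) +
      ∑ j ∈ Finset.range M, g (φ + Real.pi / N + 2 * Real.pi * j / N) := by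
    intro M
    induction M with
    | zero => simp
    | succ M ih =>
      rw [mul_add_one, Finset.sum_range_succ, Finset.sum_range_succ, ih, Finset.sum_range_succ,
        Finset.sum_range_succ]
      have e1 : φ + 2 * Real.pi * ((2 * M : ℕ) : ℝ) / ((2 * N : ℕ) : ℝ) =
          φ + 2 * Real.pi * M / N := by push_cast; field_simp
      have e2 : φ + 2 * Real.pi * ((2 * M + 1 : ℕ) : ℝ) / ((2 * N : ℕ) : ℝ) =
          φ + Real.pi / N + 2 * Real.pi * M / N := by push_cast; field_simp; ring
      rw [e1, e2]
      ring
  rw [ringAvg, ringAvg, ringAvg, h]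
  push_cast
  field_simp

/-- The segments from the `N` points at radius `a` and phase `φ`, turning by `± δ` up to
radius `b`, with total radial flux `w` at radius `b`. -/
noncomputable def layerSeg (N : ℕ) (φ δ a b w : ℝ) (i : Fin N × Bool) : Seg :=
  Seg.polar (φ + 2 * Real.pi * (i.1 : ℕ) / N) (if i.2 then δ else -δ) a b
    (w / (2 * N * (b - a * Real.cos δ)))

theorem layerSeg_valid {N : ℕ} {φ δ a b w : ℝ} (h : Admissible δ a b) (hw : 0 < w)
    (i : Fin N × Bool) : (layerSeg N φ δ a b w i).Valid := by
  have hN : 0 < N := i.1.pos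
  have hN' : (0 : ℝ) < N := Nat.cast_pos.2 hN
  have := h.lt_sub
  refine Seg.valid_polar _ ?_ (by positivity)
  split_ifs
  exacts [h, h.neg]

theorem norm_sub_polar_sq (δ a b : ℝ) :
    ‖(b : ℂ) * Complex.exp (δ * Complex.I) - a‖ ^ 2 =
      b * (b - a * Real.cos δ) - a * (b * Real.cos δ - a) := by
  rw [Complex.sq_norm, Complex.normSq_apply]
  simp only [Complex.re_ofReal_mul, Complex.im_ofReal_mul,
    Complex.sub_re, Complex.sub_im, Complex.ofReal_re, Complex.ofReal_im,
    Complex.exp_ofReal_mul_I_re, Complex.exp_ofReal_mul_I_im]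
  linear_combination b ^ 2 * Real.sin_sq_add_cos_sq δ

/-- The value is half the force of `layerSeg_force` for the field X(x) = x, whose divergence along a
plane is 2 and whose radial force at radius s is 2πs; here it follows directly from the edge
lengths. -/
theorem layerSeg_mass {N : ℕ} (hN : N ≠ 0) {φ δ a b w : ℝ} (h : Admissible δ a b) :
    ∑ i, (layerSeg N φ δ a b w i).c *
      (Real.pi * ‖(layerSeg N φ δ a b w i).q - (layerSeg N φ δ a b w i).p‖ ^ 2) =
      Real.pi * w * (b - (b * Real.cos δ - a) / (b - a * Real.cos δ) * a) := by
  have hN' : (N : ℝ) ≠ 0 := Nat.cast_ne_zero.2 hN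
  have h0 := h.lt_sub.ne'
  have h1 : ∀ i : Fin N × Bool, (layerSeg N φ δ a b w i).c *
      (Real.pi * ‖(layerSeg N φ δ a b w i).q - (layerSeg N φ δ a b w i).p‖ ^ 2) =
      w / (2 * N * (b - a * Real.cos δ)) *
        (Real.pi * (b * (b - a * Real.cos δ) - a * (b * Real.cos δ - a))) := by
    rintro ⟨j, s⟩
    simp only [layerSeg, Seg.polar]
    rw [norm_sub_polar_sq]
    split_ifs
    · rfl
    · rw [Real.cos_neg]
  simp_rw [h1]
  rw [Finset.sum_const, nsmul_eq_mul, Finset.card_univ, Fintype.card_prod, Fintype.card_fin,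
    Fintype.card_bool]
  push_cast
  field_simp

/-- At every node two mirror-image segments meet, so tangential components cancel and only radial
forces remain. The weight in `layerSeg` is normalized to give total flux w at radius b; at radius a
the flux is multiplied by (b cos δ - a)/(b - a cos δ). -/
theorem layerSeg_force (Q : E4 ≃ₗᵢ[ℝ] E4) {N : ℕ} (hN : N ≠ 0) {φ δ a b w : ℝ}
    (h : Admissible δ a b) (hδ : δ = 0 ∨ δ = Real.pi / N) {X : E4 → E4} (hX : ContDiff ℝ ∞ X) :
    ∑ i, (layerSeg N φ δ a b w i).c * ∫ x, divAlong x.2 X x.1 ∂edge Q (layerSeg N φ δ a b w i).η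
      (layerSeg N φ δ a b w i).p (layerSeg N φ δ a b w i).q =
      w * (ringAvg (radialForce Q X b) N (φ + δ) -
        (b * Real.cos δ - a) / (b - a * Real.cos δ) * ringAvg (radialForce Q X a) N φ) := by
  have hN' : (N : ℝ) ≠ 0 := Nat.cast_ne_zero.2 hN
  have h0 := h.lt_sub.ne'
  have hXc := hX.continuous
  set c := w / (2 * N * (b - a * Real.cos δ)) with hc
  have hedge : ∀ (θ : ℝ) {δ' : ℝ}, Admissible δ' a b → ∫ x, divAlong x.2 X x.1 ∂edge Q
      (Seg.polar θ δ' a b c).η (Seg.polar θ δ' a b c).p (Seg.polar θ δ' a b c).q =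
      nodeForce Q X b (θ + δ') (b - a * Complex.exp (-(δ' * Complex.I))) -
        nodeForce Q X a θ (b * Complex.exp (δ' * Complex.I) - a) := by
    intro θ δ' h'
    have hv := Seg.valid_polar θ h' one_pos
    obtain ⟨h1, h2⟩ := traction_curve_polar Q X θ h' c
    rw [← h1, ← h2]
    exact firstVariation_edge Q hv.norm_phase hv.re_left hv.re_right hv.ne hX
  have hexp1 : Complex.exp (-(δ * Complex.I)) = Real.cos δ - Real.sin δ * Complex.I := by
    have := Complex.exp_mul_I (-δ : ℂ)
    rw [Complex.cos_neg, Complex.sin_neg] at this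
    push_cast
    rw [← neg_mul, this]; ring
  have hexp2 : Complex.exp (δ * Complex.I) = Real.cos δ + Real.sin δ * Complex.I := by
    rw [Complex.exp_mul_I]; push_cast; ring
  let θ : ℕ → ℝ := fun j => φ + 2 * Real.pi * j / N
  let κ : ℂ := b - a * Complex.exp (-(δ * Complex.I))
  let κ' : ℂ := b - a * Complex.exp (δ * Complex.I)
  have hterm : ∀ j : Fin N, ∑ s, (layerSeg N φ δ a b w (j, s)).c * ∫ x, divAlong x.2 X x.1 ∂edge Q
      (layerSeg N φ δ a b w (j, s)).η (layerSeg N φ δ a b w (j, s)).p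
      (layerSeg N φ δ a b w (j, s)).q =
      c * (nodeForce Q X b (θ j + δ) κ + nodeForce Q X b (θ j - δ) κ' -
        2 * (b * Real.cos δ - a) * radialForce Q X a (θ j)) := by
    intro j
    rw [Fintype.sum_bool]
    have e1 := hedge (θ j) h
    have e2 := hedge (θ j) h.neg
    simp only [layerSeg, if_true, if_false, Bool.false_eq_true]
    -- Both segments start at the same node of radius a, so the imaginary parts cancel node by node.
    have e3 : nodeForce Q X a (θ j) (b * Complex.exp (δ * Complex.I) - a) +
        nodeForce Q X a (θ j) (b * Complex.exp (-(δ * Complex.I)) - a) =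
        2 * (b * Real.cos δ - a) * radialForce Q X a (θ j) := by
      rw [← nodeForce_add Q hXc, ← nodeForce_ofReal]
      congr 1
      rw [hexp1, hexp2]
      push_cast
      ring
    rw [← e3]
    refine (congrArg₂ (fun u v => c * u + c * v) e1 e2).trans ?_
    push_cast
    simp only [neg_mul, neg_neg, κ, κ']
    rw [← sub_eq_add_neg]
    ring
  rw [Fintype.sum_prod_type]
  simp_rw [hterm]
  rw [← Finset.mul_sum, Finset.sum_sub_distrib, Finset.sum_add_distrib, ← Finset.mul_sum,
    Fin.sum_univ_eq_sum_range (fun j => nodeForce Q X b (θ j + δ) κ),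
    Fin.sum_univ_eq_sum_range (fun j => nodeForce Q X b (θ j - δ) κ'),
    Fin.sum_univ_eq_sum_range (fun j => radialForce Q X a (θ j))]
  have hring : ∀ (g : ℝ → ℝ) (φ' : ℝ), ∑ j ∈ Finset.range N, g (φ' + 2 * Real.pi * j / N) =
      N * ringAvg g N φ' := by
    intro g φ'
    rw [ringAvg, mul_inv_cancel_left₀ hN']
  have s1 : ∑ j ∈ Finset.range N, nodeForce Q X b (θ j + δ) κ =
      N * ringAvg (fun x => nodeForce Q X b x κ) N (φ + δ) := by
    rw [← hring]
    refine Finset.sum_congr rfl fun j _ => ?_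
    simp only [θ]; congr 1; ring
  have s2 : ∑ j ∈ Finset.range N, nodeForce Q X b (θ j - δ) κ' =
      N * ringAvg (fun x => nodeForce Q X b x κ') N (φ + δ) := by
    -- At radius b the mirror partner starts from a neighbouring node: for δ = π/N the phases φ - δ
    -- and φ + δ differ by one step 2π/N and give the same ring.
    have hs : ringAvg (fun x => nodeForce Q X b x κ') N (φ - δ) =
        ringAvg (fun x => nodeForce Q X b x κ') N (φ + δ) := by
      rcases hδ with rfl | rfl
      · rw [sub_zero, add_zero]
      · rw [← ringAvg_shift (nodeForce_periodic Q X b κ') hN]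
        congr 1; ring
    rw [← hs, ← hring]
    refine Finset.sum_congr rfl fun j _ => ?_
    simp only [θ]; congr 1; ring
  have s3 : ringAvg (fun x => nodeForce Q X b x κ) N (φ + δ) +
      ringAvg (fun x => nodeForce Q X b x κ') N (φ + δ) =
      2 * (b - a * Real.cos δ) * ringAvg (radialForce Q X b) N (φ + δ) := by
    have hk : κ + κ' = ((2 * (b - a * Real.cos δ) : ℝ) : ℂ) := by
      simp only [κ, κ', hexp1, hexp2]
      push_cast
      ring
    rw [ringAvg, ringAvg, ringAvg, ← mul_add, ← Finset.sum_add_distrib]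
    simp_rw [← nodeForce_add Q hXc, hk, nodeForce_ofReal]
    rw [← Finset.mul_sum]
    ring
  have s4 : ∑ j ∈ Finset.range N, radialForce Q X a (θ j) =
      N * ringAvg (radialForce Q X a) N φ := hring _ _
  rw [s1, s2, s4, ← mul_add, s3, hc]
  field_simp

/-! ### Varifolds in shells with prescribed boundary forces -/

/-- A rectifiable varifold in the shell `a < ‖x‖² < b` with first variation `F` and mass `m`. -/
structure IsFlow (W : Measure (E4 × Gr 4 2)) (a b : ℝ) (F : (E4 → E4) → ℝ) (m : ℝ) : Prop where
  rect : IsRectVarifold W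
  shell_compl : W.map Prod.fst (shell a b)ᶜ = 0
  mass : W Set.univ = ENNReal.ofReal m
  mass_nonneg : 0 ≤ m
  force : ∀ X : E4 → E4, ContDiff ℝ ∞ X → HasCompactSupport X →
    ∫ x, divAlong x.2 X x.1 ∂W = F X

theorem IsFlow.isFiniteMeasure {W : Measure (E4 × Gr 4 2)} {a b : ℝ} {F : (E4 → E4) → ℝ} {m : ℝ}
    (h : IsFlow W a b F m) : IsFiniteMeasure W :=
  ⟨by rw [h.mass]; exact ENNReal.ofReal_lt_top⟩

theorem integrable_divAlong {W : Measure (E4 × Gr 4 2)} [IsFiniteMeasure W] {X : E4 → E4}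
    (hX : ContDiff ℝ ∞ X) (hc : HasCompactSupport X) :
    Integrable (fun x : E4 × Gr 4 2 => divAlong x.2 X x.1) W := by
  obtain ⟨C, hC⟩ := exists_bound_divAlong hX hc
  exact Integrable.of_bound (continuous_divAlong hX).measurable.aestronglyMeasurable C
    (Eventually.of_forall fun x => hC _ _)

theorem shell_mono {a b A B : ℝ} (h1 : A ≤ a) (h2 : b ≤ B) : shell a b ⊆ shell A B :=
  fun _ hx => Set.Ioo_subset_Ioo h1 h2 hx

theorem disjoint_shell {a b a' b' : ℝ} (h : Disjoint (Set.Ioo a b) (Set.Ioo a' b')) :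
    Disjoint (shell a b) (shell a' b') :=
  h.preimage _

/-- Finite total mass makes the first variation countably additive, so it is the limit of the
partial sums of forces. In the applications these telescope, leaving one boundary force and a limit.
-/
theorem IsFlow.sum {W : ℕ → Measure (E4 × Gr 4 2)} {a b : ℕ → ℝ} {F : ℕ → (E4 → E4) → ℝ}
    {m : ℕ → ℝ} (h : ∀ k, IsFlow (W k) (a k) (b k) (F k) (m k)) {A B : ℝ} (hA : ∀ k, A ≤ a k)
    (hB : ∀ k, b k ≤ B)
    (hd : Pairwise fun i j => Disjoint (Set.Ioo (a i) (b i)) (Set.Ioo (a j) (b j)))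
    {G : (E4 → E4) → ℝ} {M : ℝ}
    (hm : Tendsto (fun n => ∑ k ∈ Finset.range n, m k) atTop (𝓝 M))
    (hF : ∀ X : E4 → E4, ContDiff ℝ ∞ X → HasCompactSupport X →
      Tendsto (fun n => ∑ k ∈ Finset.range n, F k X) atTop (𝓝 (G X))) :
    IsFlow (Measure.sum W) A B G M := by
  have hsum : HasSum m M := (hasSum_iff_tendsto_nat_of_nonneg (fun k => (h k).mass_nonneg) M).2 hm
  have hmass : Measure.sum W Set.univ = ENNReal.ofReal M := by
    rw [Measure.sum_apply _ MeasurableSet.univ, ← hsum.tsum_eq,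
      ENNReal.ofReal_tsum_of_nonneg (fun k => (h k).mass_nonneg) hsum.summable]
    simp_rw [(h _).mass]
  refine ⟨IsRectVarifold.sum (fun k => (h k).rect) (fun k => isOpen_shell (a k) (b k))
    (fun i j hij => disjoint_shell (hd hij)) (fun k => (h k).shell_compl), ?_, hmass,
    hsum.nonneg fun k => (h k).mass_nonneg, fun X hX hc => ?_⟩
  · rw [map_fst_sum, Measure.sum_apply _ (isOpen_shell A B).measurableSet.compl,
      ENNReal.tsum_eq_zero]
    intro k
    exact measure_mono_null (Set.compl_subset_compl.2 (shell_mono (hA k) (hB k)))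
      (h k).shell_compl
  · have : IsFiniteMeasure (Measure.sum W) := ⟨by rw [hmass]; exact ENNReal.ofReal_lt_top⟩
    have h1 := (hasSum_integral_measure (integrable_divAlong (W := Measure.sum W) hX hc)).tendsto_sum_nat
    simp_rw [(h _).force X hX hc] at h1
    exact tendsto_nhds_unique h1 (hF X hX hc)

theorem IsRectVarifold.add {W W' : Measure (E4 × Gr 4 2)} (h : IsRectVarifold W)
    (h' : IsRectVarifold W') {U U' : Set E4} (hU : IsOpen U) (hU' : IsOpen U')
    (hd : Disjoint U U') (h0 : W.map Prod.fst Uᶜ = 0) (h0' : W'.map Prod.fst U'ᶜ = 0) :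
    IsRectVarifold (W + W') := by
  rw [show W + W' = Measure.sum (fun i : Bool => if i then W else W') by
    rw [Measure.sum_bool]; simp]
  refine IsRectVarifold.sum (U := fun i => if i then U else U') ?_ ?_ ?_ ?_
  · rintro (_ | _)
    exacts [h', h]
  · rintro (_ | _)
    exacts [hU', hU]
  · rintro (_ | _) (_ | _) hij
    exacts [absurd rfl hij, hd.symm, hd, absurd rfl hij]
  · rintro (_ | _)
    exacts [h0', h0]

theorem IsFlow.add {W W' : Measure (E4 × Gr 4 2)} {a b c : ℝ} {F F' : (E4 → E4) → ℝ}
    {m m' : ℝ} (h : IsFlow W a b F m) (h' : IsFlow W' b c F' m') (hab : a ≤ b) (hbc : b ≤ c) :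
    IsFlow (W + W') a c (fun X => F X + F' X) (m + m') := by
  have hfin := h.isFiniteMeasure
  have hfin' := h'.isFiniteMeasure
  have hd : Disjoint (Set.Ioo a b) (Set.Ioo b c) :=
    Set.disjoint_left.2 fun x hx hx' => (hx.2.trans hx'.1).false
  refine ⟨?_, ?_, ?_, add_nonneg h.mass_nonneg h'.mass_nonneg, fun X hX hc => ?_⟩
  · exact h.rect.add h'.rect (isOpen_shell _ _) (isOpen_shell _ _) (disjoint_shell hd)
      h.shell_compl h'.shell_compl
  · rw [Measure.map_add _ _ measurable_fst, Measure.add_apply,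
      measure_mono_null (Set.compl_subset_compl.2 (shell_mono le_rfl hbc)) h.shell_compl,
      measure_mono_null (Set.compl_subset_compl.2 (shell_mono hab le_rfl)) h'.shell_compl, add_zero]
  · rw [Measure.add_apply, h.mass, h'.mass, ENNReal.ofReal_add h.mass_nonneg h'.mass_nonneg]
  · rw [integral_add_measure (integrable_divAlong hX hc) (integrable_divAlong hX hc),
      h.force X hX hc, h'.force X hX hc]

theorem IsFlow.congr {W : Measure (E4 × Gr 4 2)} {a b : ℝ} {F F' : (E4 → E4) → ℝ} {m m' : ℝ}
    (h : IsFlow W a b F m) (hF : ∀ X, ContDiff ℝ ∞ X → F X = F' X) (hm : m = m') :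
    IsFlow W a b F' m' :=
  ⟨h.rect, h.shell_compl, hm ▸ h.mass, hm ▸ h.mass_nonneg,
    fun X hX hc => (h.force X hX hc).trans (hF X hX)⟩

theorem isFlow_net {ι : Type} [Fintype ι] [Nonempty ι] (Q : E4 ≃ₗᵢ[ℝ] E4) {e : ι → Seg}
    (he : ∀ i, (e i).Valid) {a b : ℝ} (hs : ∀ i, Seg.weight Q (e i) (shell a b)ᶜ = 0) :
    IsFlow (net Q e) a b (fun X => ∑ i, (e i).c * ∫ x, divAlong x.2 X x.1
      ∂edge Q (e i).η (e i).p (e i).q)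
      (∑ i, (e i).c * (Real.pi * ‖(e i).q - (e i).p‖ ^ 2)) := by
  refine ⟨isRectVarifold_net Q he, ?_, net_univ Q e fun i => (he i).weight_pos.le,
    Finset.sum_nonneg fun i _ => ?_, fun X hX hc => ?_⟩
  · rw [map_fst_net, Measure.sum_apply _ (isOpen_shell a b).measurableSet.compl,
      ENNReal.tsum_eq_zero]
    exact hs
  · have := (he i).weight_pos
    have := Real.pi_pos
    positivity
  · obtain ⟨C, hC⟩ := exists_bound_divAlong hX hc
    exact integral_net Q e (fun i => (he i).weight_pos.le) (continuous_divAlong hX).measurable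
      (fun x => hC _ _)

theorem layerSeg_shell (Q : E4 ≃ₗᵢ[ℝ] E4) {N : ℕ} {φ δ a b w : ℝ} (h : Admissible δ a b)
    (i : Fin N × Bool) : Seg.weight Q (layerSeg N φ δ a b w i) (shell a b)ᶜ = 0 := by
  refine Seg.weight_polar_shell Q ?_
  split_ifs
  exacts [h, h.neg]

theorem admissible_zero {a b : ℝ} (ha : 0 < a) (hab : a < b) : Admissible 0 a b :=
  ⟨ha, hab, by simpa using hab, by simpa using Real.pi_pos⟩

/-- The radial force on a ring of `2 ^ m` equidistant circles. -/
noncomputable def ringForce (Q : E4 ≃ₗᵢ[ℝ] E4) (X : E4 → E4) (m : ℕ) (s : ℝ) : ℝ :=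
  ringAvg (radialForce Q X s) (2 ^ m) 0

/-- For δ = 0 the two mirror segments coincide: each ray occurs twice with half the weight, and no
flux is lost. -/
theorem isFlow_radial (Q : E4 ≃ₗᵢ[ℝ] E4) (m : ℕ) {a b w : ℝ} (ha : 0 < a) (hab : a < b)
    (hw : 0 < w) : IsFlow (net Q (layerSeg (2 ^ m) 0 0 a b w)) a b
      (fun X => w * (ringForce Q X m b - ringForce Q X m a)) (Real.pi * w * (b - a)) := by
  have hadm := admissible_zero ha hab
  have hba : b - a ≠ 0 := (sub_pos.2 hab).ne'
  have hN : (2 ^ m : ℕ) ≠ 0 := by positivity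
  have : Nonempty (Fin (2 ^ m) × Bool) := ⟨⟨⟨0, by positivity⟩, true⟩⟩
  refine (isFlow_net Q (layerSeg_valid hadm hw) (layerSeg_shell Q hadm)).congr ?_ ?_
  · intro X hX
    rw [layerSeg_force Q hN hadm (Or.inl rfl) hX, ringForce, ringForce]
    simp only [Real.cos_zero, mul_one, div_self hba, add_zero, one_mul]
  · rw [layerSeg_mass hN hadm]
    simp only [Real.cos_zero, mul_one, div_self hba, one_mul]

/-! ### Branching layers -/

/-- The relative loss of flux in a layer. -/
noncomputable def loss (δ a b : ℝ) : ℝ :=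
  (1 - Real.cos δ) * (a + b) / ((1 + Real.cos δ) * (b - a))

theorem Admissible.cos_pos {δ a b : ℝ} (h : Admissible δ a b) : 0 < Real.cos δ := by
  have h1 : 0 < b * Real.cos δ := h.pos.trans h.le_cos
  exact (pos_iff_pos_of_mul_pos h1).1 (h.pos.trans h.lt)

theorem Admissible.loss_nonneg {δ a b : ℝ} (h : Admissible δ a b) : 0 ≤ loss δ a b := by
  have := h.cos_pos
  have h1 := sub_pos.2 h.lt
  have h2 := sub_nonneg.2 (Real.cos_le_one δ)
  have h3 := h.pos
  have h4 := h.pos.trans h.lt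
  unfold loss
  positivity

theorem Admissible.loss_lt_one {δ a b : ℝ} (h : Admissible δ a b) : loss δ a b < 1 := by
  have := h.cos_pos
  have h1 := sub_pos.2 h.lt
  rw [loss, div_lt_one (by positivity)]
  nlinarith [h.le_cos]

/-- This equation is the origin of `loss`: y solves (1 + y)ρ = 1 - y, where ρ is the ratio of inner
to outer flux of the slanted segments. It allows old and new nodes to carry equal flux. -/
theorem Admissible.ratio_eq {δ a b : ℝ} (h : Admissible δ a b) :
    (1 + loss δ a b) * ((b * Real.cos δ - a) / (b - a * Real.cos δ)) = 1 - loss δ a b := by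
  have h1 := (sub_pos.2 h.lt).ne'
  have h2 := h.lt_sub.ne'
  have h3 : 1 + Real.cos δ ≠ 0 := by have := h.cos_pos; positivity
  rw [loss, mul_div_assoc', div_eq_iff h2]
  field_simp
  ring

/-- The number of nodes doubles inwards. At b slanted and radial segments share the nodes, with
fluxes (1 ± y)/2. At a the slanted ones end at the midpoints of the old nodes with flux (1 + y)ρ/2 =
(1 - y)/2, the same as the radial ones, so the two rings form one uniform ring of twice the size. -/
theorem isFlow_inLayer (Q : E4 ≃ₗᵢ[ℝ] E4) (m : ℕ) {a b w : ℝ}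
    (h : Admissible (Real.pi / 2 ^ m) a b) (hw : 0 < w) :
    let y := loss (Real.pi / 2 ^ m) a b
    IsFlow (net Q (Sum.elim
      (layerSeg (2 ^ m) (-(Real.pi / 2 ^ m)) (Real.pi / 2 ^ m) a b (w * ((1 + y) / 2)))
      (layerSeg (2 ^ m) 0 0 a b (w * ((1 - y) / 2))))) a b
      (fun X => w * (ringForce Q X m b - (1 - y) * ringForce Q X (m + 1) a))
      (Real.pi * w * (b - (1 - y) * a)) := by
  intro y
  have hN : (2 ^ m : ℕ) ≠ 0 := by positivity
  have hcast : ((2 ^ m : ℕ) : ℝ) = 2 ^ m := by push_cast; rfl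
  have : Nonempty (Fin (2 ^ m) × Bool) := ⟨⟨⟨0, by positivity⟩, true⟩⟩
  have h0 := admissible_zero h.pos h.lt
  have hba : b - a ≠ 0 := (sub_pos.2 h.lt).ne'
  have hy0 : 0 ≤ y := h.loss_nonneg
  have hy1 : y < 1 := h.loss_lt_one
  have hρ := h.ratio_eq
  have hw1 : 0 < w * ((1 + y) / 2) := by positivity
  have hw2 : 0 < w * ((1 - y) / 2) := mul_pos hw (by linarith)
  refine (isFlow_net Q (a := a) (b := b) ?_ ?_).congr ?_ ?_
  · rintro (i | i)
    exacts [layerSeg_valid h hw1 i, layerSeg_valid h0 hw2 i]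
  · rintro (i | i)
    exacts [layerSeg_shell Q h i, layerSeg_shell Q h0 i]
  · intro X hX
    rw [Fintype.sum_sum_type]
    simp only [Sum.elim_inl, Sum.elim_inr]
    rw [layerSeg_force Q hN h (Or.inr (by rw [hcast])) hX, layerSeg_force Q hN h0 (Or.inl rfl) hX]
    simp only [Real.cos_zero, mul_one, div_self hba, add_zero, one_mul, neg_add_cancel]
    -- The new nodes have phase -δ, which agrees with phase +δ up to one step of the ring.
    have hd : ringForce Q X (m + 1) a = (ringAvg (radialForce Q X a) (2 ^ m) 0 +
        ringAvg (radialForce Q X a) (2 ^ m) (-(Real.pi / 2 ^ m))) / 2 := by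
      rw [ringForce, pow_succ', ringAvg_double _ hN,
        ← ringAvg_shift (radialForce_periodic Q X a) hN (-(Real.pi / 2 ^ m)), hcast]
      congr 3
      ring
    rw [hd, ringForce]
    linear_combination (-(w / 2) * ringAvg (radialForce Q X a) (2 ^ m) (-(Real.pi / 2 ^ m))) * hρ
  · rw [Fintype.sum_sum_type]
    simp only [Sum.elim_inl, Sum.elim_inr]
    rw [layerSeg_mass hN h, layerSeg_mass hN h0]
    simp only [Real.cos_zero, mul_one, div_self hba, one_mul]
    linear_combination (-(Real.pi * w / 2) * a) * hρ

/-- The number of nodes doubles outwards. Equal outer fluxes (1 + y)/2 make the ring at b uniform,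
and at a they add up to (1 + y)ρ/2 + (1 + y)/2 = 1. -/
theorem isFlow_outLayer (Q : E4 ≃ₗᵢ[ℝ] E4) (m : ℕ) {a b w : ℝ}
    (h : Admissible (Real.pi / 2 ^ m) a b) (hw : 0 < w) :
    let y := loss (Real.pi / 2 ^ m) a b
    IsFlow (net Q (Sum.elim
      (layerSeg (2 ^ m) 0 (Real.pi / 2 ^ m) a b (w * ((1 + y) / 2)))
      (layerSeg (2 ^ m) 0 0 a b (w * ((1 + y) / 2))))) a b
      (fun X => w * ((1 + y) * ringForce Q X (m + 1) b - ringForce Q X m a))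
      (Real.pi * w * ((1 + y) * b - a)) := by
  intro y
  have hN : (2 ^ m : ℕ) ≠ 0 := by positivity
  have hcast : ((2 ^ m : ℕ) : ℝ) = 2 ^ m := by push_cast; rfl
  have : Nonempty (Fin (2 ^ m) × Bool) := ⟨⟨⟨0, by positivity⟩, true⟩⟩
  have h0 := admissible_zero h.pos h.lt
  have hba : b - a ≠ 0 := (sub_pos.2 h.lt).ne'
  have hy0 : 0 ≤ y := h.loss_nonneg
  have hρ := h.ratio_eq
  have hw1 : 0 < w * ((1 + y) / 2) := by positivity
  refine (isFlow_net Q (a := a) (b := b) ?_ ?_).congr ?_ ?_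
  · rintro (i | i)
    exacts [layerSeg_valid h hw1 i, layerSeg_valid h0 hw1 i]
  · rintro (i | i)
    exacts [layerSeg_shell Q h i, layerSeg_shell Q h0 i]
  · intro X hX
    rw [Fintype.sum_sum_type]
    simp only [Sum.elim_inl, Sum.elim_inr]
    rw [layerSeg_force Q hN h (Or.inr (by rw [hcast])) hX, layerSeg_force Q hN h0 (Or.inl rfl) hX]
    simp only [Real.cos_zero, mul_one, div_self hba, add_zero, one_mul, zero_add]
    have hd : ringForce Q X (m + 1) b = (ringAvg (radialForce Q X b) (2 ^ m) 0 +
        ringAvg (radialForce Q X b) (2 ^ m) (Real.pi / 2 ^ m)) / 2 := by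
      rw [ringForce, pow_succ', ringAvg_double _ hN, hcast, zero_add]
    rw [hd, ringForce]
    linear_combination (-(w / 2) * ringAvg (radialForce Q X a) (2 ^ m) 0) * hρ
  · rw [Fintype.sum_sum_type]
    simp only [Sum.elim_inl, Sum.elim_inr]
    rw [layerSeg_mass hN h, layerSeg_mass hN h0]
    simp only [Real.cos_zero, mul_one, div_self hba, one_mul]
    linear_combination (-(Real.pi * w / 2) * a) * hρ

/-! ### Equidistribution of the ring forces on a torus -/

/-- Riemann sums whose radius also varies with n; uniform continuity on a compact neighbourhood of
the limiting circle controls both errors at once. -/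
theorem tendsto_ringAvg {A : ℝ × ℝ → ℝ} (hA : Continuous A) {s : ℕ → ℝ} {s₀ : ℝ}
    (hs : Tendsto s atTop (𝓝 s₀)) {N : ℕ → ℕ} (hN : Tendsto N atTop atTop) :
    Tendsto (fun n => ringAvg (fun θ => A (s n, θ)) (N n) 0) atTop
      (𝓝 ((2 * Real.pi)⁻¹ * ∫ θ in (0 : ℝ)..2 * Real.pi, A (s₀, θ))) := by
  have hpi := Real.two_pi_pos
  rw [Metric.tendsto_atTop]
  intro ε hε
  have hK : IsCompact (Set.Icc (s₀ - 1) (s₀ + 1) ×ˢ Set.Icc 0 (2 * Real.pi)) :=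
    isCompact_Icc.prod isCompact_Icc
  have huc := Metric.uniformContinuousOn_iff.1
    (hK.uniformContinuousOn_of_continuous hA.continuousOn) (ε / 2) (half_pos hε)
  obtain ⟨η, hη, huc⟩ := huc
  have h1 : ∀ᶠ n in atTop, |s n - s₀| < min η 1 :=
    (Metric.tendsto_nhds.1 hs) _ (lt_min hη one_pos)
  have h2 : ∀ᶠ n in atTop, 2 * Real.pi / (N n : ℝ) < η := by
    have : Tendsto (fun n => 2 * Real.pi / (N n : ℝ)) atTop (𝓝 0) :=
      (tendsto_const_nhds (x := 2 * Real.pi)).div_atTop (tendsto_natCast_atTop_atTop.comp hN)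
    exact this.eventually (gt_mem_nhds hη)
  obtain ⟨n₀, hn₀⟩ := eventually_atTop.1 (h1.and (h2.and (hN.eventually_gt_atTop 0)))
  refine ⟨n₀, fun n hn => ?_⟩
  obtain ⟨hs1, hs2, hpos⟩ := hn₀ n hn
  have hM : (0 : ℝ) < N n := Nat.cast_pos.2 hpos
  set M := N n
  have hs1 := lt_min_iff.1 hs1
  have hsmem : s n ∈ Set.Icc (s₀ - 1) (s₀ + 1) := by
    have := abs_lt.1 hs1.2
    constructor <;> linarith
  let t : ℕ → ℝ := fun j => 2 * Real.pi * j / M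
  have ht : ∀ j, t (j + 1) - t j = 2 * Real.pi / M := by
    intro j; simp only [t]; push_cast; ring
  have hle : ∀ j, t j ≤ t (j + 1) := by
    intro j
    have := ht j
    have : 0 < 2 * Real.pi / M := by positivity
    linarith
  have hint : ∀ j, IntervalIntegrable (fun θ => A (s₀, θ)) volume (t j) (t (j + 1)) := fun j =>
    Continuous.intervalIntegrable (by fun_prop) _ _
  have hsplit := intervalIntegral.sum_integral_adjacent_intervals (n := M)
    (f := fun θ => A (s₀, θ)) (a := t) (μ := volume) fun j _ => hint j
  have ht0 : t 0 = 0 := by simp [t]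
  have htM : t M = 2 * Real.pi := by simp only [t]; field_simp
  rw [ht0, htM] at hsplit
  have hterm : ∀ j ∈ Finset.range M, |(M : ℝ)⁻¹ * A (s n, t j) -
      (2 * Real.pi)⁻¹ * ∫ θ in t j..t (j + 1), A (s₀, θ)| ≤ (M : ℝ)⁻¹ * (ε / 2) := by
    intro j hj
    have hjM : (j : ℝ) + 1 ≤ M := by exact_mod_cast Finset.mem_range.1 hj
    have hmem : ∀ θ ∈ Set.Icc (t j) (t (j + 1)), θ ∈ Set.Icc 0 (2 * Real.pi) := by
      intro θ hθ
      constructor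
      · refine le_trans ?_ hθ.1
        simp only [t]; positivity
      · refine hθ.2.trans ?_
        simp only [t]
        rw [div_le_iff₀ hM]
        push_cast
        exact mul_le_mul_of_nonneg_left hjM hpi.le
    have e1 : (M : ℝ)⁻¹ * A (s n, t j) = (2 * Real.pi)⁻¹ * ∫ _ in t j..t (j + 1), A (s n, t j) := by
      rw [intervalIntegral.integral_const, ht, smul_eq_mul]
      field_simp
    rw [e1, ← mul_sub, ← intervalIntegral.integral_sub
      (Continuous.intervalIntegrable (by fun_prop) _ _) (hint j), abs_mul,
      abs_of_pos (by positivity : (0 : ℝ) < (2 * Real.pi)⁻¹)]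
    have hb : |∫ θ in t j..t (j + 1), (A (s n, t j) - A (s₀, θ))| ≤
        ε / 2 * |t (j + 1) - t j| := by
      refine intervalIntegral.norm_integral_le_of_norm_le_const
        (f := fun θ => A (s n, t j) - A (s₀, θ)) fun θ hθ => ?_
      rw [Set.uIoc_of_le (hle j)] at hθ
      have hθ' : θ ∈ Set.Icc (t j) (t (j + 1)) := Set.Ioc_subset_Icc_self hθ
      refine (huc (s n, t j) ⟨hsmem, hmem _ (Set.left_mem_Icc.2 (hle j))⟩ (s₀, θ)
        ⟨⟨by linarith, by linarith⟩, hmem _ hθ'⟩ ?_).le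
      rw [Prod.dist_eq, max_lt_iff]
      refine ⟨hs1.1, ?_⟩
      rw [Real.dist_eq, abs_sub_comm, abs_of_nonneg (sub_nonneg.2 hθ'.1)]
      have := ht j
      linarith [hθ'.2]
    rw [ht, abs_of_pos (by positivity : 0 < 2 * Real.pi / (M : ℝ))] at hb
    calc _ ≤ (2 * Real.pi)⁻¹ * (ε / 2 * (2 * Real.pi / M)) :=
          mul_le_mul_of_nonneg_left hb (by positivity)
      _ = _ := by field_simp
  rw [Real.dist_eq, ringAvg, ← hsplit, Finset.mul_sum, Finset.mul_sum, ← Finset.sum_sub_distrib]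
  simp only [zero_add]
  refine lt_of_le_of_lt (Finset.abs_sum_le_sum_abs _ _) ?_
  refine lt_of_le_of_lt (Finset.sum_le_sum hterm) ?_
  rw [Finset.sum_const, Finset.card_range, nsmul_eq_mul, mul_inv_cancel_left₀ hM.ne']
  exact half_lt_self hε

theorem continuous_radialForce (Q : E4 ≃ₗᵢ[ℝ] E4) {X : E4 → E4} (hX : Continuous X) :
    Continuous fun v : ℝ × ℝ => radialForce Q X v.1 v.2 := by
  have h : Continuous fun u : (ℝ × ℝ) × ℝ =>
      Q (tens u.2 (Complex.exp (u.1.2 / 2 * Complex.I) * Real.sqrt u.1.1)) := by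
    have h1 : Continuous fun u : (ℝ × ℝ) × ℝ =>
      (u.2, Complex.exp (u.1.2 / 2 * Complex.I) * Real.sqrt u.1.1) := by fun_prop
    exact (continuous_isom_tens Q).comp h1
  unfold radialForce
  exact intervalIntegral.continuous_parametric_intervalIntegral_of_continuous' (μ := volume)
    (f := fun v : ℝ × ℝ => fun α => (inner ℝ (X (Q (tens α (Complex.exp (v.2 / 2 * Complex.I) *
      Real.sqrt v.1)))) (Q (tens α (Complex.exp (v.2 / 2 * Complex.I) * Real.sqrt v.1))) : ℝ))
    ((hX.comp h).inner h) 0 (2 * Real.pi)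

/-- The mean radial force on a torus. -/
noncomputable def torusForce (Q : E4 ≃ₗᵢ[ℝ] E4) (X : E4 → E4) (s : ℝ) : ℝ :=
  (2 * Real.pi)⁻¹ * ∫ θ in (0 : ℝ)..2 * Real.pi, radialForce Q X s θ

theorem tendsto_ringForce (Q : E4 ≃ₗᵢ[ℝ] E4) {X : E4 → E4} (hX : Continuous X) {s : ℕ → ℝ}
    {s₀ : ℝ} (hs : Tendsto s atTop (𝓝 s₀)) {m : ℕ → ℕ} (hm : Tendsto m atTop atTop) :
    Tendsto (fun n => ringForce Q X (m n) (s n)) atTop (𝓝 (torusForce Q X s₀)) :=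
  tendsto_ringAvg (continuous_radialForce Q hX) hs
    ((tendsto_pow_atTop_atTop_of_one_lt one_lt_two).comp hm)

/-! ### Fluxes and widths of the trees -/

/-- The infinite product is normalized at infinity: E n is the reciprocal of the tail ∏ (1 + u k)
over k ≥ n. -/
theorem exists_flux {u : ℕ → ℝ} (hu : Summable u) (h1 : ∀ k, 0 < 1 + u k) :
    ∃ E : ℕ → ℝ, (∀ k, 0 < E k) ∧ (∀ k, E (k + 1) = E k * (1 + u k)) ∧ Tendsto E atTop (𝓝 1) := by
  have hl := Real.summable_log_one_add_of_summable hu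
  set S := ∑' k, Real.log (1 + u k)
  have hlim : Tendsto (fun n => ∑ k ∈ Finset.range n, Real.log (1 + u k)) atTop (𝓝 S) :=
    hl.hasSum.tendsto_sum_nat
  refine ⟨fun n => Real.exp (∑ k ∈ Finset.range n, Real.log (1 + u k) - S),
    fun k => Real.exp_pos _, fun k => ?_, ?_⟩
  · simp only []
    rw [Finset.sum_range_succ, add_sub_right_comm, Real.exp_add, Real.exp_log (h1 k)]
  · have := (Real.continuous_exp.tendsto _).comp (hlim.sub_const S)
    rw [sub_self, Real.exp_zero] at this
    exact this

/-- Half of the relative width of the trees. -/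
noncomputable def width (M : ℕ) : ℝ := (2 ^ M)⁻¹

theorem width_pos (M : ℕ) : 0 < width M := by unfold width; positivity

theorem width_succ (M : ℕ) : width (M + 1) = width M / 2 := by
  unfold width; rw [pow_succ, mul_inv]; ring

theorem width_antitone : Antitone width :=
  antitone_nat_of_succ_le fun M => by rw [width_succ]; linarith [width_pos M]

theorem width_le {M : ℕ} (hM : 5 ≤ M) : width M ≤ 1 / 32 := by
  refine (width_antitone hM).trans ?_
  norm_num [width]

theorem tendsto_width : Tendsto width atTop (𝓝 0) := by
  have : width = fun M => ((2 : ℝ)⁻¹) ^ M := by ext M; rw [width, inv_pow]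
  rw [this]
  exact tendsto_pow_atTop_nhds_zero_of_lt_one (by norm_num) (by norm_num)

theorem summable_width : Summable width := by
  have : width = fun M => ((2 : ℝ)⁻¹) ^ M := by ext M; rw [width, inv_pow]
  rw [this]
  exact summable_geometric_of_lt_one (by norm_num) (by norm_num)

theorem one_sub_cos_le (M : ℕ) : 1 - Real.cos (Real.pi / 2 ^ M) ≤ 5 * width M ^ 2 := by
  have h1 := Real.one_sub_sq_div_two_le_cos (x := Real.pi / 2 ^ M)
  have h2 : Real.pi / 2 ^ M = Real.pi * width M := by rw [width, div_eq_mul_inv]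
  rw [h2] at h1 ⊢
  have h3 : Real.pi ^ 2 ≤ 10 := by
    have := Real.pi_lt_d2
    nlinarith [Real.pi_pos]
  nlinarith [sq_nonneg (width M)]

theorem admissible_angle {M : ℕ} (hM : 5 ≤ M) : |Real.pi / 2 ^ M| < Real.pi := by
  have h2 : Real.pi / 2 ^ M = Real.pi * width M := by rw [width, div_eq_mul_inv]
  rw [abs_of_pos (by positivity), h2]
  have := width_le hM
  nlinarith [Real.pi_pos]

/-- The layer has relative thickness 2^(-M)/2, while turning by π/2^M costs at most 5 · 4^(-M) in
the cosine; M ≥ 5 is ample. -/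
theorem admissible_in {M : ℕ} (hM : 5 ≤ M) {σ : ℝ} (hσ : 0 < σ) :
    Admissible (Real.pi / 2 ^ M) (σ * (1 + width (M + 1))) (σ * (1 + width M)) := by
  have h0 := width_pos M
  have h1 := width_le hM
  have h2 := one_sub_cos_le M
  rw [width_succ]
  refine ⟨by positivity, ?_, ?_, admissible_angle hM⟩
  · exact mul_lt_mul_of_pos_left (by linarith) hσ
  · rw [mul_assoc]
    refine mul_lt_mul_of_pos_left ?_ hσ
    nlinarith [mul_nonneg h0.le (sub_nonneg.2 h1)]

theorem admissible_out {M : ℕ} (hM : 5 ≤ M) {σ : ℝ} (hσ : 0 < σ) :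
    Admissible (Real.pi / 2 ^ M) (σ * (1 - width M)) (σ * (1 - width (M + 1))) := by
  have h0 := width_pos M
  have h1 := width_le hM
  have h2 := one_sub_cos_le M
  rw [width_succ]
  refine ⟨mul_pos hσ (by linarith), ?_, ?_, admissible_angle hM⟩
  · exact mul_lt_mul_of_pos_left (by linarith) hσ
  · rw [mul_assoc]
    refine mul_lt_mul_of_pos_left ?_ hσ
    nlinarith [mul_nonneg h0.le (sub_nonneg.2 h1)]

theorem loss_scale (δ : ℝ) {σ : ℝ} (hσ : σ ≠ 0) (a b : ℝ) :
    loss δ (σ * a) (σ * b) = loss δ a b := by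
  rw [loss, loss, ← mul_add, ← mul_sub, mul_left_comm, mul_left_comm _ σ (b - a),
    mul_div_mul_left _ _ hσ]

/-- The quadratic bound on 1 - cos is divided by a thickness of first order, so the loss is of first
order in 2^(-M), hence summable over the layers. -/
theorem loss_le {M : ℕ} {a b : ℝ} (h : Admissible (Real.pi / 2 ^ M) a b)
    (hab : a + b ≤ 3) (hw : b - a = width M / 2) :
    loss (Real.pi / 2 ^ M) a b ≤ 30 * width M := by
  have h0 := width_pos M
  have h1 := h.cos_pos
  have h2 := one_sub_cos_le M
  have h3 := sub_nonneg.2 (Real.cos_le_one (Real.pi / 2 ^ M))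
  rw [loss, hw, div_le_iff₀ (by positivity)]
  have h4 : (1 - Real.cos (Real.pi / 2 ^ M)) * (a + b) ≤ 5 * width M ^ 2 * 3 :=
    mul_le_mul h2 hab (add_pos h.pos (h.pos.trans h.lt)).le (by positivity)
  nlinarith [sq_nonneg (width M), mul_nonneg (sq_nonneg (width M)) h1.le]

/-- The losses in the layers of a tree outside the unit torus. -/
noncomputable def lossIn (j : ℕ) : ℝ :=
  loss (Real.pi / 2 ^ (j + 5)) (1 + width (j + 5 + 1)) (1 + width (j + 5))

/-- The losses in the layers of a tree inside the unit torus. -/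
noncomputable def lossOut (j : ℕ) : ℝ :=
  loss (Real.pi / 2 ^ (j + 5)) (1 - width (j + 5)) (1 - width (j + 5 + 1))

theorem lossIn_spec (j : ℕ) : 0 ≤ lossIn j ∧ lossIn j < 1 ∧ lossIn j ≤ 30 * width (j + 5) := by
  have h : Admissible _ _ _ := admissible_in (M := j + 5) (by omega) one_pos
  rw [one_mul, one_mul] at h
  have hw := width_le (M := j + 5) (by omega)
  have hs := width_succ (j + 5)
  have hp := width_pos (j + 5)
  exact ⟨h.loss_nonneg, h.loss_lt_one, loss_le h (by linarith) (by linarith)⟩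

theorem lossOut_spec (j : ℕ) :
    0 ≤ lossOut j ∧ lossOut j < 1 ∧ lossOut j ≤ 30 * width (j + 5) := by
  have h : Admissible _ _ _ := admissible_out (M := j + 5) (by omega) one_pos
  rw [one_mul, one_mul] at h
  have hw := width_le (M := j + 5) (by omega)
  have hs := width_succ (j + 5)
  have hp := width_pos (j + 5)
  exact ⟨h.loss_nonneg, h.loss_lt_one, loss_le h (by linarith) (by linarith)⟩

theorem summable_lossIn : Summable lossIn :=
  Summable.of_nonneg_of_le (fun j => (lossIn_spec j).1) (fun j => (lossIn_spec j).2.2)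
    (((summable_nat_add_iff 5).2 summable_width).mul_left 30)

theorem summable_lossOut : Summable lossOut :=
  Summable.of_nonneg_of_le (fun j => (lossOut_spec j).1) (fun j => (lossOut_spec j).2.2)
    (((summable_nat_add_iff 5).2 summable_width).mul_left 30)

/-- Fluxes with the given losses converging to one. -/
structure IsFluxPair (EI EO : ℕ → ℝ) : Prop where
  in_pos : ∀ j, 0 < EI j
  in_succ : ∀ j, EI (j + 1) = EI j * (1 - lossIn j)
  in_lim : Tendsto EI atTop (𝓝 1)
  out_pos : ∀ j, 0 < EO j
  out_succ : ∀ j, EO (j + 1) = EO j * (1 + lossOut j)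
  out_lim : Tendsto EO atTop (𝓝 1)

theorem exists_isFluxPair : ∃ EI EO : ℕ → ℝ, IsFluxPair EI EO := by
  obtain ⟨EI, h1, h2, h3⟩ := exists_flux (u := fun j => -lossIn j) summable_lossIn.neg
    fun k => by linarith [(lossIn_spec k).2.1]
  obtain ⟨EO, h4, h5, h6⟩ := exists_flux (u := lossOut) summable_lossOut
    fun k => by linarith [(lossOut_spec k).1]
  exact ⟨EI, EO, h1, fun j => by rw [h2, ← sub_eq_add_neg], h3, h4, h5, h6⟩

/-! ### Infinite trees on both sides of a torus -/

theorem tendsto_width_add (k : ℕ) : Tendsto (fun j => width (j + k)) atTop (𝓝 0) :=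
  tendsto_width.comp (tendsto_add_atTop_nat k)

/-- Layers shrinking to the torus from outside are stacked with matching fluxes, so all intermediate
ring forces cancel. The last one tends to the torus force, because the number of nodes tends to
infinity, the radii to σ and the fluxes to 1. -/
theorem exists_inTree {EI EO : ℕ → ℝ} (hE : IsFluxPair EI EO) (Q : E4 ≃ₗᵢ[ℝ] E4) {σ w : ℝ}
    (hσ : 0 < σ) (hw : 0 < w) (k : ℕ) :
    ∃ W, IsFlow W σ (σ * (1 + width (k + 5)))
      (fun X => w * (EI k * ringForce Q X (k + 5) (σ * (1 + width (k + 5))) - torusForce Q X σ))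
      (Real.pi * w * (EI k * (σ * (1 + width (k + 5))) - σ)) := by
  let s : ℕ → ℝ := fun j => σ * (1 + width (k + j + 5))
  have hanti : Antitone s := antitone_nat_of_succ_le fun j => by
    have := width_antitone (show k + j + 5 ≤ k + (j + 1) + 5 by omega)
    exact mul_le_mul_of_nonneg_left (by linarith) hσ.le
  have hlim : Tendsto s atTop (𝓝 σ) := by
    have h1 : Tendsto (fun j => width (j + (k + 5))) atTop (𝓝 0) := tendsto_width_add _
    have := (h1.const_add 1).const_mul σ
    simp only [add_zero, mul_one] at this
    exact this.congr fun j => by simp only [s]; congr 3; omega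
  have hflow : ∀ j, ∃ W, IsFlow W (s (j + 1)) (s j)
      (fun X => w * (EI (k + j) * ringForce Q X (k + j + 5) (s j) -
        EI (k + (j + 1)) * ringForce Q X (k + (j + 1) + 5) (s (j + 1))))
      (Real.pi * w * (EI (k + j) * s j - EI (k + (j + 1)) * s (j + 1))) := by
    intro j
    have hadm : Admissible (Real.pi / 2 ^ (k + j + 5)) (s (j + 1)) (s j) := by
      have := admissible_in (M := k + j + 5) (by omega) hσ
      simp only [s]
      convert this using 4
      omega
    have hloss : loss (Real.pi / 2 ^ (k + j + 5)) (s (j + 1)) (s j) = lossIn (k + j) := by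
      simp only [s]
      rw [loss_scale _ hσ.ne', lossIn]
      congr 3
    refine ⟨_, (isFlow_inLayer Q (k + j + 5) hadm (mul_pos hw (hE.in_pos (k + j)))).congr
      (fun X _ => ?_) ?_⟩
    · simp only [hloss]
      rw [← add_assoc k j 1, hE.in_succ, show k + j + 1 + 5 = k + j + 5 + 1 by omega]
      ring
    · simp only [hloss]
      rw [← add_assoc k j 1, hE.in_succ]
      ring
  choose W hW using hflow
  have hElim : Tendsto (fun j => EI (k + j)) atTop (𝓝 1) := by
    exact (hE.in_lim.comp (tendsto_add_atTop_nat k)).congr fun j => by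
      rw [Function.comp_apply, add_comm]
  refine ⟨_, IsFlow.sum hW (fun j => hanti.le_of_tendsto hlim (j + 1))
    (fun j => hanti (Nat.zero_le j)) hanti.pairwise_disjoint_on_Ioo_succ ?_ ?_⟩
  · have h1 : Tendsto (fun n => Real.pi * w * (EI k * s 0 - EI (k + n) * s n)) atTop
        (𝓝 (Real.pi * w * (EI k * s 0 - 1 * σ))) :=
      ((hElim.mul hlim).const_sub _).const_mul _
    rw [one_mul] at h1
    refine h1.congr fun n => ?_
    rw [← Finset.mul_sum, Finset.sum_range_sub' (fun j => EI (k + j) * s j) n]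
    rfl
  · intro X hX _
    have hr := tendsto_ringForce Q hX.continuous hlim (m := fun j => k + j + 5)
      (tendsto_atTop_mono (fun j => (by omega : j ≤ k + j + 5)) tendsto_id)
    have h1 := ((hElim.mul hr).const_sub (EI k * ringForce Q X (k + 5) (s 0))).const_mul w
    rw [one_mul] at h1
    refine h1.congr fun n => ?_
    rw [← Finset.mul_sum, Finset.sum_range_sub'
      (fun j => EI (k + j) * ringForce Q X (k + j + 5) (s j)) n]
    rfl

/-- The mirror construction inside the torus, where the flux grows towards σ. -/
theorem exists_outTree {EI EO : ℕ → ℝ} (hE : IsFluxPair EI EO) (Q : E4 ≃ₗᵢ[ℝ] E4) {σ w : ℝ}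
    (hσ : 0 < σ) (hw : 0 < w) (k : ℕ) :
    ∃ W, IsFlow W (σ * (1 - width (k + 5))) σ
      (fun X => w * (torusForce Q X σ - EO k * ringForce Q X (k + 5) (σ * (1 - width (k + 5)))))
      (Real.pi * w * (σ - EO k * (σ * (1 - width (k + 5))))) := by
  let s : ℕ → ℝ := fun j => σ * (1 - width (k + j + 5))
  have hmono : Monotone s := monotone_nat_of_le_succ fun j => by
    have := width_antitone (show k + j + 5 ≤ k + (j + 1) + 5 by omega)
    exact mul_le_mul_of_nonneg_left (by linarith) hσ.le
  have hlim : Tendsto s atTop (𝓝 σ) := by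
    have h1 : Tendsto (fun j => width (j + (k + 5))) atTop (𝓝 0) := tendsto_width_add _
    have := (h1.const_sub 1).const_mul σ
    simp only [sub_zero, mul_one] at this
    exact this.congr fun j => by simp only [s]; congr 3; omega
  have hflow : ∀ j, ∃ W, IsFlow W (s j) (s (j + 1))
      (fun X => w * (EO (k + (j + 1)) * ringForce Q X (k + (j + 1) + 5) (s (j + 1)) -
        EO (k + j) * ringForce Q X (k + j + 5) (s j)))
      (Real.pi * w * (EO (k + (j + 1)) * s (j + 1) - EO (k + j) * s j)) := by
    intro j
    have hadm : Admissible (Real.pi / 2 ^ (k + j + 5)) (s j) (s (j + 1)) := by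
      have := admissible_out (M := k + j + 5) (by omega) hσ
      simp only [s]
      convert this using 4
      omega
    have hloss : loss (Real.pi / 2 ^ (k + j + 5)) (s j) (s (j + 1)) = lossOut (k + j) := by
      simp only [s]
      rw [loss_scale _ hσ.ne', lossOut]
      congr 3
    refine ⟨_, (isFlow_outLayer Q (k + j + 5) hadm (mul_pos hw (hE.out_pos (k + j)))).congr
      (fun X _ => ?_) ?_⟩
    · simp only [hloss]
      rw [← add_assoc k j 1, hE.out_succ, show k + j + 1 + 5 = k + j + 5 + 1 by omega]
      ring
    · simp only [hloss]
      rw [← add_assoc k j 1, hE.out_succ]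
      ring
  choose W hW using hflow
  have hElim : Tendsto (fun j => EO (k + j)) atTop (𝓝 1) := by
    exact (hE.out_lim.comp (tendsto_add_atTop_nat k)).congr fun j => by
      rw [Function.comp_apply, add_comm]
  refine ⟨_, IsFlow.sum hW (fun j => hmono (Nat.zero_le j))
    (fun j => hmono.ge_of_tendsto hlim (j + 1)) hmono.pairwise_disjoint_on_Ioo_succ ?_ ?_⟩
  · have h1 : Tendsto (fun n => Real.pi * w * (EO (k + n) * s n - EO k * s 0)) atTop
        (𝓝 (Real.pi * w * (1 * σ - EO k * s 0))) :=
      ((hElim.mul hlim).sub_const _).const_mul _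
    rw [one_mul] at h1
    refine h1.congr fun n => ?_
    rw [← Finset.mul_sum, Finset.sum_range_sub (fun j => EO (k + j) * s j) n]
    rfl
  · intro X hX _
    have hr := tendsto_ringForce Q hX.continuous hlim (m := fun j => k + j + 5)
      (tendsto_atTop_mono (fun j => (by omega : j ≤ k + j + 5)) tendsto_id)
    have h1 := ((hElim.mul hr).sub_const (EO k * ringForce Q X (k + 5) (s 0))).const_mul w
    rw [one_mul] at h1
    refine h1.congr fun n => ?_
    rw [← Finset.mul_sum, Finset.sum_range_sub
      (fun j => EO (k + j) * ringForce Q X (k + j + 5) (s j)) n]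
    rfl

/-! ### Interchanging the factors on a torus -/

/-- The isometry of `ℝ⁴ = ℝ² ⊗ ℝ²` interchanging the two factors. -/
noncomputable def swapFactors : E4 ≃ₗᵢ[ℝ] E4 :=
  LinearIsometryEquiv.piLpCongrLeft 2 ℝ ℝ (Equiv.swap (1 : Fin 4) 2)

theorem swapFactors_apply (x : E4) : swapFactors x = !₂[x 0, x 2, x 1, x 3] := by
  ext i
  fin_cases i <;> rfl

theorem swapFactors_symm : swapFactors.symm = swapFactors := by
  ext x i
  have : swapFactors (swapFactors x) = x := by
    rw [swapFactors_apply, swapFactors_apply]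
    ext i
    fin_cases i <;> rfl
  rw [swapFactors.symm_apply_eq.2 this.symm]

theorem swapFactors_tens (α β r : ℝ) :
    swapFactors (tens α (Complex.exp (β * Complex.I) * r)) =
      tens β (Complex.exp (α * Complex.I) * r) := by
  rw [swapFactors_apply, tens, tens]
  ext i
  fin_cases i <;> simp [Complex.exp_ofReal_mul_I_re, Complex.exp_ofReal_mul_I_im] <;> ring

/-- Put β = θ/2: as β runs through a full turn, θ runs through two, and the periodic radial force is
averaged twice. -/
theorem torusForce_eq (Q : E4 ≃ₗᵢ[ℝ] E4) {X : E4 → E4} (s : ℝ) :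
    torusForce Q X s = (2 * Real.pi)⁻¹ * ∫ β in (0 : ℝ)..2 * Real.pi, ∫ α in (0 : ℝ)..2 * Real.pi,
      inner ℝ (X (Q (tens α (Complex.exp (β * Complex.I) * Real.sqrt s))))
        (Q (tens α (Complex.exp (β * Complex.I) * Real.sqrt s))) := by
  have hper := radialForce_periodic Q X s
  have h1 : ∀ β : ℝ, (∫ α in (0 : ℝ)..2 * Real.pi,
      inner ℝ (X (Q (tens α (Complex.exp (β * Complex.I) * Real.sqrt s))))
        (Q (tens α (Complex.exp (β * Complex.I) * Real.sqrt s)))) =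
      radialForce Q X s (2 * β) := by
    intro β
    unfold radialForce
    push_cast
    simp only [mul_div_cancel_left₀ (β : ℂ) two_ne_zero]
  simp_rw [h1]
  rw [intervalIntegral.integral_comp_mul_left _ two_ne_zero, mul_zero, smul_eq_mul, torusForce]
  congr 1
  -- Continuity of X is not assumed here; in the non-integrable case both integrals have the default
  -- value 0.
  by_cases hi : IntervalIntegrable (radialForce Q X s) volume 0 (2 * Real.pi)
  · have hi2 : IntervalIntegrable (radialForce Q X s) volume (2 * Real.pi) (2 * (2 * Real.pi)) := by
      have := hi.comp_sub_right (2 * Real.pi)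
      rw [zero_add, ← two_mul] at this
      refine this.congr fun x _ => ?_
      exact hper.sub_eq x
    rw [← intervalIntegral.integral_add_adjacent_intervals hi hi2]
    have h3 := hper.intervalIntegral_add_eq 0 (2 * Real.pi)
    rw [zero_add, ← two_mul (2 * Real.pi)] at h3
    rw [← h3]
    ring
  · rw [intervalIntegral.integral_undef hi, intervalIntegral.integral_undef, mul_zero]
    intro h
    refine hi (h.mono_set ?_)
    rw [Set.uIcc_of_le Real.two_pi_pos.le, Set.uIcc_of_le (by linarith [Real.pi_pos])]
    exact Set.Icc_subset_Icc le_rfl (by linarith [Real.pi_pos])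

theorem intervalIntegral_swap_of_continuous {F : ℝ → ℝ → ℝ} (hF : Continuous (Function.uncurry F))
    {a b c d : ℝ} (hab : a ≤ b) (hcd : c ≤ d) :
    ∫ x in a..b, ∫ y in c..d, F x y = ∫ y in c..d, ∫ x in a..b, F x y := by
  simp only [intervalIntegral.integral_of_le hab, intervalIntegral.integral_of_le hcd]
  refine integral_integral_swap ?_
  rw [Measure.prod_restrict]
  exact (hF.continuousOn.integrableOn_compact (isCompact_Icc.prod isCompact_Icc)).mono_set
    (Set.prod_mono Set.Ioc_subset_Icc_self Set.Ioc_subset_Icc_self)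

/-- The interchange merely exchanges the angles α and β of the torus, so Fubini's theorem gives
equality. This is what lets a tree continue as an interchanged tree. -/
theorem torusForce_swapFactors {X : E4 → E4} (hX : Continuous X) (s : ℝ) :
    torusForce swapFactors X s = torusForce (LinearIsometryEquiv.refl ℝ E4) X s := by
  rw [torusForce_eq, torusForce_eq]
  simp only [swapFactors_tens, LinearIsometryEquiv.coe_refl, id]
  congr 1
  let F : ℝ → ℝ → ℝ := fun β α => inner ℝ (X (tens β (Complex.exp (α * Complex.I) * Real.sqrt s)))
      (tens β (Complex.exp (α * Complex.I) * Real.sqrt s))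
  have hF : Continuous (Function.uncurry F) := by
    have h1 : Continuous fun v : ℝ × ℝ => tens v.1 (Complex.exp (v.2 * Complex.I) * Real.sqrt s) :=
      continuous_tens.comp (f := fun v : ℝ × ℝ => (v.1, Complex.exp (v.2 * Complex.I) * Real.sqrt s))
        (by fun_prop)
    exact (hX.comp h1).inner h1
  exact intervalIntegral_swap_of_continuous hF Real.two_pi_pos.le Real.two_pi_pos.le

/-! ### Vanishing of forces at the origin; balls -/

theorem abs_ringForce_le (Q : E4 ≃ₗᵢ[ℝ] E4) {X : E4 → E4} {m : ℕ} {s B : ℝ} (hs : 0 ≤ s)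
    (hB : ∀ x : E4, ‖x‖ ^ 2 = s → |(inner ℝ (X x) x : ℝ)| ≤ B) :
    |ringForce Q X m s| ≤ 2 * Real.pi * B := by
  have h1 : ∀ θ, |radialForce Q X s θ| ≤ 2 * Real.pi * B := by
    intro θ
    have : ‖radialForce Q X s θ‖ ≤ B * |2 * Real.pi - 0| := by
      refine intervalIntegral.norm_integral_le_of_norm_le_const
        (f := fun α => (inner ℝ (X (Q (tens α (Complex.exp (θ / 2 * Complex.I) * Real.sqrt s))))
          (Q (tens α (Complex.exp (θ / 2 * Complex.I) * Real.sqrt s))) : ℝ)) fun α _ => hB _ ?_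
      rw [Q.norm_map, norm_tens, norm_mul, Complex.norm_real, mul_pow, Real.norm_eq_abs, sq_abs,
        Real.sq_sqrt hs]
      have : ((θ : ℂ) / 2) = ((θ / 2 : ℝ) : ℂ) := by push_cast; rfl
      rw [this, Complex.norm_exp_ofReal_mul_I, one_pow, one_mul]
    rwa [sub_zero, abs_of_pos Real.two_pi_pos, mul_comm] at this
  have hN : (0 : ℝ) < ((2 ^ m : ℕ) : ℝ) := by positivity
  rw [ringForce, ringAvg, abs_mul, abs_of_pos (inv_pos.2 hN)]
  calc _ ≤ (((2 ^ m : ℕ) : ℝ))⁻¹ * ∑ j ∈ Finset.range (2 ^ m), 2 * Real.pi * B :=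
        mul_le_mul_of_nonneg_left ((Finset.abs_sum_le_sum_abs _ _).trans
          (Finset.sum_le_sum fun j _ => h1 _)) (inv_pos.2 hN).le
    _ = _ := by rw [Finset.sum_const, Finset.card_range, nsmul_eq_mul, inv_mul_cancel_left₀ hN.ne']

/-- The circles over radius s have |x| = √s, so the bounded field gives force O(√s) whatever the
number of nodes: the origin carries no first variation. -/
theorem tendsto_ringForce_zero (Q : ℕ → E4 ≃ₗᵢ[ℝ] E4) {X : E4 → E4} (hX : Continuous X)
    (hc : HasCompactSupport X) {s : ℕ → ℝ} (hs0 : ∀ n, 0 ≤ s n) (hs : Tendsto s atTop (𝓝 0))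
    (m : ℕ → ℕ) : Tendsto (fun n => ringForce (Q n) X (m n) (s n)) atTop (𝓝 0) := by
  obtain ⟨C, hC⟩ := hX.bounded_above_of_compact_support hc
  have h2 : Tendsto (fun n => 2 * Real.pi * (C * Real.sqrt (s n))) atTop (𝓝 0) := by
    have := (((Real.continuous_sqrt.tendsto 0).comp hs).const_mul C).const_mul (2 * Real.pi)
    simpa using this
  refine squeeze_zero_norm (fun n => ?_) h2
  refine abs_ringForce_le (Q n) (hs0 n) fun x hx => ?_
  rw [← hx, Real.sqrt_sq (norm_nonneg x)]
  exact (abs_real_inner_le_norm _ _).trans (mul_le_mul_of_nonneg_right (hC x) (norm_nonneg x))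

theorem ringForce_eq_zero (Q : E4 ≃ₗᵢ[ℝ] E4) {X : E4 → E4} {m : ℕ} {s : ℝ} (hs : 0 ≤ s)
    (hX : ∀ x : E4, ‖x‖ ^ 2 = s → X x = 0) : ringForce Q X m s = 0 := by
  have := abs_ringForce_le Q (X := X) (m := m) hs (B := 0) fun x hx => by simp [hX x hx]
  rwa [mul_zero, abs_nonpos_iff] at this

/-- The part over the closed ball of radius `√s`. -/
def overBall (s : ℝ) : Set (E4 × Gr 4 2) := {p | ‖p.1‖ ^ 2 ≤ s}

theorem measurableSet_overBall (s : ℝ) : MeasurableSet (overBall s) :=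
  (isClosed_le (by fun_prop) continuous_const).measurableSet

theorem IsFlow.compl_eq_zero {W : Measure (E4 × Gr 4 2)} {a b : ℝ} {F : (E4 → E4) → ℝ} {m : ℝ}
    (h : IsFlow W a b F m) : W (Prod.fst ⁻¹' shell a b)ᶜ = 0 := by
  have := h.shell_compl
  rwa [Measure.map_apply measurable_fst (isOpen_shell a b).measurableSet.compl] at this

theorem IsFlow.overBall_eq_zero {W : Measure (E4 × Gr 4 2)} {a b s : ℝ} {F : (E4 → E4) → ℝ}
    {m : ℝ} (h : IsFlow W a b F m) (hs : s ≤ a) : W (overBall s) = 0 :=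
  measure_mono_null (fun p (hp : ‖p.1‖ ^ 2 ≤ s) (hp' : ‖p.1‖ ^ 2 ∈ Set.Ioo a b) =>
    (hp'.1.trans_le (hp.trans hs)).false) h.compl_eq_zero

theorem IsFlow.overBall_eq {W : Measure (E4 × Gr 4 2)} {a b s : ℝ} {F : (E4 → E4) → ℝ}
    {m : ℝ} (h : IsFlow W a b F m) (hs : b ≤ s) : W (overBall s) = ENNReal.ofReal m := by
  rw [← h.mass]
  refine measure_congr (eventuallyEq_univ.2 ?_)
  refine measure_mono_null (t := (Prod.fst ⁻¹' shell a b)ᶜ) ?_ h.compl_eq_zero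
  exact fun p hp (hp' : ‖p.1‖ ^ 2 ∈ Set.Ioo a b) => hp (hp'.2.le.trans hs)

theorem IsFlow.restrict_eq_zero {W : Measure (E4 × Gr 4 2)} {a b a' b' : ℝ} {F : (E4 → E4) → ℝ}
    {m : ℝ} (h : IsFlow W a b F m) (hd : Disjoint (Set.Ioo a' b') (Set.Ioo a b)) :
    W.restrict (Prod.fst ⁻¹' shell a' b') = 0 := by
  rw [Measure.restrict_eq_zero]
  exact measure_mono_null (fun p hp hp' => Set.disjoint_left.1 (disjoint_shell hd) hp hp')
    h.compl_eq_zero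

theorem IsFlow.restrict_eq {W : Measure (E4 × Gr 4 2)} {a b : ℝ} {F : (E4 → E4) → ℝ}
    {m : ℝ} (h : IsFlow W a b F m) : W.restrict (Prod.fst ⁻¹' shell a b) = W :=
  Measure.restrict_eq_self_of_ae_mem (by
    rw [ae_iff]
    exact measure_mono_null (fun p hp => hp) h.compl_eq_zero)

/-! ### Assembling the varifold -/

/-- Here `g n` is the flux at the n-th torus. The equation says that the rays leaving the inner tree
of torus n carry the flux required by the outer tree of torus n + 1. The levels `k n` are taken so
deep that the quotients differ from 1 by at most 2^(-n), so g converges. -/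
theorem exists_fluxes {EI EO : ℕ → ℝ} (hE : IsFluxPair EI EO) :
    ∃ (k : ℕ → ℕ) (g : ℕ → ℝ), (∀ n, n ≤ k n) ∧ (∀ n, 0 < g n) ∧
      (∀ n, g n * EO (k (n + 1)) = g (n + 1) * EI (k (n + 1))) ∧ Tendsto g atTop (𝓝 1) := by
  have hlim : Tendsto (fun j => EO j / EI j - 1) atTop (𝓝 0) := by
    have := (hE.out_lim.div hE.in_lim one_ne_zero).sub_const 1
    simpa using this
  have hex : ∀ n : ℕ, ∃ k, n ≤ k ∧ |EO k / EI k - 1| ≤ (1 / 2) ^ n := by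
    intro n
    have h1 : ∀ᶠ j in atTop, |EO j / EI j - 1| < (1 / 2) ^ n := by
      have := (Metric.tendsto_nhds.1 hlim) ((1 / 2) ^ n) (by positivity)
      simpa [Real.dist_eq] using this
    obtain ⟨k, hk1, hk2⟩ := (h1.and (eventually_ge_atTop n)).exists
    exact ⟨k, hk2, hk1.le⟩
  choose k hk1 hk2 using hex
  have hsum : Summable fun n => EO (k (n + 1)) / EI (k (n + 1)) - 1 := by
    have h2 : Summable fun n => EO (k n) / EI (k n) - 1 :=
      Summable.of_norm_bounded (summable_geometric_of_lt_one (by norm_num) (by norm_num))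
        (fun n => hk2 n)
    exact (summable_nat_add_iff 1).2 h2
  obtain ⟨g, hg1, hg2, hg3⟩ := exists_flux hsum fun n => by
    have := hE.in_pos (k (n + 1))
    have := hE.out_pos (k (n + 1))
    rw [add_sub_cancel]
    positivity
  refine ⟨k, g, hk1, hg1, fun n => ?_, hg3⟩
  have := (hE.in_pos (k (n + 1))).ne'
  rw [hg2 n, add_sub_cancel]
  field_simp

/-- From inside outwards: rays for Q', a tree for Q' ending on the torus, a tree for Q starting from
it. The two torus forces cancel by `hQ`. -/
theorem exists_block {EI EO : ℕ → ℝ} (hE : IsFluxPair EI EO) {Q Q' : E4 ≃ₗᵢ[ℝ] E4}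
    (hQ : ∀ X : E4 → E4, Continuous X → ∀ s, torusForce Q X s = torusForce Q' X s)
    {σ c w w' : ℝ} {k k' : ℕ} (hσ : 0 < σ) (hc : 0 < c) (hcd : c < σ * (1 - width (k' + 5)))
    (hw : 0 < w) (hw' : w * EO k' = w') :
    ∃ W, IsFlow W c (σ * (1 + width (k + 5)))
      (fun X => w * EI k * ringForce Q X (k + 5) (σ * (1 + width (k + 5))) -
        w' * ringForce Q' X (k' + 5) c)
      (Real.pi * (w * EI k * (σ * (1 + width (k + 5))) - w' * c)) ∧
      W.restrict (Prod.fst ⁻¹' shell c (σ * (1 - width (k' + 5)))) =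
        net Q' (layerSeg (2 ^ (k' + 5)) 0 0 c (σ * (1 - width (k' + 5))) w') := by
  obtain ⟨W1, h1⟩ := exists_inTree hE Q hσ hw k
  obtain ⟨W2, h2⟩ := exists_outTree hE Q' hσ hw k'
  have hw0 : 0 < w' := hw' ▸ mul_pos hw (hE.out_pos k')
  have h3 := isFlow_radial Q' (k' + 5) hc hcd hw0
  have hd : σ * (1 - width (k' + 5)) ≤ σ := by nlinarith [width_pos (k' + 5)]
  have hs : σ ≤ σ * (1 + width (k + 5)) := by nlinarith [width_pos (k + 5)]
  refine ⟨_, ((h3.add h2 hcd.le hd).add h1 (hcd.le.trans hd) hs).congr (fun X hX => ?_) ?_, ?_⟩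
  · rw [hQ X hX.continuous, ← hw']
    ring
  · rw [← hw']
    ring
  · rw [Measure.restrict_add, Measure.restrict_add, h3.restrict_eq, h2.restrict_eq_zero,
      h1.restrict_eq_zero, add_zero, add_zero]
    · exact Set.disjoint_left.2 fun x hx hx' => (hx'.1.trans (hx.2.trans_le hd)).false
    · exact Set.disjoint_left.2 fun x hx hx' => (hx'.1.trans hx.2).false

theorem divAlong_eq_zero_of_lt {X : E4 → E4} {R : ℝ} (hR : tsupport X ⊆ {x | ‖x‖ ^ 2 ≤ R})
    {p : E4 × Gr 4 2} (hp : p ∉ overBall R) : divAlong p.2 X p.1 = 0 :=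
  divAlong_eq_zero (fun h => hp (hR h)) _

theorem exists_tsupport_subset {X : E4 → E4} (hc : HasCompactSupport X) :
    ∃ R : ℝ, tsupport X ⊆ {x | ‖x‖ ^ 2 ≤ R} := by
  obtain ⟨r, hr⟩ := hc.isBounded.subset_closedBall (0 : E4)
  exact ⟨r ^ 2, fun x hx => pow_le_pow_left₀ (norm_nonneg x) (by simpa using hr hx) 2⟩

theorem integrable_divAlong_of_overBall {V : Measure (E4 × Gr 4 2)}
    (hV : ∀ R, V (overBall R) < ⊤) {X : E4 → E4} (hX : ContDiff ℝ ∞ X)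
    (hc : HasCompactSupport X) :
    Integrable (fun x : E4 × Gr 4 2 => divAlong x.2 X x.1) V := by
  obtain ⟨R, hR⟩ := exists_tsupport_subset hc
  have : IsFiniteMeasure (V.restrict (overBall R)) := ⟨by simpa using hV R⟩
  have h1 : IntegrableOn (fun x : E4 × Gr 4 2 => divAlong x.2 X x.1) (overBall R) V :=
    integrable_divAlong hX hc
  refine (integrableOn_iff_integrable_of_support_subset ?_).1 h1
  intro p hp
  by_contra h
  exact hp (divAlong_eq_zero_of_lt hR h)

/-- The rays are continued to infinity in unit pieces. The forces telescope, and the outer one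
vanishes beyond the support of X. -/
theorem exists_exterior (Q : E4 ≃ₗᵢ[ℝ] E4) (m : ℕ) {a w : ℝ} (ha : 0 < a) (hw : 0 < w) :
    ∃ V : Measure (E4 × Gr 4 2), IsRectVarifold V ∧ V (overBall a) = 0 ∧
      (∀ R, V (overBall R) < ⊤) ∧
      ∀ X : E4 → E4, ContDiff ℝ ∞ X → HasCompactSupport X →
        ∫ x, divAlong x.2 X x.1 ∂V = -(w * ringForce Q X m a) := by
  have hflow : ∀ j : ℕ, IsFlow (net Q (layerSeg (2 ^ m) 0 0 (a + j) (a + (j + 1 : ℕ)) w)) (a + j)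
      (a + (j + 1 : ℕ)) _ _ := fun j =>
    isFlow_radial Q m (by positivity) (by push_cast; linarith) hw
  have hmono : Monotone fun j : ℕ => a + (j : ℝ) := fun i j hij => by
    have : (i : ℝ) ≤ j := by exact_mod_cast hij
    simpa using this
  have hd := hmono.pairwise_disjoint_on_Ioo_succ
  have hzero : ∀ (R : ℝ) (j : ℕ), R ≤ a + j →
      net Q (layerSeg (2 ^ m) 0 0 (a + j) (a + (j + 1 : ℕ)) w) (overBall R) = 0 :=
    fun R j h => (hflow j).overBall_eq_zero h
  have hfin : ∀ R, Measure.sum (fun j : ℕ =>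
      net Q (layerSeg (2 ^ m) 0 0 (a + j) (a + (j + 1 : ℕ)) w)) (overBall R) < ⊤ := by
    intro R
    rw [Measure.sum_apply _ (measurableSet_overBall R)]
    obtain ⟨J, hJ⟩ := exists_nat_ge (R - a)
    rw [tsum_eq_sum (s := Finset.range J) fun j hj => hzero R j ?_]
    · refine ENNReal.sum_lt_top.2 fun j _ => ?_
      have := (hflow j).isFiniteMeasure
      exact measure_lt_top _ _
    · have : (J : ℝ) ≤ j := by exact_mod_cast not_lt.1 (fun h => hj (Finset.mem_range.2 h))
      linarith
  refine ⟨_, IsRectVarifold.sum (fun j => (hflow j).rect) (fun j => isOpen_shell _ _)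
    (fun i j hij => disjoint_shell (hd hij)) (fun j => (hflow j).shell_compl), ?_, hfin,
    fun X hX hc => ?_⟩
  · rw [Measure.sum_apply _ (measurableSet_overBall a), ENNReal.tsum_eq_zero]
    exact fun j => hzero a j (by simp)
  · have h1 := (hasSum_integral_measure
      (integrable_divAlong_of_overBall hfin hX hc)).tendsto_sum_nat
    simp_rw [(hflow _).force X hX hc] at h1
    refine tendsto_nhds_unique h1 ?_
    obtain ⟨R, hR⟩ := exists_tsupport_subset hc
    obtain ⟨J, hJ⟩ := exists_nat_gt (R - a)
    refine tendsto_const_nhds.congr' ?_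
    filter_upwards [eventually_ge_atTop J] with n hn
    rw [← Finset.mul_sum, Finset.sum_range_sub (fun j : ℕ => ringForce Q X m (a + j)) n,
      ringForce_eq_zero Q (X := X) (m := m) (s := a + n) (by positivity)]
    · simp
    · intro x hx
      refine image_eq_zero_of_notMem_tsupport fun h => ?_
      have h2 : ‖x‖ ^ 2 ≤ R := hR h
      have : (J : ℝ) ≤ n := by exact_mod_cast hn
      linarith

/-- A stationary rectifiable varifold which in the shells `a n < ‖x‖² < b n` consists of
equidistant half lines of surfaces, with the two factors interchanged from shell to shell. -/
structure IsTwisted (V : Measure (E4 × Gr 4 2)) (a b w : ℕ → ℝ) (m : ℕ → ℕ)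
    (Q : ℕ → E4 ≃ₗᵢ[ℝ] E4) : Prop where
  rect : IsRectVarifold V
  finite : ∀ R, V (overBall R) < ⊤
  stationary : ∀ X : E4 → E4, ContDiff ℝ ∞ X → HasCompactSupport X →
    ∫ x, divAlong x.2 X x.1 ∂V = 0
  pos : ∀ n, 0 < a n
  lt : ∀ n, a n < b n
  lt' : ∀ n, b (n + 1) < a n
  weight_pos : ∀ n, 0 < w n
  restrict : ∀ n, V.restrict (Prod.fst ⁻¹' shell (a n) (b n)) =
    net (Q n) (layerSeg (2 ^ m n) 0 0 (a n) (b n) (w n))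
  ball : ∀ n, V (overBall (a n)) = ENNReal.ofReal (Real.pi * (w n * a n))
  lim_zero : Tendsto a atTop (𝓝 0)
  lim_ratio : Tendsto (fun n => a n / b n) atTop (𝓝 0)
  lim_gap : Tendsto (fun n => b (n + 1) / a n) atTop (𝓝 1)
  lim_weight : Tendsto w atTop (𝓝 1)
  lim_rings : Tendsto m atTop atTop

/-- The blocks inside radius S n form one flow down to 0, since both force and mass of the innermost
boundary tend to 0. This yields the exact mass π w S of the balls, and the exterior rays balance the
outermost force. -/
theorem exists_isTwisted_of_blocks {Q : ℕ → E4 ≃ₗᵢ[ℝ] E4} {S D w : ℕ → ℝ} {m : ℕ → ℕ}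
    {W : ℕ → Measure (E4 × Gr 4 2)} (hS0 : ∀ n, 0 < S n)
    (hSD : ∀ n, S (n + 1) < D n) (hDS : ∀ n, D n < S n) (hw0 : ∀ n, 0 < w n)
    (hSlim : Tendsto S atTop (𝓝 0)) (hw1 : Tendsto w atTop (𝓝 1)) (hm : Tendsto m atTop atTop)
    (hratio : Tendsto (fun n => S (n + 1) / D n) atTop (𝓝 0))
    (hgap : Tendsto (fun n => D n / S n) atTop (𝓝 1))
    (hW : ∀ n, IsFlow (W n) (S (n + 1)) (S n) (fun X => w n * ringForce (Q n) X (m n) (S n) -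
      w (n + 1) * ringForce (Q (n + 1)) X (m (n + 1)) (S (n + 1)))
      (Real.pi * (w n * S n - w (n + 1) * S (n + 1))))
    (hWr : ∀ n, (W n).restrict (Prod.fst ⁻¹' shell (S (n + 1)) (D n)) =
      net (Q (n + 1)) (layerSeg (2 ^ m (n + 1)) 0 0 (S (n + 1)) (D n) (w (n + 1)))) :
    ∃ V a b w m, IsTwisted V a b w m fun n => Q (n + 1) := by
  have hanti : Antitone S := antitone_nat_of_succ_le fun n => ((hSD n).trans (hDS n)).le
  have htail : ∀ n, IsFlow (Measure.sum fun j => W (n + j)) 0 (S n)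
      (fun X => w n * ringForce (Q n) X (m n) (S n)) (Real.pi * (w n * S n)) := by
    intro n
    have hS' : Antitone fun j => S (n + j) := fun i j h => hanti (by omega)
    have hsh : ∀ {u : ℕ → ℝ} {l : ℝ}, Tendsto u atTop (𝓝 l) →
        Tendsto (fun j => u (n + j)) atTop (𝓝 l) := fun {u l} hu => by
      refine (hu.comp (tendsto_add_atTop_nat n)).congr fun j => ?_
      rw [Function.comp_apply, add_comm]
    refine IsFlow.sum (fun j => hW (n + j)) (fun j => (hS0 _).le)
      (fun j => hanti (Nat.le_add_right n j)) hS'.pairwise_disjoint_on_Ioo_succ ?_ ?_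
    · have h1 := ((hsh (hw1.mul hSlim)).const_sub (w n * S n)).const_mul Real.pi
      rw [mul_zero, sub_zero] at h1
      refine h1.congr fun J => ?_
      rw [← Finset.mul_sum]
      exact congrArg _ (Finset.sum_range_sub' (fun j => w (n + j) * S (n + j)) J).symm
    · intro X hX hc
      have h2 := tendsto_ringForce_zero Q hX.continuous hc (fun n => (hS0 n).le) hSlim
        (fun n => m n)
      have h1 := (hsh (hw1.mul h2)).const_sub (w n * ringForce (Q n) X (m n) (S n))
      rw [mul_zero, sub_zero] at h1
      refine h1.congr fun J => ?_
      exact (Finset.sum_range_sub'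
        (fun j => w (n + j) * ringForce (Q (n + j)) X (m (n + j)) (S (n + j))) J).symm
  obtain ⟨V₀, hV₀, hV₀a, hV₀f, hV₀X⟩ := exists_exterior (Q 0) (m 0) (hS0 0) (hw0 0)
  have hin := htail 0
  simp only [zero_add] at hin
  have hfin : ∀ R, (V₀ + Measure.sum W) (overBall R) < ⊤ := fun R => by
    have := hin.isFiniteMeasure
    rw [Measure.add_apply]
    exact ENNReal.add_lt_top.2 ⟨hV₀f R, measure_lt_top _ _⟩
  have hball : ∀ n, (V₀ + Measure.sum W) (overBall (S n)) =
      ENNReal.ofReal (Real.pi * (w n * S n)) := by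
    intro n
    have h1 : V₀ (overBall (S n)) = 0 :=
      measure_mono_null (fun p hp => le_trans hp (hanti (Nat.zero_le n))) hV₀a
    have h2 := (htail n).overBall_eq le_rfl
    rw [Measure.sum_apply _ (measurableSet_overBall _)] at h2
    have h3 : ∑ j ∈ Finset.range n, W j (overBall (S n)) = 0 := Finset.sum_eq_zero fun j hj =>
      (hW j).overBall_eq_zero (hanti (Finset.mem_range.1 hj))
    have h4 := Summable.sum_add_tsum_nat_add' (f := fun j => W j (overBall (S n))) (k := n)
      ENNReal.summable
    rw [h3, zero_add] at h4
    rw [Measure.add_apply, h1, zero_add, Measure.sum_apply _ (measurableSet_overBall _), ← h2, ← h4]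
    exact tsum_congr fun j => by rw [add_comm]
  have hrestr : ∀ n, (V₀ + Measure.sum W).restrict (Prod.fst ⁻¹' shell (S (n + 1)) (D n)) =
      net (Q (n + 1)) (layerSeg (2 ^ (m (n + 1))) 0 0 (S (n + 1)) (D n) (w (n + 1))) := by
    intro n
    have h0 : V₀.restrict (Prod.fst ⁻¹' shell (S (n + 1)) (D n)) = 0 := by
      rw [Measure.restrict_eq_zero]
      refine measure_mono_null (fun p (hp : ‖p.1‖ ^ 2 ∈ Set.Ioo _ _) => ?_) hV₀a
      exact hp.2.le.trans ((hDS n).le.trans (hanti (Nat.zero_le n)))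
    have h1 := restrict_sum_eq_of_disjoint (μ := W)
      (U := fun n => Prod.fst ⁻¹' shell (S (n + 1)) (S n))
      (fun n => measurable_fst (isOpen_shell _ _).measurableSet)
      (fun i j hij => (disjoint_shell (hanti.pairwise_disjoint_on_Ioo_succ hij)).preimage _)
      (fun i => (hW i).compl_eq_zero) n
    have h2 : (Prod.fst ⁻¹' shell (S (n + 1)) (D n) : Set (E4 × Gr 4 2)) ⊆
      Prod.fst ⁻¹' shell (S (n + 1)) (S n) := Set.preimage_mono (shell_mono le_rfl (hDS n).le)
    rw [Measure.restrict_add, h0, zero_add, ← Measure.restrict_restrict_of_subset h2, h1, hWr]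
  have hout : V₀.map Prod.fst {x : E4 | S 0 < ‖x‖ ^ 2}ᶜ = 0 := by
    rw [Measure.map_apply measurable_fst
      (isOpen_lt continuous_const (by fun_prop)).measurableSet.compl]
    exact measure_mono_null (fun p hp => not_lt.1 (show ¬S 0 < ‖p.1‖ ^ 2 from hp)) hV₀a
  refine ⟨V₀ + Measure.sum W, fun n => S (n + 1), D, fun n => w (n + 1), fun n => m (n + 1),
    ?_, hfin, fun X hX hc => ?_, fun n => hS0 _, hSD, fun n => hDS _, fun n => hw0 _, hrestr,
    fun n => hball _, hSlim.comp (tendsto_add_atTop_nat 1), hratio,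
    hgap.comp (tendsto_add_atTop_nat 1), hw1.comp (tendsto_add_atTop_nat 1),
    hm.comp (tendsto_add_atTop_nat 1)⟩
  · refine hV₀.add hin.rect (isOpen_lt continuous_const (by fun_prop)) (isOpen_shell 0 (S 0)) ?_
      hout hin.shell_compl
    exact Set.disjoint_left.2 fun x (hx : S 0 < ‖x‖ ^ 2) hx' => (hx.trans hx'.2).false
  · have := hin.isFiniteMeasure
    rw [integral_add_measure (integrable_divAlong_of_overBall hV₀f hX hc)
      (integrable_divAlong hX hc), hV₀X X hX hc, hin.force X hX hc]
    ring

/-- Block n turns `Q n` outside the torus σ n into `Q (n + 1)` inside it, so the n-th radial shell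
uses `Q (n + 1)`. -/
theorem exists_isTwisted {Q : ℕ → E4 ≃ₗᵢ[ℝ] E4}
    (hQ : ∀ n, ∀ X : E4 → E4, Continuous X → ∀ s,
      torusForce (Q n) X s = torusForce (Q (n + 1)) X s) :
    ∃ V a b w m, IsTwisted V a b w m fun n => Q (n + 1) := by
  obtain ⟨EI, EO, hE⟩ := exists_isFluxPair
  obtain ⟨k, g, hk, hg, hgk, hg1⟩ := exists_fluxes hE
  -- Factorials make σ (n + 1)/σ n tend to 0, so the radial shells become arbitrarily long in
  -- logarithmic scale.
  let σ : ℕ → ℝ := fun n => ((n + 1).factorial : ℝ)⁻¹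
  have hσ : ∀ n, 0 < σ n := fun n => inv_pos.2 (by exact_mod_cast Nat.factorial_pos _)
  have hσs : ∀ n, σ (n + 1) = σ n / (n + 2) := fun n => by
    simp only [σ]
    rw [Nat.factorial_succ (n + 1)]
    push_cast
    rw [mul_inv, div_eq_inv_mul]
    ring
  have hσ0 : Tendsto σ atTop (𝓝 0) := by
    refine squeeze_zero (fun n => (hσ n).le) (fun n => ?_) tendsto_one_div_add_atTop_nhds_zero_nat
    simp only [σ]
    rw [one_div]
    refine inv_anti₀ (by positivity) ?_
    exact_mod_cast Nat.self_le_factorial (n + 1)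
  let S : ℕ → ℝ := fun n => σ n * (1 + width (k n + 5))
  let D : ℕ → ℝ := fun n => σ n * (1 - width (k (n + 1) + 5))
  have hwd : ∀ n, width (k n + 5) ≤ 1 / 32 := fun n => width_le (by omega)
  have hwp : ∀ n, 0 < width (k n + 5) := fun n => width_pos _
  have hS0 : ∀ n, 0 < S n := fun n => mul_pos (hσ n) (by linarith [hwp n])
  have hSσ : ∀ n, S n ≤ σ n * 2 := fun n =>
    mul_le_mul_of_nonneg_left (by linarith [hwd n]) (hσ n).le
  have hDσ : ∀ n, σ n / 2 ≤ D n := fun n => by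
    simp only [D]; nlinarith [hσ n, hwd (n + 1)]
  have hD0 : ∀ n, 0 < D n := fun n => (half_pos (hσ n)).trans_le (hDσ n)
  have hSD : ∀ n, S (n + 1) < D n := fun n => by
    have h1 : σ (n + 1) ≤ σ n / 2 := by
      rw [hσs]
      exact div_le_div_of_nonneg_left (hσ n).le two_pos (by linarith [n.cast_nonneg (α := ℝ)])
    have h2 : S (n + 1) ≤ σ (n + 1) * (1 + 1 / 32) :=
      mul_le_mul_of_nonneg_left (by linarith [hwd (n + 1)]) (hσ _).le
    have h3 : σ n * (1 - 1 / 32) ≤ D n :=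
      mul_le_mul_of_nonneg_left (by linarith [hwd (n + 1)]) (hσ n).le
    linarith [hσ n]
  have hDS : ∀ n, D n < S n := fun n =>
    mul_lt_mul_of_pos_left (by linarith [hwp n, hwp (n + 1)]) (hσ n)
  let w : ℕ → ℝ := fun n => g n * EI (k n)
  have hw0 : ∀ n, 0 < w n := fun n => mul_pos (hg n) (hE.in_pos _)
  have hkt : Tendsto k atTop atTop := tendsto_atTop_mono hk tendsto_id
  have hkt5 : Tendsto (fun n => k n + 5) atTop atTop :=
    tendsto_atTop_mono (fun n => (hk n).trans (Nat.le_add_right _ 5)) tendsto_id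
  have hw1 : Tendsto w atTop (𝓝 1) := by
    have := hg1.mul (hE.in_lim.comp hkt)
    rwa [mul_one] at this
  have hSlim : Tendsto S atTop (𝓝 0) :=
    squeeze_zero (fun n => (hS0 n).le) hSσ (by simpa using hσ0.mul_const 2)
  have hblock := fun n => exists_block hE (k := k n) (hQ n) (hσ n) (hS0 (n + 1)) (hSD n) (hg n)
    (hgk n)
  choose W hW hWr using hblock
  refine exists_isTwisted_of_blocks hS0 hSD hDS hw0 hSlim hw1 hkt5 ?_ ?_ hW hWr
  · have hl : Tendsto (fun n : ℕ => 4 * (1 / ((n : ℝ) + 1))) atTop (𝓝 0) := by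
      simpa using tendsto_one_div_add_atTop_nhds_zero_nat.const_mul (4 : ℝ)
    refine squeeze_zero (fun n => (div_pos (hS0 _) (hD0 _)).le) (fun n => ?_) hl
    rw [div_le_iff₀ (hD0 n)]
    have h1 : σ (n + 1) ≤ 1 / ((n : ℝ) + 1) * σ n := by
      rw [hσs, div_mul_eq_mul_div, one_mul]
      exact div_le_div_of_nonneg_left (hσ n).le (by positivity) (by linarith)
    have h2 : 0 < 1 / ((n : ℝ) + 1) := by positivity
    nlinarith [hSσ (n + 1), mul_le_mul_of_nonneg_left (hDσ n) h2.le]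
  · have h1 : Tendsto (fun n => width (k n + 5)) atTop (𝓝 0) := tendsto_width.comp hkt5
    have h2 : Tendsto (fun n => (1 - width (k (n + 1) + 5)) / (1 + width (k n + 5))) atTop
        (𝓝 ((1 - 0) / (1 + 0))) :=
      ((h1.comp (tendsto_add_atTop_nat 1)).const_sub 1).div
        (h1.const_add 1) (by norm_num)
    rw [sub_zero, add_zero, div_one] at h2
    refine h2.congr fun n => ?_
    exact (mul_div_mul_left _ _ (hσ n).ne').symm

/-! ### Radial planes and circles -/

theorem J1234_ne_zero {x : E4} (hx : x ≠ 0) : J1234 x ≠ 0 := by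
  intro h
  refine hx ?_
  have h1 : ∀ i, J1234 x i = 0 := fun i => by rw [h]; rfl
  ext i
  have := h1 0
  have := h1 1
  have := h1 2
  have := h1 3
  fin_cases i <;> simp_all [J1234]

theorem inner_J1234 (x : E4) : inner ℝ x (J1234 x) = 0 := by
  simp [J1234, PiLp.inner_apply, Fin.sum_univ_four]
  ring

/-- The rotation `J1234` transported by an isometry. -/
noncomputable def isomRotation (Q : E4 ≃ₗᵢ[ℝ] E4) (x : E4) : E4 := Q (J1234 (Q.symm x))

theorem isomRotation_ne_zero (Q : E4 ≃ₗᵢ[ℝ] E4) {x : E4} (hx : x ≠ 0) : isomRotation Q x ≠ 0 := by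
  have : J1234 (Q.symm x) ≠ 0 := J1234_ne_zero (by simpa using hx)
  simpa [isomRotation] using this

theorem inner_isomRotation (Q : E4 ≃ₗᵢ[ℝ] E4) (x : E4) : inner ℝ x (isomRotation Q x) = 0 := by
  have : inner ℝ (Q (Q.symm x)) (isomRotation Q x) = 0 := by
    rw [isomRotation, Q.inner_map_map, inner_J1234]
  rwa [Q.apply_symm_apply] at this

theorem continuous_isomRotation (Q : E4 ≃ₗᵢ[ℝ] E4) : Continuous (isomRotation Q) := by
  have := continuous_J1234
  unfold isomRotation
  fun_prop

/-- The plane spanned by `x` and the rotated vector. -/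
noncomputable def radialPlane (Q : E4 ≃ₗᵢ[ℝ] E4) (x : E4) : Gr 4 2 := Gr.mk2 x (isomRotation Q x)

theorem radialPlane_val (Q : E4 ≃ₗᵢ[ℝ] E4) {x : E4} (hx : x ≠ 0) :
    (radialPlane Q x).1 = Submodule.span ℝ {x, isomRotation Q x} :=
  Gr.mk2_val hx (isomRotation_ne_zero Q hx) (inner_isomRotation Q x)

theorem measurable_radialPlane (Q : E4 ≃ₗᵢ[ℝ] E4) : Measurable (radialPlane Q) :=
  Gr.measurable_mk2.comp (continuous_id.prodMk (continuous_isomRotation Q)).measurable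

theorem continuousOn_radialPlane (Q : E4 ≃ₗᵢ[ℝ] E4) : ContinuousOn (radialPlane Q) {x | x ≠ 0} :=
  Gr.continuousOn_mk2.comp (continuous_id.prodMk (continuous_isomRotation Q)).continuousOn
    fun x hx => ⟨hx, isomRotation_ne_zero Q hx, inner_isomRotation Q x⟩

theorem isomRotation_smul (Q : E4 ≃ₗᵢ[ℝ] E4) (r : ℝ) (x : E4) :
    isomRotation Q (r • x) = r • isomRotation Q x := by
  have h : ∀ y : E4, J1234 (r • y) = r • J1234 y := fun y => by
    ext i; fin_cases i <;> simp [J1234]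
  rw [isomRotation, map_smul, h, map_smul, isomRotation]

theorem radialPlane_smul (Q : E4 ≃ₗᵢ[ℝ] E4) {r : ℝ} (hr : r ≠ 0) {x : E4} (hx : x ≠ 0) :
    radialPlane Q (r • x) = radialPlane Q x := by
  apply Subtype.ext
  rw [radialPlane_val Q hx, radialPlane_val Q (smul_ne_zero hr hx), isomRotation_smul]
  apply le_antisymm
  · rw [Submodule.span_le, Set.pair_subset_iff]
    exact ⟨Submodule.smul_mem _ _ (Submodule.subset_span (by simp)),
      Submodule.smul_mem _ _ (Submodule.subset_span (by simp))⟩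
  · rw [Submodule.span_le, Set.pair_subset_iff]
    exact ⟨(Submodule.smul_mem_iff _ hr).1 (Submodule.subset_span (by simp)),
      (Submodule.smul_mem_iff _ hr).1 (Submodule.subset_span (by simp))⟩

/-- The point at angle `α` of the circle over `s e^{iθ}`. -/
noncomputable def circlePoint (Q : E4 ≃ₗᵢ[ℝ] E4) (s θ α : ℝ) : E4 :=
  Q (tens α (Complex.exp (θ / 2 * Complex.I) * Real.sqrt s))

theorem continuous_circlePoint (Q : E4 ≃ₗᵢ[ℝ] E4) :
    Continuous fun u : ℝ × ℝ × ℝ => circlePoint Q u.1 u.2.1 u.2.2 := by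
  have h1 : Continuous fun u : ℝ × ℝ × ℝ =>
    (u.2.2, Complex.exp (u.2.1 / 2 * Complex.I) * Real.sqrt u.1) := by fun_prop
  exact (continuous_isom_tens Q).comp h1

theorem norm_sq_circlePoint (Q : E4 ≃ₗᵢ[ℝ] E4) {s : ℝ} (hs : 0 ≤ s) (θ α : ℝ) :
    ‖circlePoint Q s θ α‖ ^ 2 = s := by
  have : ((θ : ℂ) / 2) = ((θ / 2 : ℝ) : ℂ) := by push_cast; rfl
  rw [circlePoint, Q.norm_map, norm_tens, norm_mul, Complex.norm_real, mul_pow, Real.norm_eq_abs,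
    sq_abs, Real.sq_sqrt hs, this, Complex.norm_exp_ofReal_mul_I, one_pow, one_mul]

theorem circlePoint_ne_zero (Q : E4 ≃ₗᵢ[ℝ] E4) {s : ℝ} (hs : 0 < s) (θ α : ℝ) :
    circlePoint Q s θ α ≠ 0 := by
  intro h
  have := norm_sq_circlePoint Q hs.le θ α
  rw [h, norm_zero] at this
  norm_num at this
  exact hs.ne this

theorem circlePoint_mul (Q : E4 ≃ₗᵢ[ℝ] E4) {r : ℝ} (hr : 0 ≤ r) (s θ α : ℝ) :
    circlePoint Q (r ^ 2 * s) θ α = r • circlePoint Q s θ α := by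
  rw [circlePoint, circlePoint, ← map_smul, ← tens_smul, Real.sqrt_mul (sq_nonneg r),
    Real.sqrt_sq hr]
  congr 2
  push_cast
  ring

/-- Over a ray the direction of w̄ζ is w itself, so the second spanning vector is the position
vector and the plane contains x. -/
theorem planeField_circlePoint (Q : E4 ≃ₗᵢ[ℝ] E4) {s : ℝ} (hs : 0 < s) (θ α : ℝ) :
    planeField Q (Complex.exp (θ * Complex.I)) (circlePoint Q s θ α) =
      radialPlane Q (circlePoint Q s θ α) := by
  have hw : Complex.exp (θ / 2 * Complex.I) * (Real.sqrt s : ℂ) ≠ 0 :=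
    mul_ne_zero (Complex.exp_ne_zero _) (by exact_mod_cast (Real.sqrt_pos.2 hs).ne')
  apply Subtype.ext
  rw [radialPlane_val Q (circlePoint_ne_zero Q hs θ α), circlePoint,
    planeField_tens Q (Complex.exp_ne_zero _) α hw, isomRotation, Q.symm_apply_apply, J1234_tens,
    Set.pair_comm]
  congr 4
  rw [map_mul, ← Complex.exp_conj, Complex.conj_ofReal, map_mul, Complex.conj_I, mul_right_comm,
    ← Complex.exp_add]
  congr 2
  rw [map_div₀, Complex.conj_ofReal, map_ofNat]
  ring

/-! ### Integration over a radial shell -/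

/-- The integral of a function over the circle over `s e^{iθ}`, equipped with radial planes. -/
noncomputable def circleMean (Q : E4 ≃ₗᵢ[ℝ] E4) (f : E4 × Gr 4 2 → ℝ) (s θ : ℝ) : ℝ :=
  ∫ α in (0 : ℝ)..2 * Real.pi, f (circlePoint Q s θ α, radialPlane Q (circlePoint Q s θ α))

theorem measurable_circle (Q : E4 ≃ₗᵢ[ℝ] E4) {f : E4 × Gr 4 2 → ℝ} (hf : Measurable f) :
    Measurable fun u : ℝ × ℝ × ℝ =>
      f (circlePoint Q u.1 u.2.1 u.2.2, radialPlane Q (circlePoint Q u.1 u.2.1 u.2.2)) :=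
  hf.comp ((measurable_graph _ (measurable_radialPlane Q)).comp
    (continuous_circlePoint Q).measurable)

theorem measurable_circleMean (Q : E4 ≃ₗᵢ[ℝ] E4) {f : E4 × Gr 4 2 → ℝ} (hf : Measurable f) :
    Measurable fun v : ℝ × ℝ => circleMean Q f v.1 v.2 := by
  have h1 := measurable_circle Q hf
  have h2 : Measurable fun u : (ℝ × ℝ) × ℝ =>
      f (circlePoint Q u.1.1 u.1.2 u.2, radialPlane Q (circlePoint Q u.1.1 u.1.2 u.2)) :=
    h1.comp (g := fun u : ℝ × ℝ × ℝ => f (circlePoint Q u.1 u.2.1 u.2.2,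
      radialPlane Q (circlePoint Q u.1 u.2.1 u.2.2)))
      (f := fun u : (ℝ × ℝ) × ℝ => (u.1.1, u.1.2, u.2)) (by fun_prop)
  simp only [circleMean, intervalIntegral.integral_of_le Real.two_pi_pos.le]
  exact h2.stronglyMeasurable.integral_prod_right'.measurable

theorem abs_circleMean_le (Q : E4 ≃ₗᵢ[ℝ] E4) {f : E4 × Gr 4 2 → ℝ} {C : ℝ}
    (hf : ∀ x, |f x| ≤ C) (s θ : ℝ) : |circleMean Q f s θ| ≤ 2 * Real.pi * C := by
  have : ‖circleMean Q f s θ‖ ≤ C * |2 * Real.pi - 0| :=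
    intervalIntegral.norm_integral_le_of_norm_le_const
      (f := fun α => f (circlePoint Q s θ α, radialPlane Q (circlePoint Q s θ α)))
      fun α _ => hf _
  rwa [sub_zero, abs_of_pos Real.two_pi_pos, mul_comm] at this

theorem abs_ringAvg_le {g : ℝ → ℝ} {C : ℝ} (hg : ∀ θ, |g θ| ≤ C) {N : ℕ} (hN : N ≠ 0) (φ : ℝ) :
    |ringAvg g N φ| ≤ C := by
  have hN : (0 : ℝ) < N := by exact_mod_cast Nat.pos_of_ne_zero hN
  rw [ringAvg, abs_mul, abs_of_pos (inv_pos.2 hN)]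
  calc _ ≤ (N : ℝ)⁻¹ * ∑ j ∈ Finset.range N, C :=
        mul_le_mul_of_nonneg_left ((Finset.abs_sum_le_sum_abs _ _).trans
          (Finset.sum_le_sum fun j _ => hg _)) (inv_pos.2 hN).le
    _ = _ := by rw [Finset.sum_const, Finset.card_range, nsmul_eq_mul, inv_mul_cancel_left₀ hN.ne']

theorem exp_log_div_two {s : ℝ} (hs : 0 < s) :
    Complex.exp (Complex.log s / 2) = Real.sqrt s := by
  rw [← Complex.ofReal_log hs.le, Real.sqrt_eq_rpow, Real.rpow_def_of_pos hs]
  push_cast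
  congr 1
  ring

/-- On a ray s = ‖x‖² is the affine function a + (b - a)t of the parameter. -/
theorem integral_edge_radial (Q : E4 ≃ₗᵢ[ℝ] E4) {f : E4 × Gr 4 2 → ℝ} (hf : Measurable f) {C : ℝ}
    (hC : ∀ x, |f x| ≤ C) (θ : ℝ) {a b : ℝ} (ha : 0 < a) (hab : a < b) :
    ∫ x, f x ∂edge Q (Complex.exp (θ / 2 * Complex.I)) a b =
      (b - a) / 2 * ∫ s in a..b, circleMean Q f s θ := by
  have hη : Complex.exp (θ / 2 * Complex.I) ^ 2 = Complex.exp (θ * Complex.I) := by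
    rw [← Complex.exp_nat_mul]; congr 1; push_cast; ring
  have hba := sub_pos.2 hab
  let h : ℝ → ℝ → ℝ := fun s α =>
    f (circlePoint Q s θ α, radialPlane Q (circlePoint Q s θ α))
  have hh : Measurable fun v : ℝ × ℝ => h (a + (b - a) * v.2) v.1 :=
    (measurable_circle Q hf).comp (g := fun u : ℝ × ℝ × ℝ => f (circlePoint Q u.1 u.2.1 u.2.2,
      radialPlane Q (circlePoint Q u.1 u.2.1 u.2.2)))
      (f := fun v : ℝ × ℝ => (a + (b - a) * v.2, θ, v.1)) (by fun_prop)
  have hpt : ∀ v ∈ box, f (surf Q (Complex.exp (θ / 2 * Complex.I)) a b v,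
      planeField Q (Complex.exp (θ / 2 * Complex.I) ^ 2 * (b - a))
        (surf Q (Complex.exp (θ / 2 * Complex.I)) a b v)) = h (a + (b - a) * v.2) v.1 := by
    intro v hv
    have hs : 0 < a + (b - a) * v.2 := by
      have := mul_nonneg hba.le hv.2.1
      linarith
    have h1 : surf Q (Complex.exp (θ / 2 * Complex.I)) a b v =
        circlePoint Q (a + (b - a) * v.2) θ v.1 := by
      rw [surf, circlePoint, curve, ← exp_log_div_two hs]
      push_cast
      rw [mul_comm (v.2 : ℂ)]
    have h2 : planeField Q (Complex.exp (θ / 2 * Complex.I) ^ 2 * (b - a))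
        (circlePoint Q (a + (b - a) * v.2) θ v.1) =
        radialPlane Q (circlePoint Q (a + (b - a) * v.2) θ v.1) := by
      rw [← planeField_circlePoint Q hs, hη, mul_comm, ← Complex.ofReal_sub]
      exact planeField_real_mul Q (Complex.exp_ne_zero _) hba.ne' _
        (mul_ne_zero (Complex.exp_ne_zero _) (by exact_mod_cast (Real.sqrt_pos.2 hs).ne'))
    rw [h1, h2]
  have hint : Integrable (fun v : ℝ × ℝ => h (a + (b - a) * v.2) v.1)
      ((volume.restrict (Set.Icc 0 (2 * Real.pi))).prod (volume.restrict (Set.Icc 0 1))) :=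
    Integrable.of_bound hh.aestronglyMeasurable C (Eventually.of_forall fun v => hC _)
  rw [integral_edge Q _ _ _ hf, setIntegral_congr_fun measurableSet_box hpt, box,
    Measure.volume_eq_prod, ← Measure.prod_restrict, integral_prod_symm _ hint]
  simp only [integral_Icc_eq_integral_Ioc]
  rw [← intervalIntegral.integral_of_le zero_le_one]
  simp only [← intervalIntegral.integral_of_le Real.two_pi_pos.le]
  have h3 := intervalIntegral.smul_integral_comp_add_mul (a := 0) (b := 1)
    (fun s => circleMean Q f s θ) (b - a) a
  rw [mul_zero, add_zero, mul_one, add_sub_cancel] at h3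
  rw [← h3, ← Complex.ofReal_sub, Complex.norm_real, Real.norm_eq_abs, sq_abs, smul_eq_mul,
    ← mul_assoc]
  congr 1
  ring

theorem intervalIntegrable_circleMean (Q : E4 ≃ₗᵢ[ℝ] E4) {f : E4 × Gr 4 2 → ℝ}
    (hf : Measurable f) {C : ℝ} (hC : ∀ x, |f x| ≤ C) (θ a b : ℝ) :
    IntervalIntegrable (fun s => circleMean Q f s θ) volume a b := by
  have hm : Measurable fun s => circleMean Q f s θ :=
    (measurable_circleMean Q hf).comp (g := fun v : ℝ × ℝ => circleMean Q f v.1 v.2)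
      (f := fun s : ℝ => (s, θ)) (by fun_prop)
  rw [intervalIntegrable_iff, Set.uIoc]
  exact Integrable.of_bound hm.aestronglyMeasurable (2 * Real.pi * C)
    (Eventually.of_forall fun s => abs_circleMean_le Q hC s θ)

theorem integral_radial (Q : E4 ≃ₗᵢ[ℝ] E4) {N : ℕ} (hN : N ≠ 0) {a b w : ℝ} (ha : 0 < a)
    (hab : a < b) (hw : 0 < w) {f : E4 × Gr 4 2 → ℝ} (hf : Measurable f) {C : ℝ}
    (hC : ∀ x, |f x| ≤ C) :
    ∫ x, f x ∂net Q (layerSeg N 0 0 a b w) =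
      w / 2 * ∫ s in a..b, ringAvg (circleMean Q f s) N 0 := by
  have hN' : (N : ℝ) ≠ 0 := Nat.cast_ne_zero.2 hN
  have hba := (sub_pos.2 hab).ne'
  rw [integral_net Q _ (fun i => (layerSeg_valid (admissible_zero ha hab) hw i).weight_pos.le) hf hC]
  have hterm : ∀ i : Fin N × Bool, (layerSeg N 0 0 a b w i).c * ∫ x, f x ∂edge Q
      (layerSeg N 0 0 a b w i).η (layerSeg N 0 0 a b w i).p (layerSeg N 0 0 a b w i).q =
      -- Weight w/(2N(b - a)) times the factor (b - a)/2 of the edge; the two copies of each ray are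
      -- summed later.
      w / (4 * N) * ∫ s in a..b, circleMean Q f s (0 + 2 * Real.pi * (i.1 : ℕ) / N) := by
    rintro ⟨j, σ⟩
    have h0 : (if σ then (0 : ℝ) else -0) = 0 := by simp
    have h1 : (b : ℂ) * Complex.exp (((0 : ℝ) : ℂ) * Complex.I) = b := by simp
    simp only [layerSeg, Seg.polar, h0, h1]
    rw [integral_edge_radial Q hf hC _ ha hab, ← mul_assoc, Real.cos_zero, mul_one]
    congr 1
    field_simp
    norm_num
  simp_rw [hterm]
  rw [Fintype.sum_prod_type]
  simp only [Fintype.sum_bool]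
  have hsum : ∀ s, ringAvg (circleMean Q f s) N 0 =
      (N : ℝ)⁻¹ * ∑ j ∈ Finset.range N, circleMean Q f s (0 + 2 * Real.pi * j / N) := fun s => rfl
  simp_rw [hsum]
  rw [intervalIntegral.integral_const_mul, intervalIntegral.integral_finsetSum fun j _ =>
    intervalIntegrable_circleMean Q hf hC _ a b, ← Fin.sum_univ_eq_sum_range
    (fun j => ∫ s in a..b, circleMean Q f s (0 + 2 * Real.pi * j / N)), Finset.mul_sum,
    Finset.mul_sum]
  refine Finset.sum_congr rfl fun j _ => ?_
  field_simp
  ring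

theorem circleMean_indicator_overBall (Q : E4 ≃ₗᵢ[ℝ] E4) (s : ℝ) {u : ℝ} (hu : 0 ≤ u) (θ : ℝ) :
    circleMean Q ((overBall s).indicator 1) u θ = (Set.Iic s).indicator (fun _ => 2 * Real.pi) u := by
  have h : ∀ α, (overBall s).indicator (1 : E4 × Gr 4 2 → ℝ)
      (circlePoint Q u θ α, radialPlane Q (circlePoint Q u θ α)) =
      (Set.Iic s).indicator (fun _ => 1) u := by
    intro α
    simp only [Set.indicator_apply, overBall, Set.mem_ofPred_eq, norm_sq_circlePoint Q hu,
      Set.mem_Iic, Pi.one_apply]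
  rw [circleMean]
  simp_rw [h]
  rw [intervalIntegral.integral_const, sub_zero, smul_eq_mul]
  by_cases hs : u ≤ s <;> simp [hs]

theorem net_overBall (Q : E4 ≃ₗᵢ[ℝ] E4) {N : ℕ} (hN : N ≠ 0) {a b w s : ℝ} (ha : 0 < a)
    (hw : 0 < w) (has : a ≤ s) (hsb : s < b) :
    (net Q (layerSeg N 0 0 a b w)).real (overBall s) = Real.pi * w * (s - a) := by
  have hN' : (N : ℝ) ≠ 0 := Nat.cast_ne_zero.2 hN
  rw [← integral_indicator_one (measurableSet_overBall s),
    integral_radial Q hN ha (has.trans_lt hsb) hw (C := 1)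
    (measurable_one.indicator (measurableSet_overBall s)) fun x => by
      by_cases hx : x ∈ overBall s <;> simp [hx]]
  have h1 : ∀ u ∈ Set.uIcc a b,
      ringAvg (circleMean Q ((overBall s).indicator 1) u) N 0 =
      (Set.Iic s).indicator (fun _ => 2 * Real.pi) u := by
    intro u hu
    rw [Set.uIcc_of_le (has.trans hsb.le)] at hu
    simp only [ringAvg, circleMean_indicator_overBall Q s (ha.le.trans hu.1), Finset.sum_const,
      Finset.card_range, nsmul_eq_mul]
    rw [inv_mul_cancel_left₀ hN']
  rw [intervalIntegral.integral_congr h1, intervalIntegral.integral_of_le (has.trans hsb.le),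
    setIntegral_indicator measurableSet_Iic, Set.Ioc_inter_Iic, min_eq_right hsb.le,
    setIntegral_const, Measure.real, Real.volume_Ioc, ENNReal.toReal_ofReal (sub_nonneg.2 has),
    smul_eq_mul]
  ring

/-! ### The density at the origin -/

namespace IsTwisted

variable {V : Measure (E4 × Gr 4 2)} {a b w : ℕ → ℝ} {m : ℕ → ℕ} {Q : ℕ → E4 ≃ₗᵢ[ℝ] E4}

theorem real_ball (h : IsTwisted V a b w m Q) (n : ℕ) :
    V.real (overBall (a n)) = Real.pi * w n * a n := by
  have h1 := (h.weight_pos n).le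
  have h2 := (h.pos n).le
  rw [Measure.real, h.ball, ENNReal.toReal_ofReal (by positivity), mul_assoc]

theorem real_overBall (h : IsTwisted V a b w m Q) {n : ℕ} {s : ℝ} (has : a n ≤ s)
    (hsb : s < b n) : V.real (overBall s) = Real.pi * w n * s := by
  have hU : overBall s = overBall (a n) ∪ (overBall s ∩ Prod.fst ⁻¹' shell (a n) (b n)) := by
    ext p
    constructor
    · intro hp
      by_cases h1 : ‖p.1‖ ^ 2 ≤ a n
      · exact Or.inl h1
      · exact Or.inr ⟨hp, not_le.1 h1, lt_of_le_of_lt hp hsb⟩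
    · rintro (hp | hp)
      · exact le_trans hp has
      · exact hp.1
  have hm : MeasurableSet (Prod.fst ⁻¹' shell (a n) (b n) : Set (E4 × Gr 4 2)) :=
    measurable_fst (isOpen_shell _ _).measurableSet
  have hd : Disjoint (overBall (a n)) (overBall s ∩ Prod.fst ⁻¹' shell (a n) (b n)) :=
    Set.disjoint_left.2 fun p (h1 : ‖p.1‖ ^ 2 ≤ a n) h2 => (h2.2.1.trans_le h1).false
  have hr : V.real (overBall s ∩ Prod.fst ⁻¹' shell (a n) (b n)) =
      (net (Q n) (layerSeg (2 ^ m n) 0 0 (a n) (b n) (w n))).real (overBall s) := by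
    rw [← h.restrict, measureReal_restrict_apply (measurableSet_overBall s)]
  rw [hU, measureReal_union hd ((measurableSet_overBall s).inter hm) (h.finite _).ne
    ((measure_mono Set.inter_subset_left).trans_lt (h.finite s)).ne, hr, h.real_ball,
    net_overBall (Q n) (by positivity) (h.pos n) (h.weight_pos n) has hsb]
  ring

theorem overBall_mono {s s' : ℝ} (hs : s ≤ s') : overBall s ⊆ overBall s' := fun _ hp =>
  le_trans hp hs

theorem real_mono (h : IsTwisted V a b w m Q) {s s' : ℝ} (hs : s ≤ s') :
    V.real (overBall s) ≤ V.real (overBall s') :=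
  measureReal_mono (overBall_mono hs) (h.finite _).ne

theorem le_real_overBall (h : IsTwisted V a b w m Q) (n : ℕ) :
    Real.pi * w n * b n ≤ V.real (overBall (b n)) := by
  have hc : Continuous fun s => Real.pi * w n * s := by fun_prop
  refine le_of_tendsto ((hc.tendsto (b n)).mono_left (nhdsWithin_le_nhds (s := Set.Iio (b n)))) ?_
  filter_upwards [Ioo_mem_nhdsLT (h.lt n)] with s hs
  rw [← h.real_overBall hs.1.le hs.2]
  exact h.real_mono hs.2.le

/-- In a radial shell the ratio is exactly π times the flux. In the transition between b (n + 1) and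
a n the mass is only known to be monotone, which suffices because b (n + 1)/a n tends to 1. -/
theorem bounds (h : IsTwisted V a b w m Q) {n : ℕ} {s : ℝ} (h1 : a (n + 1) ≤ s) (h2 : s ≤ a n) :
    Real.pi * w (n + 1) * (b (n + 1) / a n) ≤ V.real (overBall s) / s ∧
      V.real (overBall s) / s ≤
        max (Real.pi * w (n + 1)) (Real.pi * w n * (b (n + 1) / a n)⁻¹) := by
  have hs : 0 < s := (h.pos _).trans_le h1
  have ha := h.pos n
  have hb : 0 < b (n + 1) := (h.pos _).trans (h.lt _)
  have hw := h.weight_pos n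
  have hw' := h.weight_pos (n + 1)
  have hlt := h.lt' n
  rcases lt_or_ge s (b (n + 1)) with h3 | h3
  · rw [h.real_overBall h1 h3, mul_div_cancel_right₀ _ hs.ne']
    refine ⟨?_, le_max_left _ _⟩
    exact mul_le_of_le_one_right (by positivity) ((div_le_one ha).2 hlt.le)
  · constructor
    · rw [le_div_iff₀ hs]
      calc _ = Real.pi * w (n + 1) * b (n + 1) * (s / a n) := by field_simp
        _ ≤ Real.pi * w (n + 1) * b (n + 1) :=
          mul_le_of_le_one_right (by positivity) ((div_le_one ha).2 h2)
        _ ≤ _ := (h.le_real_overBall _).trans (h.real_mono h3)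
    · refine le_trans ?_ (le_max_right _ _)
      rw [div_le_iff₀ hs]
      calc _ ≤ Real.pi * w n * a n := (h.real_mono h2).trans (h.real_ball n).le
        _ ≤ Real.pi * w n * a n * (s / b (n + 1)) :=
          le_mul_of_one_le_right (by positivity) ((one_le_div hb).2 h3)
        _ = _ := by field_simp

theorem tendsto_ratio (h : IsTwisted V a b w m Q) :
    Tendsto (fun s => V.real (overBall s) / s) (𝓝[>] 0) (𝓝 Real.pi) := by
  have hw1 : Tendsto (fun n => w (n + 1)) atTop (𝓝 1) :=
    h.lim_weight.comp (tendsto_add_atTop_nat 1)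
  have hlo : Tendsto (fun n => Real.pi * w (n + 1) * (b (n + 1) / a n)) atTop (𝓝 Real.pi) := by
    simpa using (hw1.const_mul Real.pi).mul h.lim_gap
  have hhi : Tendsto (fun n => max (Real.pi * w (n + 1)) (Real.pi * w n * (b (n + 1) / a n)⁻¹))
      atTop (𝓝 Real.pi) := by
    simpa using (hw1.const_mul Real.pi).max
      ((h.lim_weight.const_mul Real.pi).mul (h.lim_gap.inv₀ one_ne_zero))
  rw [tendsto_order]
  have key : ∀ n₀, ∀ s ∈ Set.Ioo 0 (a n₀), ∃ n ≥ n₀, a (n + 1) ≤ s ∧ s ≤ a n := by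
    intro n₀ s hs
    have hex : ∃ k, a (n₀ + k + 1) ≤ s := by
      have h1 := (h.lim_zero.comp (tendsto_add_atTop_nat (n₀ + 1))).eventually (ge_mem_nhds hs.1)
      obtain ⟨k, hk⟩ := h1.exists
      refine ⟨k, ?_⟩
      rwa [Function.comp_apply, show k + (n₀ + 1) = n₀ + k + 1 by omega] at hk
    classical
    refine ⟨n₀ + Nat.find hex, Nat.le_add_right _ _, Nat.find_spec hex, ?_⟩
    rcases hk : Nat.find hex with _ | k
    · exact hs.2.le
    · exact (not_le.1 (Nat.find_min hex (m := k) (by omega))).le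
  constructor
  · intro c hc
    obtain ⟨n₀, hn₀⟩ := eventually_atTop.1 (hlo.eventually (lt_mem_nhds hc))
    filter_upwards [Ioo_mem_nhdsGT (h.pos n₀)] with s hs
    obtain ⟨n, hn, h1, h2⟩ := key n₀ s hs
    exact (hn₀ n hn).trans_le (h.bounds h1 h2).1
  · intro c hc
    obtain ⟨n₀, hn₀⟩ := eventually_atTop.1 (hhi.eventually (gt_mem_nhds hc))
    filter_upwards [Ioo_mem_nhdsGT (h.pos n₀)] with s hs
    obtain ⟨n, hn, h1, h2⟩ := key n₀ s hs
    exact (h.bounds h1 h2).2.trans_lt (hn₀ n hn)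

theorem hasDensityAt (h : IsTwisted V a b w m Q) :
    HasDensityAt (V.map Prod.fst) 2 0 (ENNReal.ofReal Real.pi) := by
  have hsq : Tendsto (fun r : ℝ => r ^ 2) (𝓝[>] 0) (𝓝[>] 0) := by
    refine tendsto_nhdsWithin_iff.2 ⟨?_, ?_⟩
    · have : Tendsto (fun r : ℝ => r ^ 2) (𝓝 0) (𝓝 (0 ^ 2)) := (continuous_pow 2).tendsto 0
      rw [zero_pow two_ne_zero] at this
      exact this.mono_left nhdsWithin_le_nhds
    · filter_upwards [self_mem_nhdsWithin] with r (hr : 0 < r)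
      exact pow_pos hr 2
  refine ((ENNReal.continuous_ofReal.tendsto _).comp (h.tendsto_ratio.comp hsq)).congr' ?_
  filter_upwards [self_mem_nhdsWithin] with r (hr : 0 < r)
  have h1 : (Prod.fst ⁻¹' Metric.closedBall (0 : E4) r : Set (E4 × Gr 4 2)) = overBall (r ^ 2) := by
    ext p
    simp only [Set.mem_preimage, mem_closedBall_zero_iff, overBall, Set.mem_ofPred_eq]
    exact (pow_le_pow_iff_left₀ (norm_nonneg _) hr.le two_ne_zero).symm
  rw [Function.comp_apply, Function.comp_apply, ENNReal.ofReal_div_of_pos (by positivity),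
    Measure.real, ENNReal.ofReal_toReal (h.finite _).ne,
    Measure.map_apply measurable_fst Metric.isClosed_closedBall.measurableSet, h1]

end IsTwisted

/-! ### The invariant cone with radial planes -/

/-- The parameters of the cone. -/
noncomputable def coneParam : Measure (ℝ × ℝ × ℝ) :=
  (volume.restrict (Set.Ioi 0)).prod ((volume.restrict (Set.Ioc 0 (2 * Real.pi))).prod
    (volume.restrict (Set.Ioc 0 (2 * Real.pi))))

/-- The parametrization of the cone with its radial planes. -/
noncomputable def conePoint (Q : E4 ≃ₗᵢ[ℝ] E4) (u : ℝ × ℝ × ℝ) : E4 × Gr 4 2 :=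
  (circlePoint Q u.1 u.2.1 u.2.2, radialPlane Q (circlePoint Q u.1 u.2.1 u.2.2))

theorem measurable_conePoint (Q : E4 ≃ₗᵢ[ℝ] E4) : Measurable (conePoint Q) :=
  (measurable_graph _ (measurable_radialPlane Q)).comp (continuous_circlePoint Q).measurable

/-- The rotationally invariant varifold on the cone whose planes are radial. -/
noncomputable def coneMeasure (Q : E4 ≃ₗᵢ[ℝ] E4) : Measure (E4 × Gr 4 2) :=
  ENNReal.ofReal (4 * Real.pi)⁻¹ • coneParam.map (conePoint Q)

theorem ae_coneParam : ∀ᵐ u ∂coneParam, 0 < u.1 := by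
  have h1 : ∀ᵐ s ∂volume.restrict (Set.Ioi (0 : ℝ)), 0 < s := ae_restrict_mem measurableSet_Ioi
  exact Measure.quasiMeasurePreserving_fst.ae h1

theorem coneParam_le (R : ℝ) : coneParam {u | u.1 ≤ R} < ⊤ := by
  have : {u : ℝ × ℝ × ℝ | u.1 ≤ R} = Set.Iic R ×ˢ Set.univ := by ext; simp
  rw [this, coneParam, Measure.prod_prod, Measure.restrict_apply measurableSet_Iic, Set.inter_comm,
    Set.Ioi_inter_Iic]
  exact ENNReal.mul_lt_top (by simp) (measure_lt_top _ _)

theorem coneMeasure_overBall (Q : E4 ≃ₗᵢ[ℝ] E4) (R : ℝ) : coneMeasure Q (overBall R) < ⊤ := by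
  rw [coneMeasure, Measure.smul_apply, Measure.map_apply (measurable_conePoint Q)
    (measurableSet_overBall R)]
  refine ENNReal.mul_lt_top ENNReal.ofReal_lt_top (lt_of_le_of_lt ?_ (coneParam_le R))
  refine measure_mono_ae ?_
  filter_upwards [ae_coneParam] with u hu h
  have h1 : ‖circlePoint Q u.1 u.2.1 u.2.2‖ ^ 2 ≤ R := h
  rwa [norm_sq_circlePoint Q hu.le] at h1

theorem coneMeasure_pos (Q : E4 ≃ₗᵢ[ℝ] E4) : 0 < coneMeasure Q Set.univ := by
  rw [coneMeasure, Measure.smul_apply, Measure.map_apply (measurable_conePoint Q) MeasurableSet.univ,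
    Set.preimage_univ, coneParam, ← Set.univ_prod_univ, Measure.prod_prod, ← Set.univ_prod_univ,
    Measure.prod_prod]
  have := Real.pi_pos
  simp [Real.pi_pos]

theorem conePoint_mul (Q : E4 ≃ₗᵢ[ℝ] E4) {r : ℝ} (hr : 0 < r) {u : ℝ × ℝ × ℝ} (hu : 0 < u.1) :
    conePoint Q (r ^ 2 * u.1, u.2) = (r • (conePoint Q u).1, (conePoint Q u).2) := by
  simp only [conePoint, circlePoint_mul Q hr.le]
  rw [radialPlane_smul Q hr.ne' (circlePoint_ne_zero Q hu _ _)]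

theorem map_mul_restrict_Ioi {c : ℝ} (hc : 0 < c) :
    (volume.restrict (Set.Ioi (0 : ℝ))).map (fun s => c * s) =
      ENNReal.ofReal c⁻¹ • volume.restrict (Set.Ioi (0 : ℝ)) := by
  have h1 : (Set.Ioi (0 : ℝ)) = (fun s => c * s) ⁻¹' Set.Ioi 0 := by
    ext s; simp [hc]
  conv_lhs => rw [h1]
  rw [← Measure.restrict_map (by fun_prop) measurableSet_Ioi, Real.map_volume_mul_left hc.ne',
    abs_of_pos (inv_pos.2 hc), Measure.restrict_smul]

/-- A homothety multiplies s = ‖x‖² by t⁻² and fixes both angles and the plane; Lebesgue measure in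
s then gains the factor t². -/
theorem coneMeasure_scale (Q : E4 ≃ₗᵢ[ℝ] E4) {t : ℝ} (ht : 0 < t) :
    ENNReal.ofReal ((t ^ 2)⁻¹) • (coneMeasure Q).map (fun p => (t⁻¹ • p.1, p.2)) =
      coneMeasure Q := by
  have hm : Measurable fun p : E4 × Gr 4 2 => (t⁻¹ • p.1, p.2) :=
    (continuous_fst.const_smul t⁻¹).measurable.prodMk measurable_snd
  have hs : Measurable fun u : ℝ × ℝ × ℝ => ((t⁻¹) ^ 2 * u.1, u.2) := by fun_prop
  have h1 : coneParam.map (fun u => ((t⁻¹) ^ 2 * u.1, u.2)) = ENNReal.ofReal (t ^ 2) • coneParam := by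
    have := Measure.map_prod_map (volume.restrict (Set.Ioi (0 : ℝ)))
      ((volume.restrict (Set.Ioc 0 (2 * Real.pi))).prod
        (volume.restrict (Set.Ioc 0 (2 * Real.pi)))) (f := fun s => (t⁻¹) ^ 2 * s) (g := id)
      (by fun_prop) measurable_id
    rw [Measure.map_id, map_mul_restrict_Ioi (by positivity), Measure.prod_smul_left] at this
    rw [coneParam]
    refine this.symm.trans ?_
    rw [inv_pow, inv_inv]
  have h2 : (coneParam.map (conePoint Q)).map (fun p => (t⁻¹ • p.1, p.2)) =
      ENNReal.ofReal (t ^ 2) • coneParam.map (conePoint Q) := by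
    rw [← Measure.map_smul, ← h1, Measure.map_map (measurable_conePoint Q) hs,
      Measure.map_map hm (measurable_conePoint Q)]
    refine Measure.map_congr ?_
    filter_upwards [ae_coneParam] with u hu
    exact (conePoint_mul Q (inv_pos.2 ht) hu).symm
  rw [coneMeasure, Measure.map_smul, h2, smul_comm, smul_smul _ _ (coneParam.map _),
    ← ENNReal.ofReal_mul (by positivity), inv_mul_cancel₀ (by positivity), ENNReal.ofReal_one,
    one_smul]

theorem exists_bound_of_compact {f : E4 × Gr 4 2 → ℝ} (hf : Continuous f)
    (hc : HasCompactSupport f) :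
    ∃ C R : ℝ, (∀ p, |f p| ≤ C) ∧ ∀ p, p ∉ overBall R → f p = 0 := by
  obtain ⟨C, hC⟩ := hc.exists_bound_of_continuous hf
  have hK : IsCompact (Prod.fst '' tsupport f) := hc.isCompact.image continuous_fst
  obtain ⟨r, hr⟩ := hK.isBounded.subset_closedBall (0 : E4)
  refine ⟨C, r ^ 2, hC, fun p hp => image_eq_zero_of_notMem_tsupport fun h => hp ?_⟩
  exact pow_le_pow_left₀ (norm_nonneg _) (by simpa using hr (Set.mem_image_of_mem _ h)) 2

theorem circleMean_eq_zero (Q : E4 ≃ₗᵢ[ℝ] E4) {f : E4 × Gr 4 2 → ℝ} {R : ℝ}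
    (hf : ∀ p, p ∉ overBall R → f p = 0) {s : ℝ} (hs0 : 0 ≤ s) (hs : R < s) (θ : ℝ) :
    circleMean Q f s θ = 0 := by
  have h : ∀ α, f (circlePoint Q s θ α, radialPlane Q (circlePoint Q s θ α)) = 0 := fun α =>
    hf _ fun h => by
      have h1 : ‖circlePoint Q s θ α‖ ^ 2 ≤ R := h
      rw [norm_sq_circlePoint Q hs0] at h1
      linarith
  rw [circleMean]
  simp_rw [h]
  exact intervalIntegral.integral_zero

theorem integral_coneMeasure (Q : E4 ≃ₗᵢ[ℝ] E4) {f : E4 × Gr 4 2 → ℝ} (hf : Continuous f)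
    (hc : HasCompactSupport f) :
    ∫ p, f p ∂coneMeasure Q = 1 / 2 * ∫ s in Set.Ioi 0,
      (2 * Real.pi)⁻¹ * ∫ θ in (0 : ℝ)..2 * Real.pi, circleMean Q f s θ := by
  obtain ⟨C, R, hC, hR⟩ := exists_bound_of_compact hf hc
  have hm : Measurable fun u => f (conePoint Q u) := hf.measurable.comp (measurable_conePoint Q)
  have hint : Integrable (fun u => f (conePoint Q u)) coneParam := by
    have : IsFiniteMeasure (coneParam.restrict {u | u.1 ≤ R}) := ⟨by simpa using coneParam_le R⟩
    have h1 : IntegrableOn (fun u => f (conePoint Q u)) {u | u.1 ≤ R} coneParam :=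
      Integrable.of_bound hm.aestronglyMeasurable C (Eventually.of_forall fun u => hC _)
    have hms : MeasurableSet {u : ℝ × ℝ × ℝ | u.1 ≤ R} := measurableSet_le measurable_fst
      measurable_const
    refine ((integrable_indicator_iff hms).2 h1).congr ?_
    filter_upwards [ae_coneParam] with u hu
    by_cases h2 : u.1 ≤ R
    · exact Set.indicator_of_mem (s := {u : ℝ × ℝ × ℝ | u.1 ≤ R}) h2 _
    · rw [Set.indicator_of_notMem (s := {u : ℝ × ℝ × ℝ | u.1 ≤ R}) h2]
      refine (hR _ fun h => h2 ?_).symm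
      have h1 : ‖circlePoint Q u.1 u.2.1 u.2.2‖ ^ 2 ≤ R := h
      rwa [norm_sq_circlePoint Q hu.le] at h1
  have hin : ∀ s, ∫ v, f (conePoint Q (s, v)) ∂((volume.restrict (Set.Ioc 0 (2 * Real.pi))).prod
      (volume.restrict (Set.Ioc 0 (2 * Real.pi)))) =
      ∫ θ in (0 : ℝ)..2 * Real.pi, circleMean Q f s θ := by
    intro s
    have hi : Integrable (fun v => f (conePoint Q (s, v)))
        ((volume.restrict (Set.Ioc 0 (2 * Real.pi))).prod
          (volume.restrict (Set.Ioc 0 (2 * Real.pi)))) :=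
      Integrable.of_bound (hm.comp (f := fun v : ℝ × ℝ => (s, v))
        (by fun_prop)).aestronglyMeasurable C (Eventually.of_forall fun u => hC _)
    rw [integral_prod _ hi]
    simp only [circleMean, intervalIntegral.integral_of_le Real.two_pi_pos.le]
    rfl
  rw [coneMeasure, integral_smul_measure, integral_map (measurable_conePoint Q).aemeasurable
    hf.aestronglyMeasurable, coneParam, integral_prod _ hint]
  simp_rw [hin]
  rw [integral_const_mul, ENNReal.toReal_ofReal (by have := Real.pi_pos; positivity), smul_eq_mul,
    ← mul_assoc]
  congr 1
  have := Real.pi_pos.ne'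
  field_simp
  norm_num

theorem circleMean_scale (Q : E4 ≃ₗᵢ[ℝ] E4) (f : E4 × Gr 4 2 → ℝ) {t s : ℝ} (ht : 0 < t)
    (hs : 0 < s) (θ : ℝ) :
    circleMean Q (fun p => f (t⁻¹ • p.1, p.2)) (t ^ 2 * s) θ = circleMean Q f s θ := by
  unfold circleMean
  congr 1
  ext α
  simp only []
  rw [circlePoint_mul Q ht.le, radialPlane_smul Q ht.ne' (circlePoint_ne_zero Q hs _ _),
    inv_smul_smul₀ ht.ne']

/-- Positive s is needed, as radial planes have no continuous extension to the origin. -/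
theorem continuous_circle_angle (Q : E4 ≃ₗᵢ[ℝ] E4) {f : E4 × Gr 4 2 → ℝ} (hf : Continuous f)
    {s : ℝ} (hs : 0 < s) : Continuous (circleMean Q f s) := by
  have h1 : Continuous fun v : ℝ × ℝ => circlePoint Q s v.1 v.2 :=
    (continuous_circlePoint Q).comp (f := fun v : ℝ × ℝ => (s, v)) (by fun_prop)
  have h2 : Continuous fun v : ℝ × ℝ => radialPlane Q (circlePoint Q s v.1 v.2) :=
    (continuousOn_radialPlane Q).comp_continuous h1 fun v => circlePoint_ne_zero Q hs _ _
  exact intervalIntegral.continuous_parametric_intervalIntegral_of_continuous' (μ := volume)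
    (f := fun θ α => f (circlePoint Q s θ α, radialPlane Q (circlePoint Q s θ α)))
    (hf.comp (h1.prodMk h2)) 0 (2 * Real.pi)

/-- For fixed s > 0 the ring averages are Riemann sums in θ and s eventually lies between ρ and ρ⁻¹;
the compact support of f supplies an integrable bound. -/
theorem tendsto_integral_ringAvg (Q : E4 ≃ₗᵢ[ℝ] E4) {f : E4 × Gr 4 2 → ℝ} (hf : Continuous f)
    (hc : HasCompactSupport f) {ρ : ℕ → ℝ} (hρ0 : ∀ n, 0 < ρ n) (hρ1 : ∀ n, ρ n < 1)
    (hρ : Tendsto ρ atTop (𝓝 0)) {N : ℕ → ℕ} (hN : Tendsto N atTop atTop) (hN0 : ∀ n, N n ≠ 0) :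
    Tendsto (fun n => ∫ s in ρ n..(ρ n)⁻¹, ringAvg (circleMean Q f s) (N n) 0) atTop
      (𝓝 (∫ s in Set.Ioi 0,
        (2 * Real.pi)⁻¹ * ∫ θ in (0 : ℝ)..2 * Real.pi, circleMean Q f s θ)) := by
  obtain ⟨C, R, hC, hR⟩ := exists_bound_of_compact hf hc
  have hlt : ∀ n, ρ n ≤ (ρ n)⁻¹ := fun n => (hρ1 n).le.trans ((one_le_inv₀ (hρ0 n)).2 (hρ1 n).le)
  have hmeas : ∀ n, Measurable fun s => ringAvg (circleMean Q f s) (N n) 0 := by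
    intro n
    unfold ringAvg
    refine measurable_const.mul (Finset.measurable_sum _ fun j _ => ?_)
    exact (measurable_circleMean Q hf.measurable).comp
      (g := fun v : ℝ × ℝ => circleMean Q f v.1 v.2)
      (f := fun s : ℝ => (s, 0 + 2 * Real.pi * j / (N n))) (by fun_prop)
  have hrep : ∀ n, ∫ s in ρ n..(ρ n)⁻¹, ringAvg (circleMean Q f s) (N n) 0 =
      ∫ s in Set.Ioi 0, (Set.Ioc (ρ n) (ρ n)⁻¹).indicator
        (fun s => ringAvg (circleMean Q f s) (N n) 0) s := by
    intro n
    rw [setIntegral_indicator measurableSet_Ioc, intervalIntegral.integral_of_le (hlt n),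
      Set.inter_eq_right.2 (show Set.Ioc (ρ n) (ρ n)⁻¹ ⊆ Set.Ioi 0 from
        fun s hs => (hρ0 n).trans hs.1)]
  simp_rw [hrep]
  refine tendsto_integral_of_dominated_convergence
    ((Set.Iic R).indicator fun _ => 2 * Real.pi * C) (fun n =>
      ((hmeas n).indicator measurableSet_Ioc).aestronglyMeasurable) ?_ (fun n => ?_) ?_
  · rw [integrable_indicator_iff measurableSet_Iic, IntegrableOn,
      Measure.restrict_restrict measurableSet_Iic, Set.inter_comm, Set.Ioi_inter_Iic]
    exact integrable_const _
  · filter_upwards [ae_restrict_mem measurableSet_Ioi] with s (hs : 0 < s)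
    have hb := abs_ringAvg_le (fun θ => abs_circleMean_le Q hC s θ) (hN0 n) 0
    by_cases h1 : s ≤ R
    · rw [Set.indicator_of_mem (Set.mem_Iic.2 h1)]
      refine le_trans (norm_indicator_le_norm_self _ _) hb
    · rw [Set.indicator_of_notMem (s := Set.Iic R) (by simpa using h1)]
      have h2 : circleMean Q f s = fun _ => 0 :=
        funext fun θ => circleMean_eq_zero Q hR hs.le (not_le.1 h1) θ
      have h3 : ringAvg (circleMean Q f s) (N n) 0 = 0 := by rw [h2, ringAvg]; simp
      refine le_trans (norm_indicator_le_norm_self _ _) ?_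
      rw [h3, norm_zero]
  · filter_upwards [ae_restrict_mem measurableSet_Ioi] with s (hs : 0 < s)
    have h1 := tendsto_ringAvg (A := fun v => circleMean Q f s v.2)
      ((continuous_circle_angle Q hf hs).comp continuous_snd) (tendsto_const_nhds (x := (0 : ℝ))) hN
    refine h1.congr' ?_
    have h2 : ∀ᶠ n in atTop, ρ n < s := hρ.eventually (gt_mem_nhds hs)
    have h3 : ∀ᶠ n in atTop, ρ n < s⁻¹ := hρ.eventually (gt_mem_nhds (inv_pos.2 hs))
    filter_upwards [h2, h3] with n hn2 hn3
    rw [Set.indicator_of_mem]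
    exact ⟨hn2, ((lt_inv_comm₀ (hρ0 n) hs).1 hn3).le⟩

theorem integral_radial_scale (Q : E4 ≃ₗᵢ[ℝ] E4) {N : ℕ} (hN : N ≠ 0) {t ρ w : ℝ} (ht : 0 < t)
    (hρ : 0 < ρ) (hρ1 : ρ < 1) (hw : 0 < w) {f : E4 × Gr 4 2 → ℝ} (hf : Continuous f) {C : ℝ}
    (hC : ∀ x, |f x| ≤ C) :
    (t ^ 2)⁻¹ * ∫ p, f (t⁻¹ • p.1, p.2) ∂net Q (layerSeg N 0 0 (t ^ 2 * ρ) (t ^ 2 * ρ⁻¹) w) =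
      w / 2 * ∫ s in ρ..ρ⁻¹, ringAvg (circleMean Q f s) N 0 := by
  have hlt : ρ < ρ⁻¹ := hρ1.trans ((one_lt_inv₀ hρ).2 hρ1)
  have hm : Measurable fun p : E4 × Gr 4 2 => f (t⁻¹ • p.1, p.2) := by
    have : Continuous fun p : E4 × Gr 4 2 => f (t⁻¹ • p.1, p.2) := by fun_prop
    exact this.measurable
  rw [integral_radial Q hN (by positivity) (mul_lt_mul_of_pos_left hlt (by positivity)) hw hm
    fun x => hC _, ← intervalIntegral.smul_integral_comp_mul_left
    (fun s => ringAvg (circleMean Q (fun p => f (t⁻¹ • p.1, p.2)) s) N 0), smul_eq_mul,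
    mul_left_comm, inv_mul_cancel_left₀ (by positivity)]
  congr 1
  refine intervalIntegral.integral_congr fun s hs => ?_
  rw [Set.uIcc_of_le hlt.le] at hs
  simp only [ringAvg]
  congr 1
  exact Finset.sum_congr rfl fun j _ => circleMean_scale Q f ht (hρ.trans_le hs.1) _

/-! ### Convergence of the blow-ups -/

namespace IsTwisted

variable {V : Measure (E4 × Gr 4 2)} {a b w : ℕ → ℝ} {m : ℕ → ℕ} {Q : ℕ → E4 ≃ₗᵢ[ℝ] E4}

theorem integral_eq (h : IsTwisted V a b w m Q) (n : ℕ) {f : E4 × Gr 4 2 → ℝ} (hf : Measurable f)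
    {C R : ℝ} (hC : ∀ p, |f p| ≤ C) (hR : ∀ p, p ∉ overBall R → f p = 0) (hRb : R < b n) :
    ∫ p, f p ∂V = (∫ p in overBall (a n), f p ∂V) +
      ∫ p, f p ∂net (Q n) (layerSeg (2 ^ m n) 0 0 (a n) (b n) (w n)) := by
  have hm : MeasurableSet (Prod.fst ⁻¹' shell (a n) (b n) : Set (E4 × Gr 4 2)) :=
    measurable_fst (isOpen_shell _ _).measurableSet
  have hd : Disjoint (overBall (a n)) (Prod.fst ⁻¹' shell (a n) (b n)) :=
    Set.disjoint_left.2 fun p (h1 : ‖p.1‖ ^ 2 ≤ a n) h2 => (h2.1.trans_le h1).false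
  have hi : ∀ s ⊆ overBall (b n), IntegrableOn f s V := fun s hs => by
    have : IsFiniteMeasure (V.restrict s) :=
      ⟨by simpa using (measure_mono hs).trans_lt (h.finite (b n))⟩
    exact Integrable.of_bound hf.aestronglyMeasurable C (Eventually.of_forall hC)
  rw [← h.restrict, ← setIntegral_union hd hm (hi _ (overBall_mono (h.lt n).le))
    (hi _ fun p hp => hp.2.le)]
  refine (setIntegral_eq_integral_of_forall_compl_eq_zero fun p hp => hR p fun h1 => hp ?_).symm
  by_cases h2 : ‖p.1‖ ^ 2 ≤ a n
  · exact Or.inl h2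
  · exact Or.inr ⟨not_le.1 h2, lt_of_le_of_lt h1 hRb⟩

/-- At the scale t² = √(ab), the geometric mean, the radial shell becomes (ρ, ρ⁻¹) with ρ = √(a/b) →
0. The outside leaves the support of f, the inside has vanishing rescaled mass, and the rays
equidistribute. -/
theorem tendsto_blowup (h : IsTwisted V a b w m Q) {φ : ℕ → ℕ} (hφ : Tendsto φ atTop atTop)
    {P : E4 ≃ₗᵢ[ℝ] E4} (hP : ∀ i, Q (φ i) = P) {f : E4 × Gr 4 2 → ℝ} (hf : Continuous f)
    (hc : HasCompactSupport f) :
    let t : ℕ → ℝ := fun i => Real.sqrt (Real.sqrt (a (φ i) * b (φ i)))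
    Tendsto (fun i => (t i ^ 2)⁻¹ * ∫ p, f ((t i)⁻¹ • (p.1 - 0), p.2) ∂V) atTop
      (𝓝 (∫ p, f p ∂coneMeasure P)) := by
  intro t
  obtain ⟨C, R, hC, hR⟩ := exists_bound_of_compact hf hc
  have hb : ∀ n, 0 < b n := fun n => (h.pos n).trans (h.lt n)
  let ρ : ℕ → ℝ := fun n => Real.sqrt (a n / b n)
  have hρ0 : ∀ n, 0 < ρ n := fun n => Real.sqrt_pos.2 (div_pos (h.pos n) (hb n))
  have hρ1 : ∀ n, ρ n < 1 := fun n => by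
    rw [← Real.sqrt_one]
    exact Real.sqrt_lt_sqrt (div_pos (h.pos n) (hb n)).le ((div_lt_one (hb n)).2 (h.lt n))
  have hρ : Tendsto ρ atTop (𝓝 0) := by
    have := (Real.continuous_sqrt.tendsto 0).comp h.lim_ratio
    rwa [Real.sqrt_zero] at this
  have ht0 : ∀ i, 0 < t i := fun i =>
    Real.sqrt_pos.2 (Real.sqrt_pos.2 (mul_pos (h.pos _) (hb _)))
  have ht2 : ∀ i, t i ^ 2 = Real.sqrt (a (φ i) * b (φ i)) := fun i =>
    Real.sq_sqrt (Real.sqrt_nonneg _)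
  have ha : ∀ i, t i ^ 2 * ρ (φ i) = a (φ i) := fun i => by
    have h1 := hb (φ i)
    rw [ht2, ← Real.sqrt_mul (mul_pos (h.pos _) h1).le,
      show a (φ i) * b (φ i) * (a (φ i) / b (φ i)) = a (φ i) ^ 2 by field_simp,
      Real.sqrt_sq (h.pos _).le]
  have hb' : ∀ i, t i ^ 2 * (ρ (φ i))⁻¹ = b (φ i) := fun i => by
    have h1 := hb (φ i)
    have h2 := h.pos (φ i)
    rw [ht2, ← Real.sqrt_inv, ← Real.sqrt_mul (mul_pos h2 h1).le,
      show a (φ i) * b (φ i) * (a (φ i) / b (φ i))⁻¹ = b (φ i) ^ 2 by field_simp,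
      Real.sqrt_sq h1.le]
  -- The contribution of the inner ball, of mass π w a; after division by t² it is at most C π w ρ.
  let A : ℕ → ℝ := fun i => (t i ^ 2)⁻¹ * ∫ p in overBall (a (φ i)), f ((t i)⁻¹ • p.1, p.2) ∂V
  have hA : Tendsto A atTop (𝓝 0) := by
    have h1 : Tendsto (fun i => C * (Real.pi * w (φ i)) * ρ (φ i)) atTop (𝓝 0) := by
      have := ((((h.lim_weight.const_mul Real.pi).const_mul C).mul hρ)).comp hφ
      rwa [mul_zero] at this
    refine squeeze_zero_norm (fun i => ?_) h1
    have h2 := norm_setIntegral_le_of_norm_le_const (f := fun p => f ((t i)⁻¹ • p.1, p.2)) (C := C)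
      (h.finite (a (φ i))) fun p _ => hC _
    rw [h.real_ball] at h2
    have h3 := pow_pos (ht0 i) 2
    rw [norm_mul, norm_inv, Real.norm_of_nonneg h3.le, inv_mul_le_iff₀ h3]
    refine h2.trans (le_of_eq ?_)
    rw [← ha i]
    ring
  have hmain := tendsto_integral_ringAvg P hf hc (ρ := fun i => ρ (φ i)) (N := fun i => 2 ^ m (φ i))
    (fun i => hρ0 _) (fun i => hρ1 _) (hρ.comp hφ)
    ((tendsto_pow_atTop_atTop_of_one_lt one_lt_two).comp (h.lim_rings.comp hφ))
    (fun i => by positivity)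
  have hw : Tendsto (fun i => w (φ i) / 2) atTop (𝓝 (1 / 2)) :=
    (h.lim_weight.comp hφ).div_const 2
  have hsum := hA.add (hw.mul hmain)
  rw [zero_add, ← integral_coneMeasure P hf hc] at hsum
  refine hsum.congr' ?_
  have hev : ∀ᶠ i in atTop, R < (ρ (φ i))⁻¹ := by
    have h1 : Tendsto (fun n => (ρ n)⁻¹) atTop atTop :=
      (tendsto_nhdsWithin_iff.2 ⟨hρ, Eventually.of_forall hρ0⟩).inv_tendsto_nhdsGT_zero
    exact (h1.comp hφ).eventually_gt_atTop R
  filter_upwards [hev] with i hi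
  have h3 := pow_pos (ht0 i) 2
  have hcont : Continuous fun p : E4 × Gr 4 2 => f ((t i)⁻¹ • p.1, p.2) := by fun_prop
  have hsplit := h.integral_eq (φ i) (R := t i ^ 2 * R) hcont.measurable (fun p => hC _)
    (fun p hp => hR _ fun hp' => hp ?_) (by rw [← hb' i]; exact mul_lt_mul_of_pos_left hi h3)
  · have hrad := integral_radial_scale P (N := 2 ^ m (φ i)) (by positivity) (ht0 i) (hρ0 (φ i))
      (hρ1 (φ i)) (h.weight_pos (φ i)) hf hC
    rw [ha i, hb' i] at hrad
    simp only [sub_zero]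
    rw [hsplit, mul_add, hP i, hrad]
  · have h4 : ‖(t i)⁻¹ • p.1‖ ^ 2 ≤ R := hp'
    rw [norm_smul, mul_pow, norm_inv, inv_pow, Real.norm_of_nonneg (ht0 i).le,
      inv_mul_le_iff₀ h3] at h4
    exact h4

theorem tendsto_scale (h : IsTwisted V a b w m Q) {φ : ℕ → ℕ} (hφ : Tendsto φ atTop atTop) :
    Tendsto (fun i => Real.sqrt (Real.sqrt (a (φ i) * b (φ i)))) atTop (𝓝 0) := by
  have h1 : Tendsto (fun n => a (n + 1) * b (n + 1)) atTop (𝓝 0) := by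
    refine squeeze_zero (fun n => (mul_pos (h.pos _) ((h.pos _).trans (h.lt _))).le) (fun n =>
      mul_le_mul_of_nonneg_left (h.lt' n).le (h.pos _).le) ?_
    simpa using (h.lim_zero.comp (tendsto_add_atTop_nat 1)).mul h.lim_zero
  have h2 : Tendsto (fun n => a n * b n) atTop (𝓝 0) := (tendsto_add_atTop_iff_nat 1).1 h1
  have h3 := ((Real.continuous_sqrt.comp Real.continuous_sqrt).tendsto 0).comp (h2.comp hφ)
  rw [Function.comp_apply, Real.sqrt_zero, Real.sqrt_zero] at h3
  exact h3

end IsTwisted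

/-! ### Separation of the two cones and conclusion -/

theorem inner_J1324 (x : E4) : inner ℝ x (J1324 x) = 0 := by
  simp [J1324, PiLp.inner_apply, Fin.sum_univ_four]
  ring

theorem inner_J1234_J1324 {x : E4} (hx : x 0 * x 3 = x 1 * x 2) :
    inner ℝ (J1234 x) (J1324 x) = 0 := by
  simp [J1324, J1234, PiLp.inner_apply, Fin.sum_univ_four]
  linear_combination -2 * hx

theorem J1324_ne_zero {x : E4} (hx : x ≠ 0) : J1324 x ≠ 0 := by
  intro h
  refine hx ?_
  have h1 : ∀ i, J1324 x i = 0 := fun i => by rw [h]; rfl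
  ext i
  have := h1 0
  have := h1 1
  have := h1 2
  have := h1 3
  fin_cases i <;> simp_all [J1324]

/-- On the quadric x, `J1234 x` and `J1324 x` are mutually orthogonal, so the third cannot lie in
the span of the first two unless it vanishes. -/
theorem disjoint_radialSet : Disjoint (radialSet J1324) (radialSet J1234) := by
  refine Set.disjoint_left.2 ?_
  rintro ⟨x, S⟩ ⟨hx0, hxK, hS⟩ ⟨-, -, hS'⟩
  simp only at hx0 hxK hS hS'
  have hmem : J1324 x ∈ Submodule.span ℝ {x, J1234 x} := by
    rw [← hS', hS]
    exact Submodule.subset_span (by simp)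
  obtain ⟨c, d, hcd⟩ := Submodule.mem_span_pair.1 hmem
  refine J1324_ne_zero hx0 (inner_self_eq_zero (𝕜 := ℝ).1 ?_)
  nth_rw 1 [← hcd]
  rw [inner_add_left, inner_smul_left, inner_smul_left, inner_J1324, inner_J1234_J1324 hxK]
  simp

/-- As S has dimension 2, equality with the span means that the projection onto S fixes x and J x, a
closed condition. -/
theorem measurableSet_radialSet {J : E4 → E4} (hJ : Continuous J) (h0 : ∀ x, x ≠ 0 → J x ≠ 0)
    (hi : ∀ x, inner ℝ x (J x) = 0) : MeasurableSet (radialSet J) := by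
  have hproj : ∀ {g : E4 → E4}, Continuous g →
      IsClosed {p : E4 × Gr 4 2 | p.2.1.starProjection (g p.1) = g p.1} := fun {g} hg => by
    have h1 : Continuous fun p : E4 × Gr 4 2 => p.2.1.starProjection :=
      (Gr.isInducing_starProjection 4 2).continuous.comp continuous_snd
    exact isClosed_eq (h1.clm_apply (hg.comp continuous_fst)) (hg.comp continuous_fst)
  have : radialSet J = {p | p.1 ≠ 0} ∩ ({p | p.1 0 * p.1 3 = p.1 1 * p.1 2} ∩
      ({p | p.2.1.starProjection p.1 = p.1} ∩ {p | p.2.1.starProjection (J p.1) = J p.1})) := by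
    ext ⟨x, S⟩
    simp only [radialSet, Set.mem_inter_iff, Set.mem_ofPred_eq,
      Submodule.starProjection_eq_self_iff]
    refine and_congr_right fun hx => and_congr_right fun _ => ⟨fun h => ?_, fun h => ?_⟩
    · rw [h]
      exact ⟨Submodule.subset_span (by simp), Submodule.subset_span (by simp)⟩
    · refine (Submodule.eq_of_le_of_finrank_eq ?_ ?_).symm
      · rw [Submodule.span_le, Set.pair_subset_iff]
        exact h
      · rw [S.2, finrank_span_pair_of_orthogonal hx (h0 x hx) (hi x)]
  rw [this]
  refine (isOpen_ne_fun continuous_fst continuous_const).measurableSet.inter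
    (IsClosed.measurableSet ?_ |>.inter ((hproj continuous_id).inter (hproj hJ)).measurableSet)
  exact isClosed_eq (by fun_prop) (by fun_prop)

theorem isomRotation_refl : isomRotation (LinearIsometryEquiv.refl ℝ E4) = J1234 := rfl

theorem isomRotation_swapFactors : isomRotation swapFactors = J1324 := by
  ext x i
  rw [isomRotation, swapFactors_symm, swapFactors_apply, swapFactors_apply]
  fin_cases i <;> simp [J1234, J1324]

theorem tens_mem_quadric (α : ℝ) (w : ℂ) :
    tens α w 0 * tens α w 3 = tens α w 1 * tens α w 2 := by
  rw [tens]
  simp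
  ring

theorem coneMeasure_compl_radialSet {Q : E4 ≃ₗᵢ[ℝ] E4} {J : E4 → E4} (hJ : Continuous J)
    (hQJ : isomRotation Q = J)
    (hQ : ∀ x : E4, x 0 * x 3 = x 1 * x 2 → Q x 0 * Q x 3 = Q x 1 * Q x 2) :
    coneMeasure Q (radialSet J)ᶜ = 0 := by
  subst hQJ
  have hm := measurableSet_radialSet hJ (fun x => isomRotation_ne_zero Q) (inner_isomRotation Q)
  rw [coneMeasure, Measure.smul_apply, Measure.map_apply (measurable_conePoint Q) hm.compl,
    smul_eq_mul, mul_eq_zero]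
  right
  refine (ae_iff (p := fun u => conePoint Q u ∈ radialSet (isomRotation Q))).1 ?_
  filter_upwards [ae_coneParam] with u hu
  have h0 := circlePoint_ne_zero Q hu u.2.1 u.2.2
  exact ⟨h0, hQ _ (tens_mem_quadric _ _), radialPlane_val Q h0⟩

/-- The cone as a varifold. -/
noncomputable def coneVarifold (Q : E4 ≃ₗᵢ[ℝ] E4) : Varifold 4 2 where
  toMeasure := coneMeasure Q
  finite_on_compacts := ⟨fun K hK => by
    obtain ⟨r, hr⟩ := (hK.image continuous_fst).isBounded.subset_closedBall (0 : E4)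
    refine (measure_mono fun p hp => ?_).trans_lt (coneMeasure_overBall Q (r ^ 2))
    exact pow_le_pow_left₀ (norm_nonneg _) (by simpa using hr (Set.mem_image_of_mem _ hp)) 2⟩

theorem theorem5p2 :
    ∃ V : Varifold 4 2, V.IsRectifiable ∧ V.IsStationary ∧
      (∃ θ : ℝ≥0∞, 0 < θ ∧ θ < ⊤ ∧ HasDensityAt V.weight 2 0 θ) ∧
      Disjoint (radialSet J1324) (radialSet J1234) ∧
      ∃ C₁ C₂ : Varifold 4 2, C₁ ≠ C₂ ∧
        C₁.IsTangentAt V 0 ∧ C₁.IsConical ∧ 0 < C₁.toMeasure Set.univ ∧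
          C₁.toMeasure (radialSet J1324)ᶜ = 0 ∧
        C₂.IsTangentAt V 0 ∧ C₂.IsConical ∧ 0 < C₂.toMeasure Set.univ ∧
          C₂.toMeasure (radialSet J1234)ᶜ = 0 := by
  let Q : ℕ → E4 ≃ₗᵢ[ℝ] E4 := fun n =>
    if Even n then LinearIsometryEquiv.refl ℝ E4 else swapFactors
  have hQ : ∀ n, ∀ X : E4 → E4, Continuous X → ∀ s,
      torusForce (Q n) X s = torusForce (Q (n + 1)) X s := by
    intro n X hX s
    by_cases hn : Even n
    · simp only [Q, if_pos hn, if_neg (Nat.even_add_one.not.2 (not_not.2 hn))]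
      exact (torusForce_swapFactors hX s).symm
    · simp only [Q, if_neg hn, if_pos (Nat.even_add_one.2 hn)]
      exact torusForce_swapFactors hX s
  obtain ⟨V, a, b, w, m, h⟩ := exists_isTwisted hQ
  have htangent : ∀ {φ : ℕ → ℕ} (hφ : Tendsto φ atTop atTop) {P : E4 ≃ₗᵢ[ℝ] E4}
      (hP : ∀ i, Q (φ i + 1) = P) (hV : IsFiniteMeasureOnCompacts V),
      (coneVarifold P).IsTangentAt ⟨V, hV⟩ 0 := fun {φ} hφ {P} hP hV =>
    ⟨fun i => Real.sqrt (Real.sqrt (a (φ i) * b (φ i))),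
      fun i => Real.sqrt_pos.2 (Real.sqrt_pos.2 (mul_pos (h.pos _) ((h.pos _).trans (h.lt _)))),
      h.tendsto_scale hφ, fun f hf hc => h.tendsto_blowup hφ hP hf hc⟩
  have hV : IsFiniteMeasureOnCompacts V := ⟨fun K hK => by
    obtain ⟨r, hr⟩ := (hK.image continuous_fst).isBounded.subset_closedBall (0 : E4)
    refine (measure_mono fun p hp => ?_).trans_lt (h.finite (r ^ 2))
    exact pow_le_pow_left₀ (norm_nonneg _) (by simpa using hr (Set.mem_image_of_mem _ hp)) 2⟩
  have hz1 : (coneVarifold swapFactors).toMeasure (radialSet J1324)ᶜ = 0 :=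
    coneMeasure_compl_radialSet continuous_J1324 isomRotation_swapFactors fun x hx => by
      rw [swapFactors_apply]
      simpa [mul_comm] using hx
  have hz2 : (coneVarifold (LinearIsometryEquiv.refl ℝ E4)).toMeasure (radialSet J1234)ᶜ = 0 :=
    coneMeasure_compl_radialSet continuous_J1234 isomRotation_refl fun x hx => hx
  refine ⟨⟨V, hV⟩, ?_, h.stationary, ⟨_, ENNReal.ofReal_pos.2 Real.pi_pos, ENNReal.ofReal_lt_top,
    h.hasDensityAt⟩, disjoint_radialSet, coneVarifold swapFactors,
    coneVarifold (LinearIsometryEquiv.refl ℝ E4), ?_,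
    -- The n-th shell carries `Q (n + 1)`: even indices select the interchanged factors, odd indices
    -- the original ones.
    htangent (φ := fun i => 2 * i) (tendsto_id.const_mul_atTop' two_pos) (fun i => ?_) hV,
    fun t ht => coneMeasure_scale _ ht, coneMeasure_pos _, hz1,
    htangent (φ := fun i => 2 * i + 1) ?_ (fun i => ?_) hV,
    fun t ht => coneMeasure_scale _ ht, coneMeasure_pos _, hz2⟩
  · obtain ⟨h1, T, hT, hTx, hTV⟩ := h.rect
    exact ⟨h1, T, hT.aemeasurable, hTx, hTV⟩
  · intro heq
    rw [heq] at hz1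
    -- If the cones coincided, their measure would vanish off two disjoint sets, hence everywhere,
    -- against positivity of its mass.
    have h1 : (coneVarifold (LinearIsometryEquiv.refl ℝ E4)).toMeasure Set.univ = 0 := by
      refine measure_mono_null (fun p _ => ?_) (measure_union_null hz1 hz2)
      by_contra hp
      rw [Set.mem_union, not_or, Set.notMem_compl_iff, Set.notMem_compl_iff] at hp
      exact Set.disjoint_left.1 disjoint_radialSet hp.1 hp.2
    exact (coneMeasure_pos _).ne' h1
  · have : ¬Even (2 * i + 1) := by simp
    exact if_neg this
  · exact tendsto_atTop_mono (fun i => (by omega : i ≤ 2 * i + 1)) tendsto_id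
  · have : Even (2 * i + 1 + 1) := by simp [Nat.even_add_one]
    exact if_pos this
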